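/- Let $U$ be a compact connected (Hausdorff) Lie group with Lie algebra $\mathfrak u$, let $\sigma$ be a smooth involutive automorphism of $U$, and let $K$ be a closed subgroup of $U$ with $(U^\sigma)_0\subseteq K\subseteq U^\sigma$, so that $U/K$ is a compact symmetric space with base point $o=eK$. Let $\mathfrak u=\mathfrak k\oplus\mathfrak p$ be the decomposition into the $+1$ and $-1$ eigenspaces of $d\sigma$, let $\operatorname{Exp}:\mathfrak p\to U/K$, $\operatorname{Exp}X=\exp(X)K$, and let $\mathfrak a\subseteq\mathfrak p$ be a maximal abelian subspace, with lattice $\Gamma=\{\gamma\in\mathfrak a:\exp\gamma\in K\}=\{\gamma\in\mathfrak a:\operatorname{Exp}\gamma=o\}$, so that $\mathfrak a/\Gamma$ is the torus $\operatorname{Exp}\mathfrak a$. Let $dX$ be a Lebesgue (Haar) measure on $\mathfrak p$, let $J(X)$ be the Jacobian determinant of $\operatorname{Exp}$ at $X$ (the tangent space of $U/K$ at $\operatorname{Exp}X$ being identified with $\mathfrak p$ by translation by $\exp X$), and let $dx$ be the $U$-invariant finite measure on $U/K$ normalised so that $dx=|J(X)|\,dX$ in the coordinates given by $\operatorname{Exp}$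 near $o$. Let $j:\mathfrak p\to\mathbb R$ be a real square root of the Jacobian in the sense that $j^2=|J|$. For a function $\varphi$ on $\mathfrak p$, its wrap $\Phi(\varphi)$ is the functional $$(\Phi(\varphi),f)=\int_{\mathfrak p}\varphi(X)\,j(X)\,f(\operatorname{Exp}X)\,dX,\qquad f\in C^\infty(U/K).$$ Let $\mu$ be an $\operatorname{Ad}(K)$-invariant complex-valued Schwartz function on $\mathfrak p$. Then the integral defining $(\Phi(j\mu),f)$ converges absolutely for every $f\in C^\infty(U/K)$, and $\Phi(j\mu)$ is given by a continuous $K$-invariant function on $U/K$: there is a continuous $K$-invariant function $\Psi:U/K\to\mathbb C$ with $$(\Phi(j\mu),f)=\int_{U/K}\Psi(x)f(x)\,dx\qquad\text{for all } f\in C^\infty(U/K),$$ and, writing $\Phi(j\mu)$ also for this function, it is on the torus the periodization of $\mu$ over $\Gamma$: $$\Phi(j\mu)(\operatorname{Exp} H)=\sum_{\gamma\in\Gamma}\mu(H+\gamma),\qquad H\in\mathfrak a,$$ where the sum converges absolutely. -/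

import Mathlib

open scoped Manifold ContDiff Topology
open MeasureTheory

/-! Throughout, `U` is a real Lie group modelled on the finite-dimensional space `E`. In Mathlib the
tangent space of `U` at each point is, by definition, the vector space `E`; in particular the
Lie algebra `T₁U` of `U` is `E`, and it is written `E` below so that it carries a norm. -/

noncomputable section

namespace Wrapping

/-- `γ` is the one-parameter subgroup of `U` with initial velocity `X`. -/
structure IsOneParameterSubgroup {E : Type*} [NormedAddCommGroup E] [NormedSpace ℝ E]
    {U : Type*} [TopologicalSpace U] [ChartedSpace E U] [Group U] (X : E) (γ : ℝ → U) : Prop where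
  map_add : ∀ s t : ℝ, γ (s + t) = γ s * γ t
  hasMFDerivAt : HasMFDerivAt 𝓘(ℝ, ℝ) 𝓘(ℝ, E) γ 0 (ContinuousLinearMap.toSpanSingleton ℝ X)

open Classical in
/-- The exponential map of the Lie group `U`: the value at time `1` of the one-parameter subgroup
with initial velocity `X`. -/
def lieExp {E : Type*} [NormedAddCommGroup E] [NormedSpace ℝ E]
    (U : Type*) [TopologicalSpace U] [ChartedSpace E U] [Group U] (X : E) : U :=
  if h : ∃ γ : ℝ → U, IsOneParameterSubgroup X γ then h.choose 1 else 1

/-- The adjoint action of `u` on the Lie algebra: the differential at `1` of `v ↦ u v u⁻¹`. -/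
def lieAd {E : Type*} [NormedAddCommGroup E] [NormedSpace ℝ E]
    {U : Type*} [TopologicalSpace U] [ChartedSpace E U] [Group U] (u : U) : E →L[ℝ] E :=
  mfderiv 𝓘(ℝ, E) 𝓘(ℝ, E) (fun v : U => u * v * u⁻¹) 1

/-- The Lie bracket of `T₁U`, as defined in Mathlib through left-invariant vector fields. -/
def lieBr {E : Type*} [NormedAddCommGroup E] [NormedSpace ℝ E]
    (U : Type*) [TopologicalSpace U] [ChartedSpace E U] [Group U] (X Y : E) : E :=
  Bracket.bracket (L := GroupLieAlgebra 𝓘(ℝ, E) U) (M := GroupLieAlgebra 𝓘(ℝ, E) U) X Y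

/-- A symmetric pair `(U, K)`: an involutive smooth automorphism `σ` of `U`, and a closed
subgroup `K` lying between the identity component of the fixed point group of `σ` and that
group. For compact connected `U`, the space `U ⧸ K` is a compact symmetric space. -/
structure SymmetricPair (E : Type*) [NormedAddCommGroup E] [NormedSpace ℝ E]
    (U : Type*) [TopologicalSpace U] [ChartedSpace E U] [Group U] where
  /-- the involution -/
  σ : U →* U
  smooth_σ : ContMDiff 𝓘(ℝ, E) 𝓘(ℝ, E) ∞ σ
  invol : ∀ u, σ (σ u) = u
  /-- the isotropy subgroup -/
  K : Subgroup U
  isClosed_K : IsClosed (K : Set U)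
  fixed_of_mem : ∀ u ∈ K, σ u = u
  component_subset : connectedComponentIn {u : U | σ u = u} 1 ⊆ K

namespace SymmetricPair

variable {E : Type*} [NormedAddCommGroup E] [NormedSpace ℝ E]
  {U : Type*} [TopologicalSpace U] [ChartedSpace E U] [Group U] (S : SymmetricPair E U)

/-- The differential of `σ` at the identity. -/
def dσ : E →L[ℝ] E := mfderiv 𝓘(ℝ, E) 𝓘(ℝ, E) S.σ 1

theorem dσ_dσ (X : E) : S.dσ (S.dσ X) = X := by
  have key : ∀ u : U, u = 1 →
      (mfderiv 𝓘(ℝ, E) 𝓘(ℝ, E) S.σ u : E →L[ℝ] E) = S.dσ := by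
    rintro _ rfl; rfl
  have hd : MDifferentiable 𝓘(ℝ, E) 𝓘(ℝ, E) S.σ := S.smooth_σ.mdifferentiable (by simp)
  have hc : (S.σ ∘ S.σ : U → U) = id := funext S.invol
  have h1 := mfderiv_comp (1 : U) (hd (S.σ 1)) (hd 1)
  rw [hc, mfderiv_id] at h1
  have h2 := congrArg (fun L : E →L[ℝ] E => L X) h1
  have h3 := congrArg (fun L : E →L[ℝ] E => L (S.dσ X)) (key (S.σ 1) (map_one S.σ))
  exact h3.symm.trans h2.symm

/-- The tangent space `𝔭` of `U ⧸ K` at the base point: the `-1` eigenspace of `dσ`. -/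
def p : Submodule ℝ E := LinearMap.ker ((S.dσ : E →ₗ[ℝ] E) + LinearMap.id)

/-- The projection of `T₁U = 𝔨 ⊕ 𝔭` onto `𝔭` along the `+1` eigenspace `𝔨` of `dσ`. -/
def projP : E →ₗ[ℝ] S.p :=
  LinearMap.codRestrict S.p ((2 : ℝ)⁻¹ • (LinearMap.id - (S.dσ : E →ₗ[ℝ] E))) (fun X => by
    simp [p, S.dσ_dσ])

/-- The exponential map `Exp : 𝔭 → U ⧸ K`, `Exp X = exp X · K`. -/
def Exp (X : S.p) : U ⧸ S.K := ((lieExp U (X : E) : U) : U ⧸ S.K)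

/-- The differential at `X` of `𝔭 → U`, `Y ↦ exp(X)⁻¹ exp(Y)`, with values in `T₁U`; it sends `Y`
to `d/dt exp(X)⁻¹ exp(X + tY)` at `t = 0`. -/
def dexp (X : S.p) : S.p →L[ℝ] E :=
  mfderiv 𝓘(ℝ, S.p) 𝓘(ℝ, E) (fun Y : S.p => (lieExp U (X : E))⁻¹ * lieExp U (Y : E)) X

/-- The Jacobian determinant of `Exp` at `X`: the tangent space of `U ⧸ K` at `Exp X` is identified
with `𝔭` by means of the translation by `exp X`, and `dExp_X` becomes the endomorphism
`Y ↦ proj_𝔭 (d/dt exp(X)⁻¹ exp(X + tY) at t = 0)` of `𝔭`. -/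
def jacobian (X : S.p) : ℝ :=
  LinearMap.det (S.projP ∘ₗ (S.dexp X : S.p →ₗ[ℝ] E))

/-- `j` is a real square root of the (absolute value of the) Jacobian of `Exp`. This covers both
`j = |J| ^ (1/2)` and, where it is real, the analytic square root of `J`. -/
def IsJacobianRoot (j : S.p → ℝ) : Prop := ∀ X, j X ^ 2 = |S.jacobian X|

theorem isJacobianRoot_sqrt : S.IsJacobianRoot (fun X => √|S.jacobian X|) :=
  fun _ => Real.sq_sqrt (abs_nonneg _)

/-- `𝔞` is a maximal abelian subspace of `𝔭`. -/
def IsMaximalAbelian (𝔞 : Submodule ℝ S.p) : Prop :=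
  Maximal (fun 𝔟 : Submodule ℝ S.p => ∀ X ∈ 𝔟, ∀ Y ∈ 𝔟, lieBr U (X : E) (Y : E) = 0) 𝔞

/-- The lattice `Γ` of those `γ ∈ 𝔞` with `Exp γ = o`, that is `exp γ ∈ K`; thus `𝔞 / Γ` is the
torus `Exp 𝔞` in `U ⧸ K`. -/
def lattice (𝔞 : Submodule ℝ S.p) : Set S.p := {γ | γ ∈ 𝔞 ∧ lieExp U (γ : E) ∈ S.K}

/-- `φ` is invariant under the adjoint action of `K` on `𝔭`. -/
def IsKInvariant (φ : S.p → ℂ) : Prop :=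
  ∀ k ∈ S.K, ∀ X Y : S.p, (Y : E) = lieAd k (X : E) → φ Y = φ X

/-- `f` is a smooth function on `U ⧸ K`: its lift to `U` is smooth. -/
def IsSmooth (f : U ⧸ S.K → ℂ) : Prop :=
  ContMDiff 𝓘(ℝ, E) 𝓘(ℝ, ℂ) ∞ (fun u : U => f (u : U ⧸ S.K))

variable [MeasurableSpace E] [MeasurableSpace U]

/-- `ν` is the `U`-invariant measure `dx` on `U ⧸ K` that corresponds to the Lebesgue measure
`vol = dX` of `𝔭`: it is finite, `U`-invariant, and satisfies `dx = |J(X)| dX` in the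
coordinates given by `Exp` on a neighbourhood of `0`. -/
structure IsInvariantVolume (vol : Measure S.p) (ν : Measure (U ⧸ S.K)) : Prop where
  finite : IsFiniteMeasure ν
  invariant : SMulInvariantMeasure U (U ⧸ S.K) ν
  normalized : ∃ V ∈ 𝓝 (0 : S.p), Set.InjOn S.Exp V ∧
    ∀ s ⊆ V, MeasurableSet s →
      ν (S.Exp '' s) = ∫⁻ X in s, ENNReal.ofReal |S.jacobian X| ∂vol

/-- The wrap `Φ(φ)` of a function `φ` on `𝔭`, as a functional of test functions `f` on `U ⧸ K`:
`(Φ(φ), f) = (φ, j · f ∘ Exp)`. -/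
def wrap (vol : Measure S.p) (j : S.p → ℝ) (φ : S.p → ℂ) (f : U ⧸ S.K → ℂ) : ℂ :=
  ∫ X, φ X * ((j X : ℂ) * f (S.Exp X)) ∂vol

end SymmetricPair

end Wrapping

end

/-! Since j² = |J|, the pairing of Φ(jμ) with f is the integral of |J(X)| μ(X) f(Exp X) over 𝔭.
Integrating over the fibres of Exp turns it into the integral over y in U/K of f(y) times the sum of
μ over Exp⁻¹(y). It remains to see that this fibre sum is, for almost every y, a periodization of μ
over Γ, and that the periodization extends from the torus to a continuous K-invariant function.

Integration over the fibres is `integral_abs_jacobian_mul`. It rests on `exists_normal_form`: near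
any X₀, Exp is the translate by exp X₀ of Exp near 0 composed with a C¹ map of 𝔭. The normalisation
of dx near o therefore propagates to all of 𝔭, and the critical values of Exp form a null set.

For the fibres, let Exp X = Exp X' with J(X) ≠ 0. Then exp 2X = exp 2X', so T = [X, X'], which lies
in 𝔨, is fixed by Ad(exp 2X), and the differential of Exp at X kills [T, X]. Hence (ad X)² X' = 0,
and since ad X is skew for an invariant inner product, [X, X'] = 0 (`lieBr_eq_zero_of_Exp_eq`).
Outside a null set the centraliser of X in 𝔭 has dimension at most dim 𝔞 (`exists_finrank_ker_le`),
so it is a conjugate Ad(u)𝔞, and the fibre through X = Ad(u)H is Ad(u)(H + Γ) (`exists_fiber`). As μ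
is Ad(K)-invariant, its sum over the fibre is the periodization at H.

For continuity, the decomposition U = K exp(𝔞) K with bounded 𝔞-part (`exists_decomposition`)
presents U/K as a quotient of K times a compact piece of 𝔞. The periodization descends because two
points of the torus in one K-orbit differ by an element of K preserving 𝔞 and a lattice vector
(`exists_weyl`), both of which leave it unchanged. These structural facts come from Hunt's maximum
argument applied to stabilisers in K.

The exponential map is constructed from integral curves of left-invariant fields. Its differential,
the integral of Ad(exp(-tX)) over 0 ≤ t ≤ 1, is obtained by a direct estimate uniform in X. -/

noncomputable section

namespace Wrapping

/-! ### The chart at the identity. -/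

section Chart

set_option linter.unusedSectionVars false

variable {E : Type*} [NormedAddCommGroup E] [NormedSpace ℝ E]
  {U : Type*} [TopologicalSpace U] [ChartedSpace E U] [Group U]
  {F : Type*} [NormedAddCommGroup F] [NormedSpace ℝ F]

variable (E U) in
/-- The preferred chart at the identity, translated so that it sends the identity to `0`. -/
def chartOne : OpenPartialHomeomorph U E :=
  (chartAt E (1 : U)).transHomeomorph (Homeomorph.addRight (-(chartAt E (1 : U) 1)))

theorem chartOne_apply (u : U) : chartOne E U u = chartAt E (1 : U) u - chartAt E (1 : U) 1 := by
  simp [chartOne, sub_eq_add_neg]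

theorem chartOne_symm_apply (z : E) :
    (chartOne E U).symm z = (chartAt E (1 : U)).symm (z + chartAt E (1 : U) 1) := by
  simp [chartOne, Homeomorph.addRight_symm]

theorem chartOne_source : (chartOne E U).source = (chartAt E (1 : U)).source := by
  simp [chartOne]

@[simp] theorem one_mem_chartOne_source : (1 : U) ∈ (chartOne E U).source := by
  rw [chartOne_source]; exact mem_chart_source E 1

@[simp] theorem chartOne_one : chartOne E U (1 : U) = (0 : E) := by
  simp [chartOne_apply]

@[simp] theorem zero_mem_chartOne_target : (0 : E) ∈ (chartOne E U).target := by
  rw [← chartOne_one (U := U)]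
  exact (chartOne E U).map_source one_mem_chartOne_source

@[simp] theorem chartOne_symm_zero : (chartOne E U).symm (0 : E) = 1 := by
  rw [← chartOne_one (U := U)]
  exact (chartOne E U).left_inv one_mem_chartOne_source

theorem chartOne_source_mem_nhds : (chartOne E U).source ∈ 𝓝 (1 : U) :=
  (chartOne E U).open_source.mem_nhds one_mem_chartOne_source

theorem chartOne_target_mem_nhds : (chartOne E U).target ∈ 𝓝 (0 : E) :=
  (chartOne E U).open_target.mem_nhds zero_mem_chartOne_target

/-- A manifold derivative at `x` is read in the preferred chart at `g x`, which is here the chart at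
1; subtracting a constant from the chart does not change derivatives. -/
theorem hasMFDerivAt_iff_chartOne {g : F → U} {x : F} {L : F →L[ℝ] E} (hg : g x = 1) :
    HasMFDerivAt 𝓘(ℝ, F) 𝓘(ℝ, E) g x L ↔
      ContinuousAt g x ∧ HasFDerivAt (fun y => chartOne E U (g y)) L x := by
  unfold HasMFDerivAt
  refine and_congr Iff.rfl ?_
  -- The base point of the chart is generalised to `v`, so that it can be replaced by 1 without
  -- touching `g`.
  have : ∀ v : U, g x = v → v = 1 → (HasFDerivWithinAt (fun y => extChartAt 𝓘(ℝ, E) v (g y)) L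
      Set.univ x ↔ HasFDerivAt (fun y => chartOne E U (g y)) L x) := by
    rintro v - rfl
    rw [hasFDerivWithinAt_univ]
    simp only [chartOne_apply, mfld_simps]
    exact (hasFDerivAt_sub_const_iff _).symm
  rw [show Set.range 𝓘(ℝ, F) = Set.univ from Set.range_id]
  exact this (g x) rfl hg

variable [LieGroup 𝓘(ℝ, E) ∞ U]


theorem contMDiffAt_chartOne {u : U} (hu : u ∈ (chartOne E U).source) :
    ContMDiffAt 𝓘(ℝ, E) 𝓘(ℝ, E) ∞ (chartOne E U) u := by
  have : IsManifold 𝓘(ℝ, E) ∞ U := inferInstance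
  have h : ContMDiffAt 𝓘(ℝ, E) 𝓘(ℝ, E) ∞ (chartAt E (1 : U)) u := by
    refine contMDiffAt_of_mem_maximalAtlas (IsManifold.chart_mem_maximalAtlas 1) ?_
    rwa [chartOne_source] at hu
  refine (h.sub (contMDiffAt_const (c := chartAt E (1 : U) 1))).congr_of_eventuallyEq ?_
  exact Filter.Eventually.of_forall chartOne_apply

theorem contMDiffAt_chartOne_symm {z : E} (hz : z ∈ (chartOne E U).target) :
    ContMDiffAt 𝓘(ℝ, E) 𝓘(ℝ, E) ∞ (chartOne E U).symm z := by
  have h : ContMDiffAt 𝓘(ℝ, E) 𝓘(ℝ, E) ∞ (chartAt E (1 : U)).symm (z + chartAt E (1 : U) 1) := by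
    refine contMDiffAt_symm_of_mem_maximalAtlas (IsManifold.chart_mem_maximalAtlas 1) ?_
    simpa [chartOne, Homeomorph.addRight_symm] using hz
  have h2 : ContMDiffAt 𝓘(ℝ, E) 𝓘(ℝ, E) ∞ (fun z : E => z + chartAt E (1 : U) 1) z := by
    rw [contMDiffAt_iff_contDiffAt]; fun_prop
  refine (h.comp z h2).congr_of_eventuallyEq ?_
  exact Filter.Eventually.of_forall chartOne_symm_apply

theorem contDiffAt_chartOne_comp {n : WithTop ℕ∞} (hn : n ≤ ∞) {g : F → U} {x : F}
    (hg : ContMDiffAt 𝓘(ℝ, F) 𝓘(ℝ, E) n g x) (hx : g x ∈ (chartOne E U).source) :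
    ContDiffAt ℝ n (fun y => chartOne E U (g y)) x := by
  rw [← contMDiffAt_iff_contDiffAt]
  exact ((contMDiffAt_chartOne hx).of_le hn).comp x hg

theorem contMDiffAt_of_chartOne {n : WithTop ℕ∞} (hn : n ≤ ∞) {g : F → U} {x : F}
    (hc : ContinuousAt g x) (hx : g x ∈ (chartOne E U).source)
    (hg : ContDiffAt ℝ n (fun y => chartOne E U (g y)) x) :
    ContMDiffAt 𝓘(ℝ, F) 𝓘(ℝ, E) n g x := by
  have h1 : ContMDiffAt 𝓘(ℝ, F) 𝓘(ℝ, E) n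
      (fun y => (chartOne E U).symm (chartOne E U (g y))) x :=
    ContMDiffAt.comp (I' := 𝓘(ℝ, E)) x
      ((contMDiffAt_chartOne_symm ((chartOne E U).map_source hx)).of_le hn)
      (contMDiffAt_iff_contDiffAt.2 hg)
  refine h1.congr_of_eventuallyEq ?_
  filter_upwards [hc.eventually ((chartOne E U).open_source.mem_nhds hx)] with y hy
  exact ((chartOne E U).left_inv hy).symm

theorem hasMFDerivAt_chartOne_symm :
    HasMFDerivAt 𝓘(ℝ, E) 𝓘(ℝ, E) (chartOne E U).symm (0 : E) (ContinuousLinearMap.id ℝ E) := by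
  rw [hasMFDerivAt_iff_chartOne chartOne_symm_zero]
  refine ⟨(contMDiffAt_chartOne_symm (U := U) zero_mem_chartOne_target).continuousAt, ?_⟩
  refine (hasFDerivAt_id (0 : E)).congr_of_eventuallyEq ?_
  filter_upwards [chartOne_target_mem_nhds (U := U)] with y hy
  exact (chartOne E U).right_inv hy

/-- A self-map of `U` fixing the identity, read in the chart at the identity. -/
theorem hasFDerivAt_chartOne_conj {f : U → U} (h1 : f 1 = 1)
    (hf : MDifferentiableAt 𝓘(ℝ, E) 𝓘(ℝ, E) f 1) :
    HasFDerivAt (fun z : E => chartOne E U (f ((chartOne E U).symm z)))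
      (mfderiv 𝓘(ℝ, E) 𝓘(ℝ, E) f 1 : E →L[ℝ] E) 0 := by
  have hs := hasMFDerivAt_chartOne_symm (E := E) (U := U)
  have key : ∀ u : U, u = 1 → HasMFDerivAt 𝓘(ℝ, E) 𝓘(ℝ, E) f u
      (mfderiv 𝓘(ℝ, E) 𝓘(ℝ, E) f 1 : E →L[ℝ] E) := by
    rintro _ rfl; exact hf.hasMFDerivAt
  have h2 := HasMFDerivAt.comp (0 : E) (key _ chartOne_symm_zero) hs
  have h3 := (hasMFDerivAt_iff_chartOne (g := f ∘ (chartOne E U).symm) (x := (0 : E))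
    (by simp [h1])).1 h2
  simpa [Function.comp_def] using! h3.2

end Chart

end Wrapping

end

noncomputable section

namespace Wrapping

/-! ### Left-trivialised derivatives and the adjoint representation. -/

section LocalGroup

set_option linter.unusedSectionVars false

variable {E : Type*} [NormedAddCommGroup E] [NormedSpace ℝ E]
  {U : Type*} [TopologicalSpace U] [ChartedSpace E U] [Group U] [LieGroup 𝓘(ℝ, E) ∞ U]
  [IsTopologicalGroup U]
  {F : Type*} [NormedAddCommGroup F] [NormedSpace ℝ F]
  {F' : Type*} [NormedAddCommGroup F'] [NormedSpace ℝ F']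

variable (E U) in
/-- The group law read in the chart at the identity. -/
def mulChart (q : E × E) : E := chartOne E U ((chartOne E U).symm q.1 * (chartOne E U).symm q.2)

theorem contDiffAt_mulChart {q : E × E} (h1 : q.1 ∈ (chartOne E U).target)
    (h2 : q.2 ∈ (chartOne E U).target)
    (h3 : (chartOne E U).symm q.1 * (chartOne E U).symm q.2 ∈ (chartOne E U).source) :
    ContDiffAt ℝ ∞ (mulChart E U) q := by
  refine contDiffAt_chartOne_comp le_rfl (ContMDiffAt.mul ?_ ?_) h3
  · exact ContMDiffAt.comp (I' := 𝓘(ℝ, E)) q (contMDiffAt_chartOne_symm h1)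
      (contMDiffAt_iff_contDiffAt.2 contDiffAt_fst)
  · exact ContMDiffAt.comp (I' := 𝓘(ℝ, E)) q (contMDiffAt_chartOne_symm h2)
      (contMDiffAt_iff_contDiffAt.2 contDiffAt_snd)

theorem contDiffAt_mulChart_zero : ContDiffAt ℝ ∞ (mulChart E U) 0 :=
  contDiffAt_mulChart (by simp) (by simp) (by simp)

theorem mulChart_zero_left {y : E} (hy : y ∈ (chartOne E U).target) :
    mulChart E U (0, y) = y := by
  simp [mulChart, (chartOne E U).right_inv hy]

theorem mulChart_zero_right {x : E} (hx : x ∈ (chartOne E U).target) :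
    mulChart E U (x, 0) = x := by
  simp [mulChart, (chartOne E U).right_inv hx]

theorem chartOne_mul {u v : U} (hu : u ∈ (chartOne E U).source)
    (hv : v ∈ (chartOne E U).source) :
    chartOne E U (u * v) = mulChart E U (chartOne E U u, chartOne E U v) := by
  simp [mulChart, (chartOne E U).left_inv hu, (chartOne E U).left_inv hv]

/-- A differential on a product is determined by its restrictions to the two axes, and there the
unit law makes the group law the identity. -/
theorem hasFDerivAt_mulChart_zero :
    HasFDerivAt (mulChart E U)
      (ContinuousLinearMap.fst ℝ E E + ContinuousLinearMap.snd ℝ E E) 0 := by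
  have hd : HasFDerivAt (mulChart E U) (fderiv ℝ (mulChart E U) 0) 0 :=
    (contDiffAt_mulChart_zero.differentiableAt (by simp)).hasFDerivAt
  have e1 : HasFDerivAt (fun x : E => mulChart E U (x, 0)) (ContinuousLinearMap.id ℝ E) 0 := by
    refine (hasFDerivAt_id (0 : E)).congr_of_eventuallyEq ?_
    filter_upwards [chartOne_target_mem_nhds (E := E) (U := U)] with y hy
    exact mulChart_zero_right hy
  have e2 : HasFDerivAt (fun x : E => mulChart E U (0, x)) (ContinuousLinearMap.id ℝ E) 0 := by
    refine (hasFDerivAt_id (0 : E)).congr_of_eventuallyEq ?_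
    filter_upwards [chartOne_target_mem_nhds (E := E) (U := U)] with y hy
    exact mulChart_zero_left hy
  have f1 := HasFDerivAt.comp (0 : E) (f := fun x : E => (x, (0 : E))) hd
    (hasFDerivAt_prodMk_left (0 : E) (0 : E))
  have f2 := HasFDerivAt.comp (0 : E) (f := fun x : E => ((0 : E), x)) hd
    (hasFDerivAt_prodMk_right (0 : E) (0 : E))
  have g1 := e1.unique f1
  have g2 := e2.unique f2
  convert hd using 1
  ext x
  · simpa using! congrArg (fun T : E →L[ℝ] E => T x) g1
  · simpa using! congrArg (fun T : E →L[ℝ] E => T x) g2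

/-- The map `g` into the Lie group has left-trivialised derivative `L` at `x`: the derivative of
`y ↦ g(x)⁻¹ g(y)` at `x` is `L`. -/
structure HasLeftDeriv (g : F → U) (L : F →L[ℝ] E) (x : F) : Prop where
  continuousAt : ContinuousAt g x
  hasFDerivAt : HasFDerivAt (fun y => chartOne E U ((g x)⁻¹ * g y)) L x

theorem hasLeftDeriv_iff_hasMFDerivAt {g : F → U} {L : F →L[ℝ] E} {x : F} :
    HasLeftDeriv g L x ↔
      HasMFDerivAt 𝓘(ℝ, F) 𝓘(ℝ, E) (fun y => (g x)⁻¹ * g y) x L := by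
  rw [hasMFDerivAt_iff_chartOne (by simp)]
  constructor
  · rintro ⟨h1, h2⟩
    exact ⟨continuousAt_const.mul h1, h2⟩
  · rintro ⟨h1, h2⟩
    refine ⟨?_, h2⟩
    simpa [Pi.mul_def] using (continuousAt_const (y := g x)).mul h1

theorem hasLeftDeriv_of_eq_one {g : F → U} {L : F →L[ℝ] E} {x : F} (h1 : g x = 1)
    (hc : ContinuousAt g x) (h : HasFDerivAt (fun y => chartOne E U (g y)) L x) :
    HasLeftDeriv g L x :=
  ⟨hc, by simpa [h1] using h⟩

namespace HasLeftDeriv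

variable {g h : F → U} {L M : F →L[ℝ] E} {x : F}

theorem unique (h1 : HasLeftDeriv g L x) (h2 : HasLeftDeriv g M x) : L = M :=
  h1.hasFDerivAt.unique h2.hasFDerivAt

theorem congr_deriv (h1 : HasLeftDeriv g L x) (e : L = M) : HasLeftDeriv g M x := e ▸ h1

theorem congr_of_eventuallyEq (h1 : HasLeftDeriv g L x) (e : h =ᶠ[𝓝 x] g) :
    HasLeftDeriv h L x := by
  refine ⟨h1.continuousAt.congr e.symm, h1.hasFDerivAt.congr_of_eventuallyEq ?_⟩
  filter_upwards [e] with y hy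
  rw [hy, e.self_of_nhds]

theorem comp_fderiv {f : F' → F} {x' : F'} {f' : F' →L[ℝ] F} (h1 : HasLeftDeriv g L (f x'))
    (hf : HasFDerivAt f f' x') : HasLeftDeriv (fun y => g (f y)) (L.comp f') x' :=
  ⟨ContinuousAt.comp h1.continuousAt hf.continuousAt, h1.hasFDerivAt.comp x' hf⟩

theorem const_mul (h1 : HasLeftDeriv g L x) (u : U) : HasLeftDeriv (fun y => u * g y) L x :=
  ⟨continuousAt_const.mul h1.continuousAt, by simpa [mul_assoc] using h1.hasFDerivAt⟩

theorem one_mul_aux (h1 : HasLeftDeriv g L x) (hg : g x = 1) :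
    HasFDerivAt (fun y => chartOne E U (g y)) L x := by
  simpa [hg] using h1.hasFDerivAt

theorem mul_of_eq_one (h1 : HasLeftDeriv g L x) (h2 : HasLeftDeriv h M x)
    (hg : g x = 1) (hh : h x = 1) : HasLeftDeriv (fun y => g y * h y) (L + M) x := by
  refine hasLeftDeriv_of_eq_one (by simp [hg, hh]) (h1.continuousAt.mul h2.continuousAt) ?_
  have hm : HasFDerivAt (mulChart E U) (ContinuousLinearMap.fst ℝ E E +
      ContinuousLinearMap.snd ℝ E E) (chartOne E U (g x), chartOne E U (h x)) := by
    rw [hg, hh, chartOne_one]; exact hasFDerivAt_mulChart_zero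
  have h3 := HasFDerivAt.comp x hm ((h1.one_mul_aux hg).prodMk (h2.one_mul_aux hh))
  refine HasFDerivAt.congr_of_eventuallyEq (h3.congr_fderiv ?_) ?_
  · ext v; simp
  · have s1 : ∀ᶠ y in 𝓝 x, g y ∈ (chartOne E U).source :=
      h1.continuousAt.eventually (by rw [hg]; exact chartOne_source_mem_nhds)
    have s2 : ∀ᶠ y in 𝓝 x, h y ∈ (chartOne E U).source :=
      h2.continuousAt.eventually (by rw [hh]; exact chartOne_source_mem_nhds)
    filter_upwards [s1, s2] with y hy1 hy2
    exact chartOne_mul hy1 hy2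

end HasLeftDeriv

theorem contMDiff_conj (u : U) :
    ContMDiff 𝓘(ℝ, E) 𝓘(ℝ, E) ∞ (fun v : U => u * v * u⁻¹) :=
  (contMDiff_const.mul contMDiff_id).mul contMDiff_const

theorem hasFDerivAt_lieAd (u : U) :
    HasFDerivAt (fun z : E => chartOne E U (u * (chartOne E U).symm z * u⁻¹)) (lieAd u) 0 :=
  hasFDerivAt_chartOne_conj (f := fun v : U => u * v * u⁻¹) (by simp)
    ((contMDiff_conj u).mdifferentiable (by simp) 1)

theorem HasLeftDeriv.map_of_eq_one {g : F → U} {L : F →L[ℝ] E} {x : F}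
    (h1 : HasLeftDeriv g L x) (hg : g x = 1) {f : U → U} (hf1 : f 1 = 1)
    (hc : ContinuousAt f 1) {A : E →L[ℝ] E}
    (hf : HasFDerivAt (fun z : E => chartOne E U (f ((chartOne E U).symm z))) A 0) :
    HasLeftDeriv (fun y => f (g y)) (A.comp L) x := by
  refine hasLeftDeriv_of_eq_one (by simp [hg, hf1])
    (ContinuousAt.comp (by rwa [hg]) h1.continuousAt) ?_
  have hf' : HasFDerivAt (fun z : E => chartOne E U (f ((chartOne E U).symm z))) A
      (chartOne E U (g x)) := by simpa [hg] using hf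
  refine (hf'.comp x (h1.one_mul_aux hg)).congr_of_eventuallyEq ?_
  have s1 : ∀ᶠ y in 𝓝 x, g y ∈ (chartOne E U).source :=
    h1.continuousAt.eventually (by rw [hg]; exact chartOne_source_mem_nhds)
  filter_upwards [s1] with y hy
  simp [(chartOne E U).left_inv hy]

namespace HasLeftDeriv

variable {g h : F → U} {L M : F →L[ℝ] E} {x : F}

theorem conj (h1 : HasLeftDeriv g L x) (hg : g x = 1) (u : U) :
    HasLeftDeriv (fun y => u * g y * u⁻¹) ((lieAd u).comp L) x :=
  h1.map_of_eq_one hg (f := fun v => u * v * u⁻¹) (by simp)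
    (by fun_prop) (hasFDerivAt_lieAd u)

theorem left_translate (h1 : HasLeftDeriv g L x) : HasLeftDeriv (fun y => (g x)⁻¹ * g y) L x :=
  h1.const_mul _

/-- With a = g(x) and b = h(x), write g(y)h(y) = ab · (b⁻¹(a⁻¹g(y))b) · (b⁻¹h(y)): the last two
factors are 1 at x, where derivatives simply add, and the first of them is a conjugate. -/
theorem mul (h1 : HasLeftDeriv g L x) (h2 : HasLeftDeriv h M x) :
    HasLeftDeriv (fun y => g y * h y) ((lieAd (h x)⁻¹).comp L + M) x := by
  have a1 := h1.left_translate.conj (by simp) (h x)⁻¹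
  have a2 := (a1.mul_of_eq_one h2.left_translate (by simp) (by simp)).const_mul (g x * h x)
  refine a2.congr_of_eventuallyEq (Filter.Eventually.of_forall fun y => ?_)
  simp only [inv_inv]; group

end HasLeftDeriv

theorem hasLeftDeriv_chartOne_symm :
    HasLeftDeriv (chartOne E U).symm (ContinuousLinearMap.id ℝ E) (0 : E) := by
  have h := (hasMFDerivAt_iff_chartOne chartOne_symm_zero).1
    (hasMFDerivAt_chartOne_symm (E := E) (U := U))
  exact hasLeftDeriv_of_eq_one chartOne_symm_zero h.1 h.2

theorem lieAd_unique {u : U} {A : E →L[ℝ] E}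
    (h : HasLeftDeriv (fun z : E => u * (chartOne E U).symm z * u⁻¹) A 0) : lieAd u = A := by
  have := (hasLeftDeriv_chartOne_symm (E := E) (U := U)).conj (by simp) u
  simpa using this.unique h

@[simp] theorem lieAd_one : (lieAd (1 : U) : E →L[ℝ] E) = ContinuousLinearMap.id ℝ E :=
  lieAd_unique (by simpa using hasLeftDeriv_chartOne_symm (E := E) (U := U))

theorem lieAd_mul (u v : U) : (lieAd (u * v) : E →L[ℝ] E) = (lieAd u).comp (lieAd v) := by
  refine lieAd_unique ?_
  have h := ((hasLeftDeriv_chartOne_symm (E := E) (U := U)).conj (by simp) v).conj (by simp) u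
  simpa [mul_assoc] using h

theorem lieAd_mul_apply (u v : U) (X : E) : lieAd (u * v) X = lieAd u (lieAd v X) := by
  rw [lieAd_mul]; rfl

@[simp] theorem lieAd_inv_apply_lieAd (u : U) (X : E) : lieAd u⁻¹ (lieAd u X) = X := by
  rw [← lieAd_mul_apply]; simp

@[simp] theorem lieAd_apply_lieAd_inv (u : U) (X : E) : lieAd u (lieAd u⁻¹ X) = X := by
  rw [← lieAd_mul_apply]; simp

/-- Ad is the partial derivative at w = 0 of the smooth map (z, w) ↦ z w z⁻¹ read in the chart. -/
theorem contDiffAt_lieAd_chartOne_symm :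
    ContDiffAt ℝ ∞ (fun z : E => (lieAd ((chartOne E U).symm z) : E →L[ℝ] E)) 0 := by
  let f : E → E → E := fun z w => chartOne E U
    ((chartOne E U).symm z * (chartOne E U).symm w * ((chartOne E U).symm z)⁻¹)
  have hf : ContDiffAt ℝ ∞ (Function.uncurry f) (0, 0) := by
    refine contDiffAt_chartOne_comp le_rfl (ContMDiffAt.mul (ContMDiffAt.mul ?_ ?_)
      (ContMDiffAt.inv ?_)) (by simp)
    · exact ContMDiffAt.comp (I' := 𝓘(ℝ, E)) ((0, 0) : E × E)
        (contMDiffAt_chartOne_symm (by simp)) (contMDiffAt_iff_contDiffAt.2 contDiffAt_fst)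
    · exact ContMDiffAt.comp (I' := 𝓘(ℝ, E)) ((0, 0) : E × E)
        (contMDiffAt_chartOne_symm (by simp)) (contMDiffAt_iff_contDiffAt.2 contDiffAt_snd)
    · exact ContMDiffAt.comp (I' := 𝓘(ℝ, E)) ((0, 0) : E × E)
        (contMDiffAt_chartOne_symm (by simp)) (contMDiffAt_iff_contDiffAt.2 contDiffAt_fst)
  have h2 : ContDiffAt ℝ ∞ (fun z => fderiv ℝ (f z) ((fun _ : E => (0 : E)) z)) 0 :=
    ContDiffAt.fderiv (n := ∞) (m := ∞) hf contDiffAt_const (by simp)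
  refine h2.congr_of_eventuallyEq (Filter.Eventually.of_forall fun z => ?_)
  exact (hasFDerivAt_lieAd ((chartOne E U).symm z)).fderiv.symm

/-- Continuity at 1 is read in the chart, and Ad(v) = Ad(u) Ad(u⁻¹v) transports it to every point.
-/
theorem continuous_lieAd : Continuous (fun u : U => (lieAd u : E →L[ℝ] E)) := by
  have h1 : ContinuousAt (fun u : U => (lieAd u : E →L[ℝ] E)) 1 := by
    have h2 : ContinuousAt (fun u : U =>
        (lieAd ((chartOne E U).symm (chartOne E U u)) : E →L[ℝ] E)) 1 := by
      refine ContinuousAt.comp (f := fun u : U => chartOne E U u)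
        (g := fun z : E => (lieAd ((chartOne E U).symm z) : E →L[ℝ] E)) ?_
        ((chartOne E U).continuousAt (by simp))
      simpa using (contDiffAt_lieAd_chartOne_symm (E := E) (U := U)).continuousAt
    refine h2.congr ?_
    filter_upwards [chartOne_source_mem_nhds (E := E) (U := U)] with u hu
    rw [(chartOne E U).left_inv hu]
  refine continuous_iff_continuousAt.2 fun u => ?_
  have h3 : ContinuousAt (fun v : U => (lieAd u : E →L[ℝ] E).comp (lieAd (u⁻¹ * v))) u := by
    refine ContinuousAt.clm_comp continuousAt_const ?_
    refine ContinuousAt.comp (f := fun v : U => u⁻¹ * v)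
      (g := fun v : U => (lieAd v : E →L[ℝ] E)) ?_
      (continuous_const.mul continuous_id).continuousAt
    simpa using h1
  refine h3.congr (Filter.Eventually.of_forall fun v => ?_)
  simp [← lieAd_mul]

end LocalGroup

end Wrapping

end

noncomputable section

namespace Wrapping

/-! ### Existence and uniqueness of one-parameter subgroups. -/

section OneParameter

set_option linter.unusedSectionVars false

variable {E : Type*} [NormedAddCommGroup E] [NormedSpace ℝ E]
  {U : Type*} [TopologicalSpace U] [ChartedSpace E U] [Group U]

namespace IsOneParameterSubgroup

variable {X : E} {γ : ℝ → U}

theorem map_zero (h : IsOneParameterSubgroup X γ) : γ 0 = 1 := by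
  have := h.map_add 0 0
  simpa using this

theorem map_neg (h : IsOneParameterSubgroup X γ) (t : ℝ) : γ (-t) = (γ t)⁻¹ := by
  have := h.map_add (-t) t
  rw [neg_add_cancel, h.map_zero] at this
  exact eq_inv_of_mul_eq_one_left this.symm

variable [LieGroup 𝓘(ℝ, E) ∞ U] [IsTopologicalGroup U]

theorem hasLeftDeriv (h : IsOneParameterSubgroup X γ) (t : ℝ) :
    HasLeftDeriv γ (ContinuousLinearMap.toSpanSingleton ℝ X) t := by
  have h0 : HasLeftDeriv γ (ContinuousLinearMap.toSpanSingleton ℝ X) (0 : ℝ) := by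
    obtain ⟨a, b⟩ := (hasMFDerivAt_iff_chartOne h.map_zero).1 h.hasMFDerivAt
    exact hasLeftDeriv_of_eq_one h.map_zero a b
  have h1 : HasLeftDeriv (fun s : ℝ => γ (s - t))
      ((ContinuousLinearMap.toSpanSingleton ℝ X).comp (ContinuousLinearMap.id ℝ ℝ)) t :=
    HasLeftDeriv.comp_fderiv (f := fun s : ℝ => s - t) (by simpa using h0)
      ((hasFDerivAt_id t).sub_const t)
  refine ((h1.const_mul (γ t)).congr_deriv (by simp)).congr_of_eventuallyEq
    (Filter.Eventually.of_forall fun s => ?_)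
  change γ s = γ t * γ (s - t)
  rw [← h.map_add]; congr 1; ring

end IsOneParameterSubgroup

theorem isOneParameterSubgroup_of_hasLeftDeriv [LieGroup 𝓘(ℝ, E) ∞ U] [IsTopologicalGroup U]
    {X : E} {γ : ℝ → U} (h : ∀ s t : ℝ, γ (s + t) = γ s * γ t)
    (hd : HasLeftDeriv γ (ContinuousLinearMap.toSpanSingleton ℝ X) 0) :
    IsOneParameterSubgroup X γ := by
  have h0 : γ 0 = 1 := by simpa using h 0 0
  exact ⟨h, (hasMFDerivAt_iff_chartOne h0).2 ⟨hd.continuousAt, hd.one_mul_aux h0⟩⟩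

variable [LieGroup 𝓘(ℝ, E) ∞ U] [IsTopologicalGroup U]

variable (E U) in
theorem lieGroup_minSmoothness : LieGroup 𝓘(ℝ, E) (minSmoothness ℝ 3) U := by
  rw [minSmoothness_of_isRCLikeNormedField]
  exact LieGroup.of_le (n := ∞) (WithTop.coe_le_coe.2 (le_top : (3 : ℕ∞) ≤ ⊤))

theorem mdifferentiableAt_mul_left (u v : U) :
    MDifferentiableAt 𝓘(ℝ, E) 𝓘(ℝ, E) (fun w : U => u * w) v :=
  (contMDiff_mul_left (n := ∞)).mdifferentiable (by simp) v

theorem hasMFDerivAt_mul_left_of_eq_one (u : U) {v : U} (hv : v = 1) :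
    HasMFDerivAt 𝓘(ℝ, E) 𝓘(ℝ, E) (fun w : U => u * w) v
      (mfderiv 𝓘(ℝ, E) 𝓘(ℝ, E) (fun w : U => u * w) 1 : E →L[ℝ] E) := by
  subst hv
  exact (mdifferentiableAt_mul_left u _).hasMFDerivAt

/-- This brings one-parameter subgroups under the uniqueness theorem for integral curves. -/
theorem IsOneParameterSubgroup.isMIntegralCurve {X : E} {γ : ℝ → U}
    (h : IsOneParameterSubgroup X γ) :
    IsMIntegralCurve (I := 𝓘(ℝ, E)) γ
      (fun u : U => mulInvariantVectorField (I := 𝓘(ℝ, E)) (G := U) X u) := by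
  intro t
  have h1 := hasLeftDeriv_iff_hasMFDerivAt.1 (h.hasLeftDeriv t)
  have h2 := HasMFDerivAt.comp t (hasMFDerivAt_mul_left_of_eq_one (E := E) (γ t)
    (v := (γ t)⁻¹ * γ t) (by simp)) h1
  have e : (fun w : U => γ t * w) ∘ (fun s : ℝ => (γ t)⁻¹ * γ s) = γ := by
    ext s; simp
  rw [e] at h2
  refine h2.congr_mfderiv ?_
  apply ContinuousLinearMap.ext
  intro s
  exact (mfderiv 𝓘(ℝ, E) 𝓘(ℝ, E) (fun w : U => γ t * w) 1 : E →L[ℝ] E).map_smul s X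

theorem contMDiff_mulInvariantVectorField_one (X : E) :
    ContMDiff 𝓘(ℝ, E) (𝓘(ℝ, E).tangent) 1
      (fun u : U => (⟨u, mulInvariantVectorField (I := 𝓘(ℝ, E)) (G := U) X u⟩ :
        TangentBundle 𝓘(ℝ, E) U)) := by
  have := lieGroup_minSmoothness E U
  refine (contMDiff_mulInvariantVectorField (I := 𝓘(ℝ, E)) (G := U) X).of_le ?_
  rw [minSmoothness_of_isRCLikeNormedField]
  norm_num

theorem IsOneParameterSubgroup.unique [T2Space U] [CompleteSpace E] {X : E} {γ γ' : ℝ → U}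
    (h : IsOneParameterSubgroup X γ) (h' : IsOneParameterSubgroup X γ') : γ = γ' := by
  have : IsManifold 𝓘(ℝ, E) 1 U := IsManifold.of_le (n := ∞) (by simp)
  exact isMIntegralCurve_Ioo_eq_of_contMDiff_boundaryless (t₀ := 0)
    (contMDiff_mulInvariantVectorField_one X) h.isMIntegralCurve h'.isMIntegralCurve
    (by rw [h.map_zero, h'.map_zero])

theorem hasMFDerivAt_mul_left_integral {X : E} {γ : ℝ → U} {t : ℝ} (u : U)
    (h : HasMFDerivAt 𝓘(ℝ, ℝ) 𝓘(ℝ, E) γ t ((1 : ℝ →L[ℝ] ℝ).smulRight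
      (mulInvariantVectorField (I := 𝓘(ℝ, E)) (G := U) X (γ t)))) :
    HasMFDerivAt 𝓘(ℝ, ℝ) 𝓘(ℝ, E) (fun s => u * γ s) t ((1 : ℝ →L[ℝ] ℝ).smulRight
      (mulInvariantVectorField (I := 𝓘(ℝ, E)) (G := U) X (u * γ t))) := by
  have h1 := HasMFDerivAt.comp t (mdifferentiableAt_mul_left (E := E) u (γ t)).hasMFDerivAt h
  refine h1.congr_mfderiv ?_
  have e : mulInvariantVectorField (I := 𝓘(ℝ, E)) (G := U) X (u * γ t) =
      mfderiv 𝓘(ℝ, E) 𝓘(ℝ, E) (fun w : U => u * w) (γ t)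
        (mulInvariantVectorField (I := 𝓘(ℝ, E)) (G := U) X (γ t)) := by
    have e1 : (fun w : U => (u * γ t) * w) = (fun w : U => u * w) ∘ (fun w : U => γ t * w) := by
      ext w; simp [mul_assoc]
    have key : ∀ v : U, v = γ t → (mfderiv 𝓘(ℝ, E) 𝓘(ℝ, E) (fun w : U => u * w) v : E →L[ℝ] E) =
      mfderiv 𝓘(ℝ, E) 𝓘(ℝ, E) (fun w : U => u * w) (γ t) := by
      rintro _ rfl; rfl
    unfold mulInvariantVectorField
    rw [e1, mfderiv_comp (1 : U) (mdifferentiableAt_mul_left u _)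
      (mdifferentiableAt_mul_left (γ t) _)]
    exact congrArg (fun T : E →L[ℝ] E => T _) (key (γ t * 1) (mul_one _))
  apply ContinuousLinearMap.ext
  intro s
  rw [e]
  exact (mfderiv 𝓘(ℝ, E) 𝓘(ℝ, E) (fun w : U => u * w) (γ t)).map_smul s _

/-- A local integral curve through 1, translated to the left, gives an integral curve through every
point on the same interval (-ε, ε). A uniform existence time yields a global curve. It is a
homomorphism because t ↦ γ(s + t) and t ↦ γ(s)γ(t) are integral curves with the same initial point.
-/
theorem exists_isOneParameterSubgroup [T2Space U] [CompleteSpace E] (X : E) :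
    ∃ γ : ℝ → U, IsOneParameterSubgroup X γ := by
  have : IsManifold 𝓘(ℝ, E) 1 U := IsManifold.of_le (n := ∞) (by simp)
  set V := fun u : U => mulInvariantVectorField (I := 𝓘(ℝ, E)) (G := U) X u
  have hV := contMDiff_mulInvariantVectorField_one (U := U) X
  obtain ⟨γ₀, h0, h1⟩ := exists_isMIntegralCurveAt_of_contMDiffAt_boundaryless (I := 𝓘(ℝ, E))
    (v := V) (x₀ := (1 : U)) 0 hV.contMDiffAt
  obtain ⟨ε, hε, h2⟩ := isMIntegralCurveAt_iff'.1 h1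
  have h3 : ∀ u : U, ∃ γ : ℝ → U, γ 0 = u ∧ IsMIntegralCurveOn γ V (Set.Ioo (-ε) ε) := by
    intro u
    refine ⟨fun s => u * γ₀ s, by simp [h0], fun t ht => ?_⟩
    have ht' : t ∈ Metric.ball (0 : ℝ) ε := by
      rw [Real.ball_eq_Ioo]; simpa using ht
    have := (h2 t ht').hasMFDerivAt (Metric.isOpen_ball.mem_nhds ht')
    exact (hasMFDerivAt_mul_left_integral u this).hasMFDerivWithinAt
  obtain ⟨γ, g0, g1⟩ := exists_isMIntegralCurve_of_isMIntegralCurveOn hV hε h3 1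
  refine ⟨γ, fun s t => ?_, ?_⟩
  · have a1 : IsMIntegralCurve (I := 𝓘(ℝ, E)) (γ ∘ (· + s)) V := g1.comp_add s
    have a2 : IsMIntegralCurve (I := 𝓘(ℝ, E)) (fun t => γ s * γ t) V :=
      fun t => hasMFDerivAt_mul_left_integral (γ s) (g1 t)
    have a3 := isMIntegralCurve_Ioo_eq_of_contMDiff_boundaryless (t₀ := 0) hV a1 a2 (by simp [g0])
    have := congrFun a3 t
    simpa [add_comm] using this
  · have a := g1 0
    have key : ∀ u : U, u = 1 → (V u : E) = X := by
      rintro _ rfl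
      have e : (fun w : U => 1 * w) = id := by ext w; simp
      have e1 : (mfderiv 𝓘(ℝ, E) 𝓘(ℝ, E) (fun w : U => 1 * w) 1 : E →L[ℝ] E) =
          ContinuousLinearMap.id ℝ E := by rw [e]; exact mfderiv_id
      exact congrArg (fun T : E →L[ℝ] E => T X) e1
    have hk := key (γ 0) g0
    refine a.congr_mfderiv ?_
    apply ContinuousLinearMap.ext
    intro s
    exact congrArg (fun v : E => s • v) hk

end OneParameter

end Wrapping

end

noncomputable section

namespace Wrapping

/-! ### The exponential map and its differential. -/

section Exponential

set_option linter.unusedSectionVars false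

variable {E : Type*} [NormedAddCommGroup E] [NormedSpace ℝ E]
  {U : Type*} [TopologicalSpace U] [ChartedSpace E U] [Group U] [LieGroup 𝓘(ℝ, E) ∞ U]
  [IsTopologicalGroup U] [T2Space U] [CompleteSpace E]

theorem IsOneParameterSubgroup.comp_mul {X : E} {γ : ℝ → U} (h : IsOneParameterSubgroup X γ)
    (a : ℝ) : IsOneParameterSubgroup (a • X) (fun t => γ (a * t)) := by
  refine isOneParameterSubgroup_of_hasLeftDeriv (fun s t => by rw [mul_add, h.map_add]) ?_
  have hf : HasFDerivAt (fun t : ℝ => a * t) (a • ContinuousLinearMap.id ℝ ℝ) 0 :=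
    (hasFDerivAt_id (0 : ℝ)).const_mul a
  refine (HasLeftDeriv.comp_fderiv (f := fun t : ℝ => a * t) (h.hasLeftDeriv _) hf).congr_deriv ?_
  ext; simp

theorem IsOneParameterSubgroup.lieExp_eq {X : E} {γ : ℝ → U} (h : IsOneParameterSubgroup X γ) :
    lieExp U X = γ 1 := by
  have hex : ∃ γ : ℝ → U, IsOneParameterSubgroup X γ := ⟨γ, h⟩
  rw [lieExp, dif_pos hex, hex.choose_spec.unique h]

variable (U) in
theorem isOneParameterSubgroup_lieExp (X : E) :
    IsOneParameterSubgroup X (fun t : ℝ => lieExp U (t • X)) := by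
  obtain ⟨γ, hγ⟩ := exists_isOneParameterSubgroup (U := U) X
  have : (fun t : ℝ => lieExp U (t • X)) = γ := by
    ext t
    simpa using (hγ.comp_mul t).lieExp_eq
  rwa [this]

theorem lieExp_add_smul (s t : ℝ) (X : E) :
    lieExp U ((s + t) • X) = lieExp U (s • X) * lieExp U (t • X) :=
  (isOneParameterSubgroup_lieExp U X).map_add s t

@[simp] theorem lieExp_zero : lieExp U (0 : E) = 1 := by
  simpa using (isOneParameterSubgroup_lieExp U (0 : E)).map_zero

theorem lieExp_neg (X : E) : lieExp U (-X) = (lieExp U X)⁻¹ := by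
  simpa using (isOneParameterSubgroup_lieExp U X).map_neg 1

theorem lieExp_two_smul (X : E) : lieExp U ((2 : ℝ) • X) = lieExp U X * lieExp U X := by
  have := lieExp_add_smul (U := U) 1 1 X
  rw [one_smul] at this
  rw [← this]; norm_num

theorem hasLeftDeriv_lieExp_smul (X : E) (t : ℝ) :
    HasLeftDeriv (fun t : ℝ => lieExp U (t • X)) (ContinuousLinearMap.toSpanSingleton ℝ X) t :=
  (isOneParameterSubgroup_lieExp U X).hasLeftDeriv t

theorem continuous_lieExp_smul (X : E) : Continuous (fun t : ℝ => lieExp U (t • X)) :=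
  continuous_iff_continuousAt.2 fun t => (hasLeftDeriv_lieExp_smul X t).continuousAt

theorem conj_lieExp (u : U) (X : E) : u * lieExp U X * u⁻¹ = lieExp U (lieAd u X) := by
  have h := isOneParameterSubgroup_lieExp U X
  have h2 : IsOneParameterSubgroup (lieAd u X) (fun t : ℝ => u * lieExp U (t • X) * u⁻¹) := by
    refine isOneParameterSubgroup_of_hasLeftDeriv (fun s t => ?_) ?_
    · rw [lieExp_add_smul]; group
    · refine ((h.hasLeftDeriv 0).conj (by simp) u).congr_deriv ?_
      ext; simp
  simpa using h2.lieExp_eq.symm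

/-- The two one-parameter subgroups have the same velocity at 0. This turns identities between group
elements into identities in the Lie algebra. -/
theorem eq_of_forall_lieExp_smul_eq {X Y : E}
    (h : ∀ t : ℝ, lieExp U (t • X) = lieExp U (t • Y)) : X = Y := by
  have h1 := (hasLeftDeriv_lieExp_smul (U := U) X 0)
  have h2 := (hasLeftDeriv_lieExp_smul (U := U) Y 0)
  have e : (fun t : ℝ => lieExp U (t • X)) = fun t : ℝ => lieExp U (t • Y) := funext h
  rw [e] at h1
  simpa using congrArg (fun T : ℝ →L[ℝ] E => T 1) (h1.unique h2)

theorem lieAd_lieExp_smul_self (t : ℝ) (X : E) : lieAd (lieExp U (t • X)) X = X := by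
  refine eq_of_forall_lieExp_smul_eq (U := U) fun s => ?_
  rw [← map_smul, ← conj_lieExp, ← lieExp_add_smul, ← lieExp_neg, ← neg_smul, ← lieExp_add_smul]
  congr 2; ring

section ChartDeriv

variable (E U) in
/-- The differential at `0` of the left translation by the point with coordinate `z`. -/
def translChart (z : E) : E →L[ℝ] E := fderiv ℝ (fun y => mulChart E U (z, y)) 0

theorem contDiffAt_translChart {z : E} (hz : z ∈ (chartOne E U).target) :
    ContDiffAt ℝ ∞ (translChart E U) z := by
  have h := contDiffAt_mulChart (U := U) (q := (z, 0)) hz (by simp)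
    (by simpa using (chartOne E U).map_target hz)
  exact ContDiffAt.fderiv (f := fun z y => mulChart E U (z, y)) (n := ∞) (m := ∞)
    (g := fun _ => 0) h contDiffAt_const (by simp)

theorem hasFDerivAt_translChart {z : E} (hz : z ∈ (chartOne E U).target) :
    HasFDerivAt (fun y => mulChart E U (z, y)) (translChart E U z) 0 := by
  have h := contDiffAt_mulChart (U := U) (q := (z, 0)) hz (by simp)
    (by simpa using (chartOne E U).map_target hz)
  have h2 : ContDiffAt ℝ ∞ (fun y => mulChart E U (z, y)) 0 :=
    ContDiffAt.comp (0 : E) (g := mulChart E U) (f := fun y => (z, y)) h (contDiffAt_const.prodMk contDiffAt_id)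
  exact (h2.differentiableAt (by simp)).hasFDerivAt

@[simp] theorem translChart_zero : translChart E U 0 = ContinuousLinearMap.id ℝ E := by
  refine (hasFDerivAt_translChart (U := U) zero_mem_chartOne_target).unique ?_
  refine (hasFDerivAt_id (0 : E)).congr_of_eventuallyEq ?_
  filter_upwards [chartOne_target_mem_nhds (E := E) (U := U)] with y hy
  exact mulChart_zero_left hy

/-- The chain rule for g(y) = g(x) · (g(x)⁻¹g(y)): the differential of the left translation by g(x)
converts the left-trivialised derivative into the ordinary one. -/
theorem HasLeftDeriv.chartOne_comp {F : Type*} [NormedAddCommGroup F] [NormedSpace ℝ F]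
    {g : F → U} {L : F →L[ℝ] E} {x : F} (h : HasLeftDeriv g L x)
    (hx : g x ∈ (chartOne E U).source) :
    HasFDerivAt (fun y => chartOne E U (g y)) ((translChart E U (chartOne E U (g x))).comp L) x := by
  have h1 := hasFDerivAt_translChart ((chartOne E U).map_source hx)
  have h1' : HasFDerivAt (fun y => mulChart E U (chartOne E U (g x), y))
      (translChart E U (chartOne E U (g x))) (chartOne E U ((g x)⁻¹ * g x)) := by simpa using h1
  refine (h1'.comp x h.hasFDerivAt).congr_of_eventuallyEq ?_
  have s1 : ∀ᶠ y in 𝓝 x, (g x)⁻¹ * g y ∈ (chartOne E U).source := by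
    refine h.left_translate.continuousAt.eventually ?_
    simpa using chartOne_source_mem_nhds (E := E) (U := U)
  filter_upwards [s1] with y hy
  simp [← chartOne_mul hx hy]

end ChartDeriv

/-- A continuity argument: the velocity bound is known only while the curve stays in the ball of
radius r. The times at which the estimate C·t holds form a closed set. At such a time below 1 the
estimate is strictly below r, so the curve stays in the ball a little longer and the mean value
inequality extends the estimate. -/
theorem bootstrap_chartOne [ProperSpace E] {c : ℝ → U} {v : ℝ → E} {r C : ℝ}
    (hr : Metric.closedBall (0 : E) r ⊆ (chartOne E U).target) (hC : 0 ≤ C) (hCr : C < r)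
    (hc : Continuous c) (h0 : c 0 = 1)
    (hd : ∀ t, c t ∈ (chartOne E U).source → ‖chartOne E U (c t)‖ ≤ r →
      HasDerivAt (fun s => chartOne E U (c s)) (v t) t ∧ ‖v t‖ ≤ C) :
    ∀ t ∈ Set.Icc (0 : ℝ) 1, c t ∈ (chartOne E U).source ∧ ‖chartOne E U (c t)‖ ≤ C * t := by
  set D : Set U := (chartOne E U).symm '' Metric.closedBall (0 : E) r with hD
  have hDs : D ⊆ (chartOne E U).source := by
    rintro _ ⟨z, hz, rfl⟩; exact (chartOne E U).map_target (hr hz)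
  have hDc : IsClosed D := ((isCompact_closedBall (0 : E) r).image_of_continuousOn
    ((chartOne E U).continuousOn_symm.mono hr)).isClosed
  have hmemD : ∀ u ∈ (chartOne E U).source, ‖chartOne E U u‖ ≤ r → u ∈ D := fun u hu hur =>
    ⟨chartOne E U u, by simpa using hur, (chartOne E U).left_inv hu⟩
  have hcont : ContinuousOn (fun t => ‖chartOne E U (c t)‖) (c ⁻¹' D) :=
    (ContinuousOn.comp ((chartOne E U).continuousOn.mono hDs) hc.continuousOn
      (Set.mapsTo_preimage c D)).norm
  set T : Set ℝ := {t ∈ c ⁻¹' D | ‖chartOne E U (c t)‖ ≤ C * t} with hT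
  have hTc : IsClosed T := (hDc.preimage hc).isClosed_le hcont (by fun_prop)
  have h0T : (0 : ℝ) ∈ T := ⟨hmemD _ (by simp [h0]) (by simp [h0]; linarith), by simp [h0]⟩
  have hsub : Set.Icc (0 : ℝ) 1 ⊆ T := by
    refine IsClosed.Icc_subset_of_forall_exists_gt (hTc.inter isClosed_Icc) h0T ?_
    rintro x ⟨⟨hxD, hx⟩, hx0, hx1⟩ y (hxy : x < y)
    have hlt : ‖chartOne E U (c x)‖ < r := by nlinarith
    have hG : ∀ᶠ t in 𝓝 x, c t ∈ (chartOne E U).source ∧ ‖chartOne E U (c t)‖ < r := by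
      have hs := (chartOne E U).open_source.mem_nhds (hDs hxD)
      have h1 := hc.continuousAt.eventually hs
      have h2 : ContinuousAt (fun t => ‖chartOne E U (c t)‖) x :=
        (ContinuousAt.comp (g := chartOne E U) ((chartOne E U).continuousAt (hDs hxD))
          hc.continuousAt).norm
      exact h1.and (h2.eventually (gt_mem_nhds hlt))
    obtain ⟨δ, hδ, hball⟩ := Metric.eventually_nhds_iff.1 hG
    obtain ⟨z, hxz, hz⟩ := exists_between (lt_min hxy (lt_add_of_pos_right x hδ))
    have hzy := (lt_min_iff.1 hz).1
    have hzd := (lt_min_iff.1 hz).2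
    have hseg : ∀ t ∈ Set.Icc x z, c t ∈ (chartOne E U).source ∧ ‖chartOne E U (c t)‖ < r := by
      intro t ht
      refine hball ?_
      rw [Real.dist_eq, abs_lt]
      constructor <;> linarith [ht.1, ht.2]
    have hmv := norm_image_sub_le_of_norm_deriv_le_segment'
      (f := fun s => chartOne E U (c s)) (f' := v) (C := C) (a := x) (b := z)
      (fun t ht => (hd t (hseg t ht).1 (hseg t ht).2.le).1.hasDerivWithinAt)
      (fun t ht => (hd t (hseg t ⟨ht.1, ht.2.le⟩).1 (hseg t ⟨ht.1, ht.2.le⟩).2.le).2)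
      z ⟨hxz.le, le_rfl⟩
    have hzz := hseg z ⟨hxz.le, le_rfl⟩
    refine ⟨z, ⟨hmemD _ hzz.1 hzz.2.le, ?_⟩, hxz, hzy.le⟩
    have := norm_sub_norm_le (chartOne E U (c z)) (chartOne E U (c x))
    have h3 : ‖chartOne E U (c z) - chartOne E U (c x)‖ ≤ C * (z - x) := hmv
    nlinarith
  exact fun t ht => ⟨hDs (hsub ht).1, (hsub ht).2⟩

variable (E U) in
theorem exists_norm_lieAd_le [CompactSpace U] :
    ∃ M : ℝ, 1 ≤ M ∧ ∀ u : U, ‖(lieAd u : E →L[ℝ] E)‖ ≤ M := by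
  obtain ⟨M, hM⟩ := (isCompact_range (continuous_lieAd (E := E) (U := U))).isBounded.exists_norm_le
  exact ⟨max 1 M, le_max_left _ _, fun u => (hM _ ⟨u, rfl⟩).trans (le_max_right _ _)⟩

variable (U) in
/-- The left-trivialised differential of the exponential map at `X`. -/
def lieExpDeriv (X : E) : E →L[ℝ] E := ∫ t in (0 : ℝ)..1, (lieAd (lieExp U (-(t • X))) : E →L[ℝ] E)

theorem continuous_lieAd_lieExp_neg_smul (X : E) :
    Continuous (fun t : ℝ => (lieAd (lieExp U (-(t • X))) : E →L[ℝ] E)) := by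
  refine continuous_lieAd.comp ?_
  simp only [lieExp_neg]
  exact (continuous_lieExp_smul X).inv

/-- For c(t) = exp(-tX) exp(t(X+Z)) the product rule gives -Ad(b⁻¹)X + (X+Z) with b = exp(t(X+Z)).
As Ad(b) fixes X+Z, this is Ad(b⁻¹)Z = Ad(c⁻¹)Ad(exp(-tX))Z, which is small with Z. -/
theorem hasDerivAt_chartOne_lieExp (X Z : E) {t : ℝ}
    (ht : lieExp U (-(t • X)) * lieExp U (t • (X + Z)) ∈ (chartOne E U).source) :
    HasDerivAt (fun s : ℝ => chartOne E U (lieExp U (-(s • X)) * lieExp U (s • (X + Z))))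
      (translChart E U (chartOne E U (lieExp U (-(t • X)) * lieExp U (t • (X + Z))))
        (lieAd (lieExp U (-(t • X)) * lieExp U (t • (X + Z)))⁻¹
          (lieAd (lieExp U (-(t • X))) Z))) t := by
  have h1 : HasLeftDeriv (fun s : ℝ => lieExp U (-(s • X)))
      (ContinuousLinearMap.toSpanSingleton ℝ (-X)) t := by
    simpa using hasLeftDeriv_lieExp_smul (U := U) (-X) t
  have h2 := h1.mul (hasLeftDeriv_lieExp_smul (U := U) (X + Z) t)
  have h3 := (h2.chartOne_comp ht).hasDerivAt
  convert h3 using 1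
  have h4 : lieAd (lieExp U (t • (X + Z)))⁻¹ (X + Z) = X + Z := by
    have h := lieAd_inv_apply_lieAd (lieExp U (t • (X + Z))) (X + Z)
    rwa [lieAd_lieExp_smul_self] at h
  have h5 : lieAd (lieExp U (t • (X + Z)))⁻¹ Z =
      lieAd (lieExp U (t • (X + Z)))⁻¹ (-X) + (X + Z) := by
    refine Eq.trans ?_ (congrArg (lieAd (lieExp U (t • (X + Z)))⁻¹ (-X) + ·) h4)
    rw [← map_add]; congr 1; abel
  rw [mul_inv_rev, lieAd_mul_apply, lieAd_inv_apply_lieAd, h5]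
  simp

theorem lieExpDeriv_apply (X Z : E) :
    lieExpDeriv U X Z = ∫ t in (0 : ℝ)..1, lieAd (lieExp U (-(t • X))) Z :=
  ContinuousLinearMap.intervalIntegral_apply
    ((continuous_lieAd_lieExp_neg_smul X).intervalIntegrable _ _) Z

/-- The curve c(t) = exp(-tX) exp(t(X+Z)) joins 1 to exp(X)⁻¹exp(X+Z). Its velocity in the chart is
R(c) applied to w(t) = Ad(exp(-tX))Z, where R is continuous and R = 1 at the identity. While c stays
near 1 the velocity is close to w, whose integral is the claimed differential. The bound on Ad over
the compact group makes δ independent of X. -/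
theorem norm_chartOne_lieExp_sub_le [CompactSpace U] [ProperSpace E] {ε : ℝ} (hε : 0 < ε) :
    ∃ δ > 0, ∀ X Z : E, ‖Z‖ < δ → (lieExp U X)⁻¹ * lieExp U (X + Z) ∈ (chartOne E U).source ∧
      ‖chartOne E U ((lieExp U X)⁻¹ * lieExp U (X + Z)) - lieExpDeriv U X Z‖ ≤ ε * ‖Z‖ := by
  obtain ⟨M, hM1, hM⟩ := exists_norm_lieAd_le E U
  have hM0 : 0 < M := by linarith
  set R : E → E →L[ℝ] E := fun z =>
    (translChart E U z).comp (lieAd ((chartOne E U).symm z)⁻¹) with hR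
  have hRc : ContinuousAt R 0 := by
    refine ContinuousAt.clm_comp (contDiffAt_translChart (by simp)).continuousAt ?_
    refine ContinuousAt.comp (g := fun u : U => (lieAd u⁻¹ : E →L[ℝ] E)) ?_
      ((chartOne E U).continuousAt_symm (by simp))
    exact (continuous_lieAd.comp continuous_inv).continuousAt
  have hR0 : R 0 = 1 := by simp [hR]; rfl
  -- The bound 1 keeps the velocity below 2M‖Z‖, as the continuity argument needs; the bound ε/M
  -- turns the final error into ε‖Z‖.
  have hη : 0 < min 1 (ε / M) := lt_min one_pos (by positivity)
  obtain ⟨r₁, hr₁, hball₁⟩ := Metric.continuousAt_iff.1 hRc _ hη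
  obtain ⟨r₂, hr₂, hball₂⟩ := Metric.mem_nhds_iff.1 (chartOne_target_mem_nhds (E := E) (U := U))
  set r := min r₁ r₂ / 2 with hr
  have hrpos : 0 < r := by positivity
  have hr1 : r < r₁ := by have := min_le_left r₁ r₂; linarith [lt_min hr₁ hr₂]
  have hr2 : r < r₂ := by have := min_le_right r₁ r₂; linarith [lt_min hr₁ hr₂]
  have htar : Metric.closedBall (0 : E) r ⊆ (chartOne E U).target :=
    (Metric.closedBall_subset_ball hr2).trans hball₂
  have hRle : ∀ z : E, ‖z‖ ≤ r → ‖R z - 1‖ ≤ min 1 (ε / M) := fun z hz => by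
    have := hball₁ (x := z) (by rw [dist_zero_right]; linarith)
    rw [hR0, dist_eq_norm] at this
    exact this.le
  refine ⟨r / (2 * M), by positivity, fun X Z hZ => ?_⟩
  set c : ℝ → U := fun s => lieExp U (-(s • X)) * lieExp U (s • (X + Z)) with hcdef
  set w : ℝ → E := fun s => lieAd (lieExp U (-(s • X))) Z with hw
  have hwle : ∀ s, ‖w s‖ ≤ M * ‖Z‖ := fun s => (ContinuousLinearMap.le_opNorm _ _).trans
    (mul_le_mul_of_nonneg_right (hM _) (norm_nonneg _))
  have hwc : Continuous w := (continuous_lieAd_lieExp_neg_smul X).clm_apply continuous_const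
  have hc : Continuous c := by
    refine Continuous.mul ?_ (continuous_lieExp_smul _)
    simp only [lieExp_neg]
    exact (continuous_lieExp_smul X).inv
  have hder : ∀ t, c t ∈ (chartOne E U).source → HasDerivAt (fun s => chartOne E U (c s))
      (R (chartOne E U (c t)) (w t)) t := fun t ht => by
    have := hasDerivAt_chartOne_lieExp X Z ht
    change HasDerivAt _ (translChart E U (chartOne E U (c t))
      (lieAd ((chartOne E U).symm (chartOne E U (c t)))⁻¹ (w t))) t
    rwa [(chartOne E U).left_inv ht]
  have hC : 2 * M * ‖Z‖ < r := by
    rw [lt_div_iff₀ (by positivity)] at hZ; linarith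
  have hRw : ∀ t, ‖chartOne E U (c t)‖ ≤ r →
      ‖R (chartOne E U (c t)) (w t) - w t‖ ≤ min 1 (ε / M) * (M * ‖Z‖) := fun t ht => by
    have : R (chartOne E U (c t)) (w t) - w t = (R (chartOne E U (c t)) - 1) (w t) := by simp
    rw [this]
    exact (ContinuousLinearMap.le_opNorm _ _).trans
      (mul_le_mul (hRle _ ht) (hwle t) (norm_nonneg _) hη.le)
  have hboot := bootstrap_chartOne (U := U) (c := c)
    (v := fun t => R (chartOne E U (c t)) (w t)) htar (C := 2 * M * ‖Z‖) (by positivity) hC hc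
    (by simp [hcdef]) (fun t ht htr => ⟨hder t ht, by
      have h1 := hRw t htr
      have h2 := norm_sub_norm_le (R (chartOne E U (c t)) (w t)) (w t)
      have h3 : min 1 (ε / M) * (M * ‖Z‖) ≤ 1 * (M * ‖Z‖) :=
        mul_le_mul_of_nonneg_right (min_le_left _ _) (by positivity)
      linarith [hwle t]⟩)
  have hin : ∀ t ∈ Set.Icc (0 : ℝ) 1, c t ∈ (chartOne E U).source ∧ ‖chartOne E U (c t)‖ ≤ r :=
    fun t ht => ⟨(hboot t ht).1, (hboot t ht).2.trans (by
      have : 2 * M * ‖Z‖ * t ≤ 2 * M * ‖Z‖ * 1 :=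
        mul_le_mul_of_nonneg_left ht.2 (by positivity)
      linarith)⟩
  have hc1 : c 1 = (lieExp U X)⁻¹ * lieExp U (X + Z) := by simp [hcdef, lieExp_neg]
  rw [← hc1]
  refine ⟨(hin 1 (by simp)).1, ?_⟩
  have hy : ∀ t ∈ Set.Icc (0 : ℝ) 1, HasDerivWithinAt
      (fun s => chartOne E U (c s) - ∫ x in (0 : ℝ)..s, w x)
      (R (chartOne E U (c t)) (w t) - w t) (Set.Icc 0 1) t := fun t ht =>
    ((hder t (hin t ht).1).sub
      (intervalIntegral.integral_hasDerivAt_right (hwc.intervalIntegrable _ _)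
        (hwc.stronglyMeasurableAtFilter _ _) hwc.continuousAt)).hasDerivWithinAt
  have hfin := norm_image_sub_le_of_norm_deriv_le_segment_01' hy
    (fun t ht => hRw t (hin t ⟨ht.1, ht.2.le⟩).2)
  have hc0 : chartOne E U (c 0) = 0 := by simp [hcdef]
  rw [hc0] at hfin
  simp only [intervalIntegral.integral_same, sub_zero] at hfin
  rw [lieExpDeriv_apply]
  refine hfin.trans ?_
  calc min 1 (ε / M) * (M * ‖Z‖) ≤ ε / M * (M * ‖Z‖) :=
        mul_le_mul_of_nonneg_right (min_le_right _ _) (by positivity)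
    _ = ε * ‖Z‖ := by field_simp

variable [CompactSpace U] [FiniteDimensional ℝ E]

theorem hasLeftDeriv_lieExp (X : E) : HasLeftDeriv (lieExp U) (lieExpDeriv U X) X := by
  have : ProperSpace E := FiniteDimensional.proper ℝ E
  have hd : HasFDerivAt (fun Y => chartOne E U ((lieExp U X)⁻¹ * lieExp U Y))
      (lieExpDeriv U X) X := by
    rw [hasFDerivAt_iff_isLittleO_nhds_zero, Asymptotics.isLittleO_iff]
    intro ε hε
    obtain ⟨δ, hδ, h⟩ := norm_chartOne_lieExp_sub_le (U := U) (E := E) hε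
    filter_upwards [Metric.ball_mem_nhds (0 : E) hδ] with Z hZ
    simpa using (h X Z (by simpa using hZ)).2
  refine ⟨?_, hd⟩
  -- Continuity is not contained in `hd`, since the chart is meaningful only on its source; the
  -- estimate also places exp(X)⁻¹exp(Y) in that source, where the chart can be inverted.
  obtain ⟨δ, hδ, h⟩ := norm_chartOne_lieExp_sub_le (U := U) (E := E) one_pos
  have h1 : ContinuousAt (fun Y => (chartOne E U).symm
      (chartOne E U ((lieExp U X)⁻¹ * lieExp U Y))) X := by
    refine ContinuousAt.comp (g := (chartOne E U).symm) ?_ hd.continuousAt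
    simpa using (chartOne E U).continuousAt_symm (x := (0 : E)) (by simp)
  have h2 : ContinuousAt (fun Y => (lieExp U X)⁻¹ * lieExp U Y) X := by
    refine h1.congr ?_
    filter_upwards [Metric.ball_mem_nhds X hδ] with Y hY
    refine (chartOne E U).left_inv ?_
    simpa using (h X (Y - X) (by simpa [dist_eq_norm] using hY)).1
  simpa [Pi.mul_def] using (continuousAt_const (y := lieExp U X)).mul h2

theorem continuous_lieExp : Continuous (lieExp U : E → U) :=
  continuous_iff_continuousAt.2 fun X => (hasLeftDeriv_lieExp X).continuousAt

theorem continuous_lieExpDeriv : Continuous (lieExpDeriv U : E → E →L[ℝ] E) := by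
  refine intervalIntegral.continuous_parametric_intervalIntegral_of_continuous' ?_ 0 1
  refine continuous_lieAd.comp (continuous_lieExp.comp ?_)
  exact (continuous_snd.smul continuous_fst).neg

theorem norm_lieExpDeriv_le {M : ℝ} (hM : ∀ u : U, ‖(lieAd u : E →L[ℝ] E)‖ ≤ M) (X : E) :
    ‖lieExpDeriv U X‖ ≤ M := by
  have := intervalIntegral.norm_integral_le_of_norm_le_const (a := (0 : ℝ)) (b := 1)
    (f := fun t => (lieAd (lieExp U (-(t • X))) : E →L[ℝ] E)) (C := M) (fun t _ => hM _)
  simpa [lieExpDeriv] using this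

@[simp] theorem lieExpDeriv_zero : lieExpDeriv U (0 : E) = ContinuousLinearMap.id ℝ E := by
  simp [lieExpDeriv]

/-- The explicit differential depends continuously on the point. Class C¹ is all that the inverse
function theorem and the change of variables require below. -/
theorem contDiffAt_chartOne_lieExp (u : U) {X : E}
    (hX : u * lieExp U X ∈ (chartOne E U).source) :
    ContDiffAt ℝ 1 (fun Y => chartOne E U (u * lieExp U Y)) X := by
  rw [contDiffAt_one_iff]
  refine ⟨fun Y => (translChart E U (chartOne E U (u * lieExp U Y))).comp (lieExpDeriv U Y),
    (fun Y => u * lieExp U Y) ⁻¹' (chartOne E U).source, ?_, ?_, ?_⟩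
  · exact ((chartOne E U).open_source.preimage
      (continuous_const.mul continuous_lieExp)).mem_nhds hX
  · refine ContinuousOn.clm_comp ?_ continuous_lieExpDeriv.continuousOn
    intro Y hY
    refine ContinuousAt.continuousWithinAt ?_
    refine ContinuousAt.comp (g := translChart E U)
      (contDiffAt_translChart ((chartOne E U).map_source hY)).continuousAt ?_
    exact ContinuousAt.comp (g := chartOne E U) ((chartOne E U).continuousAt hY)
      (continuous_const.mul continuous_lieExp).continuousAt
  · exact fun Y hY => ((hasLeftDeriv_lieExp Y).const_mul u).chartOne_comp hY

theorem contMDiff_lieExp : ContMDiff 𝓘(ℝ, E) 𝓘(ℝ, E) 1 (lieExp U : E → U) := by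
  intro X
  have h1 := contMDiffAt_of_chartOne (n := 1) (g := fun Y => (lieExp U X)⁻¹ * lieExp U Y) (x := X)
    (by exact_mod_cast le_top) (continuous_const.mul continuous_lieExp).continuousAt (by simp)
    (contDiffAt_chartOne_lieExp _ (by simp))
  have : LieGroup 𝓘(ℝ, E) 1 U := LieGroup.of_le (n := ∞) (by exact_mod_cast le_top)
  have h2 : ContMDiffAt 𝓘(ℝ, E) 𝓘(ℝ, E) 1 (fun _ : E => lieExp U X) X := contMDiffAt_const
  simpa [Pi.mul_def] using h2.mul h1

end Exponential

end Wrapping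

end

noncomputable section

namespace Wrapping

/-! ### The Lie bracket as the differential of Ad. -/

section Bracket

set_option linter.unusedSectionVars false

variable {E : Type*} [NormedAddCommGroup E] [NormedSpace ℝ E]
  {U : Type*} [TopologicalSpace U] [ChartedSpace E U] [Group U] [LieGroup 𝓘(ℝ, E) ∞ U]
  [IsTopologicalGroup U] [T2Space U] [CompleteSpace E]

theorem mulInvariantVectorField_eq_of_hasMFDerivAt {z : E} (hz : z ∈ (chartOne E U).target)
    {w : E} {D : E →L[ℝ] E}
    (hw : w = z + chartAt E (1 : U) 1)
    (hD : HasMFDerivAt 𝓘(ℝ, E) 𝓘(ℝ, E) (chartAt E (1 : U)).symm w D) (X : E) :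
    (mulInvariantVectorField (I := 𝓘(ℝ, E)) (G := U) X ((chartAt E (1 : U)).symm w) : E) =
      D (translChart E U z X) := by
  set u := (chartAt E (1 : U)).symm w with hu
  have huz : u = (chartOne E U).symm z := by rw [hu, hw, chartOne_symm_apply]
  have hus : u ∈ (chartOne E U).source := huz ▸ (chartOne E U).map_target hz
  have h1 := HasMFDerivAt.comp (0 : E) (hasMFDerivAt_mul_left_of_eq_one (E := E) u
    (v := (chartOne E U).symm (0 : E)) (by simp)) (hasMFDerivAt_chartOne_symm (E := E) (U := U))
  have h2 : HasMFDerivAt 𝓘(ℝ, E) 𝓘(ℝ, E)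
      (fun y : E => mulChart E U (z, y) + chartAt E (1 : U) 1) 0 (translChart E U z) :=
    ((hasFDerivAt_translChart hz).add_const _).hasMFDerivAt
  have e0 : mulChart E U (z, 0) + chartAt E (1 : U) 1 = w := by
    rw [mulChart_zero_right hz, hw]
  have hD' : HasMFDerivAt 𝓘(ℝ, E) 𝓘(ℝ, E) (chartAt E (1 : U)).symm
      (mulChart E U (z, 0) + chartAt E (1 : U) 1) D := by
    rw [e0]; exact hD
  have h3 := HasMFDerivAt.comp (0 : E) hD' h2
  have h4 : (fun w : U => u * w) ∘ (chartOne E U).symm =ᶠ[𝓝 (0 : E)]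
      (chartAt E (1 : U)).symm ∘ fun y : E => mulChart E U (z, y) + chartAt E (1 : U) 1 := by
    have hc : ContinuousAt (fun y : E => u * (chartOne E U).symm y) 0 :=
      continuousAt_const.mul ((chartOne E U).continuousAt_symm (by simp))
    have hm : (chartOne E U).source ∈ 𝓝 (u * (chartOne E U).symm (0 : E)) := by
      simpa using (chartOne E U).open_source.mem_nhds hus
    filter_upwards [hc.eventually hm] with y hy
    simp only [Function.comp_apply]
    rw [← chartOne_symm_apply, mulChart, ← huz, (chartOne E U).left_inv hy]
  have h5 := hasMFDerivAt_unique h1 (h3.congr_of_eventuallyEq h4)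
  exact congrArg (fun T : E →L[ℝ] E => T X) h5

theorem mpullbackWithin_mulInvariantVectorField (X : E) {w : E}
    (hw : w ∈ (chartAt E (1 : U)).target) :
    (VectorField.mpullbackWithin 𝓘(ℝ, E) 𝓘(ℝ, E) (extChartAt 𝓘(ℝ, E) (1 : U)).symm
      (fun u : U => mulInvariantVectorField (I := 𝓘(ℝ, E)) (G := U) X u)
      (Set.range 𝓘(ℝ, E)) w : E) = translChart E U (w - chartAt E (1 : U) 1) X := by
  have : IsManifold 𝓘(ℝ, E) 1 U := IsManifold.of_le (n := ∞) (by simp)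
  have hw' : w ∈ (extChartAt 𝓘(ℝ, E) (1 : U)).target := by simpa using hw
  have hinv := isInvertible_mfderivWithin_extChartAt_symm (I := 𝓘(ℝ, E)) hw'
  refine (ContinuousLinearMap.IsInvertible.inverse_apply_eq hinv).2 ?_
  have hr : Set.range 𝓘(ℝ, E) = (Set.univ : Set E) := Set.range_id
  have hd : MDifferentiableAt 𝓘(ℝ, E) 𝓘(ℝ, E) (chartAt E (1 : U)).symm w :=
    mdifferentiableAt_atlas_symm (ChartedSpace.chart_mem_atlas _) hw
  refine mulInvariantVectorField_eq_of_hasMFDerivAt (D := _) ?_ (by simp) ?_ X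
  · rw [chartOne]; simpa [Homeomorph.addRight_symm] using hw
  · rw [hr, mfderivWithin_univ]
    simpa using! hd.hasMFDerivAt

/-- Pulled back to the chart, the left-invariant field of X is z ↦ `translChart z X`, and the
bracket of two fields on a vector space is the difference of their directional derivatives. -/
theorem lieBr_eq_fderiv_translChart (X Y : E) :
    lieBr U X Y = fderiv ℝ (translChart E U) 0 X Y - fderiv ℝ (translChart E U) 0 Y X := by
  have : IsManifold 𝓘(ℝ, E) 1 U := IsManifold.of_le (n := ∞) (by simp)
  have hT : DifferentiableAt ℝ (translChart E U) 0 :=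
    (contDiffAt_translChart (by simp)).differentiableAt (by simp)
  set e := chartAt E (1 : U) 1 with he
  set V : E → E → E := fun X => VectorField.mpullbackWithin 𝓘(ℝ, E) 𝓘(ℝ, E)
    (extChartAt 𝓘(ℝ, E) (1 : U)).symm
    (fun u : U => mulInvariantVectorField (I := 𝓘(ℝ, E)) (G := U) X u) (Set.range 𝓘(ℝ, E)) with hV
  have hVe : ∀ X, V X =ᶠ[𝓝 e] fun w => translChart E U (w - e) X := fun X => by
    filter_upwards [(chartAt E (1 : U)).open_target.mem_nhds (mem_chart_target E (1 : U))]
      with w hw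
    exact mpullbackWithin_mulInvariantVectorField X hw
  have hVd : ∀ X Y, fderiv ℝ (V X) e Y = fderiv ℝ (translChart E U) 0 Y X := fun X Y => by
    rw [(hVe X).fderiv_eq]
    have h1 : HasFDerivAt (fun w : E => w - e) (ContinuousLinearMap.id ℝ E) e :=
      (hasFDerivAt_id e).sub_const e
    have h2 : HasFDerivAt (translChart E U) (fderiv ℝ (translChart E U) 0) (e - e) := by
      simpa using hT.hasFDerivAt
    have h3 := (HasFDerivAt.comp e (f := fun w : E => w - e) h2 h1).clm_apply (hasFDerivAt_const X e)
    have h4 := h3.fderiv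
    simp only [Function.comp_apply] at h4
    rw [h4]; simp
  have hV0 : ∀ X, V X e = X := fun X => by rw [(hVe X).self_of_nhds]; simp
  let D : E →L[ℝ] E := mfderiv 𝓘(ℝ, E) 𝓘(ℝ, E) (extChartAt 𝓘(ℝ, E) (1 : U)) 1
  have hid : D = ContinuousLinearMap.id ℝ E := by
    have := mfderiv_chartAt_eq_tangentCoordChange (I := 𝓘(ℝ, E)) (x := (1 : U)) (y := 1)
      (mem_chart_source E 1)
    have h2 : (mfderiv 𝓘(ℝ, E) 𝓘(ℝ, E) (chartAt E (1 : U)) 1 : E →L[ℝ] E) =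
      ContinuousLinearMap.id ℝ E := by
      rw [this]
      ext v
      exact tangentCoordChange_self (mem_extChartAt_source (1 : U))
    simpa using! h2
  have key : lieBr U X Y = D.inverse (VectorField.lieBracketWithin ℝ (V X) (V Y)
        ((extChartAt 𝓘(ℝ, E) (1 : U)).symm ⁻¹' Set.univ ∩ Set.range 𝓘(ℝ, E)) e) := rfl
  have hset : ((extChartAt 𝓘(ℝ, E) (1 : U)).symm ⁻¹' Set.univ ∩ Set.range 𝓘(ℝ, E)) =
      (Set.univ : Set E) := by
    rw [Set.preimage_univ, Set.univ_inter]; exact Set.range_id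
  rw [key, hid, hset, ContinuousLinearMap.inverse_id]
  simp only [VectorField.lieBracketWithin, fderivWithin_univ, hVd, hV0,
    ContinuousLinearMap.id_apply]

variable (E U) in
/-- The differential of the adjoint representation at the identity. -/
def adL : E →L[ℝ] E →L[ℝ] E := fderiv ℝ (fun z : E => (lieAd ((chartOne E U).symm z) : E →L[ℝ] E)) 0

theorem hasFDerivAt_lieAd_chartOne_symm :
    HasFDerivAt (fun z : E => (lieAd ((chartOne E U).symm z) : E →L[ℝ] E)) (adL E U) 0 :=
  (contDiffAt_lieAd_chartOne_symm.differentiableAt (by simp)).hasFDerivAt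

theorem translChart_eq {z : E} (hz : z ∈ (chartOne E U).target) :
    translChart E U z = (fderiv ℝ (mulChart E U) (z, 0)).comp (ContinuousLinearMap.inr ℝ E E) := by
  have h := ((contDiffAt_mulChart (U := U) (q := (z, 0)) hz (by simp)
      (by simpa using (chartOne E U).map_target hz)).differentiableAt (by simp)).hasFDerivAt
  exact (HasFDerivAt.comp (0 : E) (f := fun y : E => (z, y)) h
    (hasFDerivAt_prodMk_right z (0 : E))).fderiv

/-- From uy = (uyu⁻¹)u: left translation by u is conjugation by u followed by right translation. -/
theorem translChart_eq_lieAd {z : E} (hz : z ∈ (chartOne E U).target) :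
    translChart E U z = ((fderiv ℝ (mulChart E U) (0, z)).comp
      (ContinuousLinearMap.inl ℝ E E)).comp (lieAd ((chartOne E U).symm z)) := by
  have h := ((contDiffAt_mulChart (U := U) (q := (0, z)) (by simp) hz
      (by simpa using (chartOne E U).map_target hz)).differentiableAt (by simp)).hasFDerivAt
  set u := (chartOne E U).symm z with hu
  have hus : u ∈ (chartOne E U).source := (chartOne E U).map_target hz
  have h1 : HasFDerivAt (fun x : E => mulChart E U (x, z)) ((fderiv ℝ (mulChart E U) (0, z)).comp
      (ContinuousLinearMap.inl ℝ E E)) (chartOne E U (u * (chartOne E U).symm 0 * u⁻¹)) := by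
    have := HasFDerivAt.comp (0 : E) (f := fun x : E => (x, z)) h
      (hasFDerivAt_prodMk_left (0 : E) z)
    simpa [Function.comp_def] using this
  have h2 := HasFDerivAt.comp (0 : E) h1 (hasFDerivAt_lieAd u)
  refine (h2.congr_of_eventuallyEq ?_).fderiv
  have hc : ContinuousAt (fun y : E => u * (chartOne E U).symm y * u⁻¹) 0 :=
    (continuousAt_const.mul ((chartOne E U).continuousAt_symm (by simp))).mul continuousAt_const
  have hm : (chartOne E U).source ∈ 𝓝 (u * (chartOne E U).symm (0 : E) * u⁻¹) := by
    simpa using chartOne_source_mem_nhds (E := E) (U := U)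
  filter_upwards [hc.eventually hm] with y hy
  simp [mulChart, (chartOne E U).left_inv hy, ← hu]

theorem fderiv_translChart_apply (X Y : E) : fderiv ℝ (translChart E U) 0 X Y =
    fderiv ℝ (fderiv ℝ (mulChart E U)) 0 (X, 0) (0, Y) := by
  have hD : HasFDerivAt (fderiv ℝ (mulChart E U)) (fderiv ℝ (fderiv ℝ (mulChart E U)) 0)
      ((0 : E), (0 : E)) :=
    (((contDiffAt_mulChart_zero (U := U)).fderiv_right (m := 1)
      (by rw [one_add_one_eq_two]; exact WithTop.coe_le_coe.2 le_top)).differentiableAt (by simp)).hasFDerivAt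
  have h1 := HasFDerivAt.comp (0 : E) (f := fun z : E => (z, (0 : E))) hD
    (hasFDerivAt_prodMk_left (0 : E) (0 : E))
  have h2 := h1.clm_comp (hasFDerivAt_const (ContinuousLinearMap.inr ℝ E E) (0 : E))
  have h3 : translChart E U =ᶠ[𝓝 0] fun z => (fderiv ℝ (mulChart E U) (z, 0)).comp
      (ContinuousLinearMap.inr ℝ E E) := by
    filter_upwards [chartOne_target_mem_nhds (E := E) (U := U)] with z hz using translChart_eq hz
  rw [h3.fderiv_eq]
  erw [h2.fderiv]
  simp

theorem fderiv_translChart_apply' (X Y : E) : fderiv ℝ (translChart E U) 0 X Y =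
    fderiv ℝ (fderiv ℝ (mulChart E U)) 0 (0, X) (Y, 0) + adL E U X Y := by
  have hD : HasFDerivAt (fderiv ℝ (mulChart E U)) (fderiv ℝ (fderiv ℝ (mulChart E U)) 0)
      ((0 : E), (0 : E)) :=
    (((contDiffAt_mulChart_zero (U := U)).fderiv_right (m := 1)
      (by rw [one_add_one_eq_two]; exact WithTop.coe_le_coe.2 le_top)).differentiableAt (by simp)).hasFDerivAt
  have h1 := HasFDerivAt.comp (0 : E) (f := fun z : E => ((0 : E), z)) hD
    (hasFDerivAt_prodMk_right (0 : E) (0 : E))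
  have h2 := (h1.clm_comp (hasFDerivAt_const (ContinuousLinearMap.inl ℝ E E) (0 : E))).clm_comp
    (hasFDerivAt_lieAd_chartOne_symm (E := E) (U := U))
  have h3 : translChart E U =ᶠ[𝓝 0] fun z => ((fderiv ℝ (mulChart E U) (0, z)).comp
      (ContinuousLinearMap.inl ℝ E E)).comp (lieAd ((chartOne E U).symm z)) := by
    filter_upwards [chartOne_target_mem_nhds (E := E) (U := U)] with z hz
      using translChart_eq_lieAd hz
  have h4 : (fderiv ℝ (mulChart E U) ((0 : E), (0 : E))) = _ :=
    (hasFDerivAt_mulChart_zero (E := E) (U := U)).fderiv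
  rw [h3.fderiv_eq]
  erw [h2.fderiv]
  simp [h4, add_comm]

/-- Differentiating the two descriptions of left translation gives mixed second derivatives of the
group law at 0, one of them with an additional ad term. By the symmetry of second derivatives
everything else cancels in the commutator. -/
theorem lieBr_eq_adL (X Y : E) : lieBr U X Y = adL E U X Y := by
  have hs : IsSymmSndFDerivAt ℝ (mulChart E U) 0 :=
    (contDiffAt_mulChart_zero (U := U)).isSymmSndFDerivAt (by
      rw [minSmoothness_of_isRCLikeNormedField]; exact WithTop.coe_le_coe.2 le_top)
  rw [lieBr_eq_fderiv_translChart, fderiv_translChart_apply' X Y, fderiv_translChart_apply Y X,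
    hs (Y, 0) (0, X)]
  abel

theorem lieBr_swap (X Y : E) : lieBr U X Y = -lieBr U Y X := by
  rw [lieBr_eq_fderiv_translChart, lieBr_eq_fderiv_translChart]; abel

@[simp] theorem lieBr_self (X : E) : lieBr U X X = 0 := by
  rw [lieBr_eq_fderiv_translChart]; abel

end Bracket

end Wrapping

end

noncomputable section

namespace Wrapping

/-! ### Ad along one-parameter subgroups, and commuting elements. -/

section AdjointExp

set_option linter.unusedSectionVars false

variable {E : Type*} [NormedAddCommGroup E] [NormedSpace ℝ E]
  {U : Type*} [TopologicalSpace U] [ChartedSpace E U] [Group U] [LieGroup 𝓘(ℝ, E) ∞ U]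
  [IsTopologicalGroup U] [T2Space U] [CompleteSpace E]

theorem hasDerivAt_lieAd_lieExp_zero (X Y : E) :
    HasDerivAt (fun t : ℝ => lieAd (lieExp U (t • X)) Y) (lieBr U X Y) 0 := by
  have h1 : HasFDerivAt (fun t : ℝ => chartOne E U (lieExp U (t • X)))
      (ContinuousLinearMap.toSpanSingleton ℝ X) 0 :=
    (hasLeftDeriv_lieExp_smul (U := U) X 0).one_mul_aux (by simp)
  have h2 : HasFDerivAt (fun z : E => (lieAd ((chartOne E U).symm z) : E →L[ℝ] E)) (adL E U)
      (chartOne E U (lieExp U ((0 : ℝ) • X))) := by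
    simpa using hasFDerivAt_lieAd_chartOne_symm (E := E) (U := U)
  have h3 := ((HasFDerivAt.comp (0 : ℝ) (f := fun t : ℝ => chartOne E U (lieExp U (t • X)))
    h2 h1).clm_apply (hasFDerivAt_const Y (0 : ℝ))).hasDerivAt
  simp only [ContinuousLinearMap.comp_zero, zero_add] at h3
  have h4 : (fun t : ℝ => lieAd (lieExp U (t • X)) Y) =ᶠ[𝓝 0] fun t : ℝ =>
      lieAd ((chartOne E U).symm (chartOne E U (lieExp U (t • X)))) Y := by
    have hm : (chartOne E U).source ∈ 𝓝 (lieExp U ((0 : ℝ) • X)) := by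
      simpa using chartOne_source_mem_nhds (E := E) (U := U)
    filter_upwards [(continuous_lieExp_smul X).continuousAt.eventually hm] with t ht
    rw [(chartOne E U).left_inv ht]
  refine (HasDerivAt.congr_of_eventuallyEq (f₁ := _) ?_ h4)
  rw [lieBr_eq_adL]
  simpa [Function.comp_def] using! h3

theorem hasDerivAt_lieAd_lieExp (X Y : E) (t : ℝ) :
    HasDerivAt (fun t : ℝ => lieAd (lieExp U (t • X)) Y)
      (lieAd (lieExp U (t • X)) (lieBr U X Y)) t := by
  have h := hasDerivAt_lieAd_lieExp_zero (U := U) X Y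
  have h0 : HasDerivAt (fun t : ℝ => lieAd (lieExp U (t • X)) Y) (lieBr U X Y) (t - t) := by
    simpa using h
  have h1 := HasDerivAt.scomp t (h := fun s : ℝ => s - t) h0 ((hasDerivAt_id t).sub_const t)
  have h2 := (lieAd (lieExp U (t • X)) : E →L[ℝ] E).hasFDerivAt.comp_hasDerivAt t h1
  simp only [one_smul] at h2
  refine h2.congr_of_eventuallyEq (Filter.Eventually.of_forall fun s => ?_)
  simp only [Function.comp_apply]
  rw [← lieAd_mul_apply, ← lieExp_add_smul]
  rw [add_sub_cancel]

/-- Differentiate Ad(u) Ad(exp tX) Y = Ad(exp(t Ad(u)X)) Ad(u) Y at t = 0. -/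
theorem lieAd_lieBr (u : U) (X Y : E) :
    lieAd u (lieBr U X Y) = lieBr U (lieAd u X) (lieAd u Y) := by
  have h1 := (lieAd u : E →L[ℝ] E).hasFDerivAt.comp_hasDerivAt 0
    (hasDerivAt_lieAd_lieExp_zero (U := U) X Y)
  refine h1.unique ((hasDerivAt_lieAd_lieExp_zero (U := U) (lieAd u X) (lieAd u Y)
    ).congr_of_eventuallyEq (Filter.Eventually.of_forall fun t => ?_))
  simp only [Function.comp_apply]
  rw [← map_smul, ← conj_lieExp, ← lieAd_mul_apply, ← lieAd_mul_apply]
  simp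

theorem lieBr_add_left (X Y Z : E) : lieBr U (X + Y) Z = lieBr U X Z + lieBr U Y Z := by
  simp [lieBr_eq_adL]

theorem lieBr_add_right (X Y Z : E) : lieBr U X (Y + Z) = lieBr U X Y + lieBr U X Z := by
  simp [lieBr_eq_adL]

theorem lieBr_smul_left (c : ℝ) (X Y : E) : lieBr U (c • X) Y = c • lieBr U X Y := by
  simp [lieBr_eq_adL]

theorem lieBr_smul_right (c : ℝ) (X Y : E) : lieBr U X (c • Y) = c • lieBr U X Y := by
  simp [lieBr_eq_adL]

theorem lieBr_comm_zero {X Y : E} (h : lieBr U X Y = 0) : lieBr U Y X = 0 := by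
  rw [lieBr_swap, h, neg_zero]

theorem lieAd_lieExp_smul_of_lieBr_eq_zero {X Y : E} (h : lieBr U X Y = 0) (t : ℝ) :
    lieAd (lieExp U (t • X)) Y = Y := by
  have hd : ∀ t, HasDerivAt (fun t : ℝ => lieAd (lieExp U (t • X)) Y) 0 t := fun t => by
    simpa [h] using hasDerivAt_lieAd_lieExp (U := U) X Y t
  have := is_const_of_deriv_eq_zero (fun t => (hd t).differentiableAt)
    (fun t => (hd t).deriv) t 0
  simpa using this

theorem lieAd_lieExp_of_lieBr_eq_zero {X Y : E} (h : lieBr U X Y = 0) :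
    lieAd (lieExp U X) Y = Y := by
  simpa using lieAd_lieExp_smul_of_lieBr_eq_zero h 1

theorem lieBr_eq_zero_of_forall_lieAd {X Y : E}
    (h : ∀ t : ℝ, lieAd (lieExp U (t • X)) Y = Y) : lieBr U X Y = 0 := by
  have h1 := hasDerivAt_lieAd_lieExp_zero (U := U) X Y
  simp only [h] at h1
  exact h1.unique (hasDerivAt_const _ _)

theorem commute_lieExp_of_lieBr_eq_zero {X Y : E} (h : lieBr U X Y = 0) :
    lieExp U X * lieExp U Y = lieExp U Y * lieExp U X := by
  have := conj_lieExp (lieExp U X) Y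
  rw [lieAd_lieExp_of_lieBr_eq_zero h] at this
  exact mul_inv_eq_iff_eq_mul.1 this

/-- As exp(tX) and exp(sY) commute, t ↦ exp(tX) exp(tY) is a one-parameter subgroup, with velocity X
+ Y. -/
theorem lieExp_add_of_lieBr_eq_zero {X Y : E} (h : lieBr U X Y = 0) :
    lieExp U (X + Y) = lieExp U X * lieExp U Y := by
  have hst : ∀ s t : ℝ, lieExp U (s • Y) * lieExp U (t • X) =
      lieExp U (t • X) * lieExp U (s • Y) := fun s t =>
    (commute_lieExp_of_lieBr_eq_zero (by rw [lieBr_smul_left, lieBr_smul_right, h]; simp)).symm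
  have h2 : IsOneParameterSubgroup (X + Y)
      (fun t : ℝ => lieExp U (t • X) * lieExp U (t • Y)) := by
    refine isOneParameterSubgroup_of_hasLeftDeriv (fun s t => ?_) ?_
    · rw [lieExp_add_smul, lieExp_add_smul, mul_assoc, mul_assoc,
        ← mul_assoc (lieExp U (t • X)), ← hst s t]
      group
    · refine ((hasLeftDeriv_lieExp_smul X 0).mul_of_eq_one (hasLeftDeriv_lieExp_smul Y 0)
        (by simp) (by simp)).congr_deriv ?_
      ext; simp
  simpa using h2.lieExp_eq

theorem lieExp_sub_of_lieBr_eq_zero {X Y : E} (h : lieBr U X Y = 0) :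
    lieExp U (X - Y) = lieExp U X * (lieExp U Y)⁻¹ := by
  rw [sub_eq_add_neg, lieExp_add_of_lieBr_eq_zero, lieExp_neg]
  rw [← neg_one_smul ℝ Y, lieBr_smul_right, h, smul_zero]

/-- The only case of the Jacobi identity that is needed. Ad(exp tX) respects brackets and fixes Y;
differentiate its action on [Y, Z] at t = 0. -/
theorem lieAd_comm_lieBr_of_lieBr_eq_zero {X Y Z : E} (h : lieBr U X Y = 0) :
    lieBr U X (lieBr U Y Z) = lieBr U Y (lieBr U X Z) := by
  have h1 := hasDerivAt_lieAd_lieExp_zero (U := U) X (lieBr U Y Z)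
  have h2 := (adL E U Y).hasFDerivAt.comp_hasDerivAt 0 (hasDerivAt_lieAd_lieExp_zero (U := U) X Z)
  have e : (fun t : ℝ => lieAd (lieExp U (t • X)) (lieBr U Y Z)) =
      (adL E U Y) ∘ fun t : ℝ => lieAd (lieExp U (t • X)) Z := by
    ext t
    rw [lieAd_lieBr, lieAd_lieExp_smul_of_lieBr_eq_zero h, lieBr_eq_adL]; rfl
  rw [e] at h1
  rw [h1.unique h2, ← lieBr_eq_adL]

/-! ### Compatibility of the involution with exp, Ad and the bracket. -/

section Involution

variable (S : SymmetricPair E U)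

theorem hasFDerivAt_dσ : HasFDerivAt
    (fun z : E => chartOne E U (S.σ ((chartOne E U).symm z))) S.dσ 0 :=
  hasFDerivAt_chartOne_conj (map_one S.σ) (S.smooth_σ.mdifferentiable (by simp) 1)

theorem continuous_σ : Continuous S.σ := S.smooth_σ.continuous

theorem σ_lieExp (X : E) : S.σ (lieExp U X) = lieExp U (S.dσ X) := by
  have h2 : IsOneParameterSubgroup (S.dσ X) (fun t : ℝ => S.σ (lieExp U (t • X))) := by
    refine isOneParameterSubgroup_of_hasLeftDeriv (fun s t => ?_) ?_
    · rw [lieExp_add_smul, map_mul]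
    · refine ((hasLeftDeriv_lieExp_smul X 0).map_of_eq_one (by simp) (map_one S.σ)
        (continuous_σ S).continuousAt (hasFDerivAt_dσ S)).congr_deriv ?_
      ext; simp
  simpa using h2.lieExp_eq.symm

theorem dσ_lieAd (u : U) (X : E) : S.dσ (lieAd u X) = lieAd (S.σ u) (S.dσ X) := by
  refine eq_of_forall_lieExp_smul_eq (U := U) fun t => ?_
  rw [← map_smul, ← map_smul, ← map_smul, ← map_smul, ← σ_lieExp, ← conj_lieExp, ← conj_lieExp,
    ← σ_lieExp]
  simp

theorem dσ_lieBr (X Y : E) : S.dσ (lieBr U X Y) = lieBr U (S.dσ X) (S.dσ Y) := by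
  have h1 := S.dσ.hasFDerivAt.comp_hasDerivAt 0 (hasDerivAt_lieAd_lieExp_zero (U := U) X Y)
  refine h1.unique ((hasDerivAt_lieAd_lieExp_zero (U := U) (S.dσ X) (S.dσ Y)
    ).congr_of_eventuallyEq (Filter.Eventually.of_forall fun t => ?_))
  simp only [Function.comp_apply]
  rw [dσ_lieAd, σ_lieExp, map_smul]

end Involution

/-! ### Local injectivity and openness of exponential products. -/

section LocalExp

variable [CompactSpace U] [FiniteDimensional ℝ E]
  {F : Type*} [NormedAddCommGroup F] [NormedSpace ℝ F]

theorem hasStrictFDerivAt_chartOne_comp {g : F → U} {L : F →L[ℝ] E} {x : F} (hx : g x = 1)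
    (hg : ContMDiffAt 𝓘(ℝ, F) 𝓘(ℝ, E) 1 g x) (hL : HasLeftDeriv g L x) :
    HasStrictFDerivAt (fun y => chartOne E U (g y)) L x :=
  (contDiffAt_chartOne_comp (by exact_mod_cast le_top) hg (by simp [hx])).hasStrictFDerivAt'
    (hL.one_mul_aux hx) (by simp)

/-- Openness at a point with surjective strict differential, transported through the chart at the
identity. -/
theorem map_nhds_eq_of_surjective [CompleteSpace F] {g : F → U} {L : F →L[ℝ] E} {x : F}
    (hx : g x = 1) (hg : ContMDiffAt 𝓘(ℝ, F) 𝓘(ℝ, E) 1 g x) (hL : HasLeftDeriv g L x)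
    (hs : LinearMap.range (L : F →ₗ[ℝ] E) = ⊤) : Filter.map g (𝓝 x) = 𝓝 1 := by
  have h1 := (hasStrictFDerivAt_chartOne_comp hx hg hL).map_nhds_eq_of_surj hs
  have h2 : g =ᶠ[𝓝 x] fun y => (chartOne E U).symm (chartOne E U (g y)) := by
    have hm : (chartOne E U).source ∈ 𝓝 (g x) := by
      rw [hx]; exact chartOne_source_mem_nhds
    filter_upwards [hg.continuousAt.eventually hm] with y hy
    exact ((chartOne E U).left_inv hy).symm
  rw [Filter.map_congr h2]
  change Filter.map ((chartOne E U).symm ∘ fun y => chartOne E U (g y)) (𝓝 x) = 𝓝 1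
  rw [← Filter.map_map, h1, hx]
  simpa using (chartOne E U).symm.map_nhds_eq (x := (0 : E)) (by simp)

theorem hasLeftDeriv_lieExp_zero : HasLeftDeriv (lieExp U) (ContinuousLinearMap.id ℝ E) 0 := by
  simpa using hasLeftDeriv_lieExp (U := U) (0 : E)

theorem map_lieExp_nhds_zero : Filter.map (lieExp U) (𝓝 (0 : E)) = 𝓝 1 :=
  map_nhds_eq_of_surjective lieExp_zero (contMDiff_lieExp 0) hasLeftDeriv_lieExp_zero
    (LinearMap.range_eq_top.2 Function.surjective_id)

variable (E U) in
theorem exists_injOn_lieExp : ∃ r > 0, Set.InjOn (lieExp U) (Metric.ball (0 : E) r) := by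
  have h1 := hasStrictFDerivAt_chartOne_comp (E := E) (U := U) lieExp_zero (contMDiff_lieExp 0)
    hasLeftDeriv_lieExp_zero
  have h2 : HasStrictFDerivAt (fun y : E => chartOne E U (lieExp U y))
    ((ContinuousLinearEquiv.refl ℝ E : E ≃L[ℝ] E) : E →L[ℝ] E) 0 := h1
  obtain ⟨r, hr, hball⟩ := Metric.mem_nhds_iff.1
    (h2.toOpenPartialHomeomorph _ |>.open_source.mem_nhds h2.mem_toOpenPartialHomeomorph_source)
  refine ⟨r, hr, fun X hX Y hY h => ?_⟩
  refine (h2.toOpenPartialHomeomorph _).injOn (hball hX) (hball hY) ?_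
  simp [h]

theorem map_lieExp_mul₃_nhds_zero [CompleteSpace F] (L₁ L₂ L₃ : F →L[ℝ] E)
    (hs : LinearMap.range ((L₁ + L₂ + L₃ : F →L[ℝ] E) : F →ₗ[ℝ] E) = ⊤) :
    Filter.map (fun y => lieExp U (L₁ y) * lieExp U (L₂ y) * lieExp U (L₃ y)) (𝓝 0) = 𝓝 1 := by
  have : LieGroup 𝓘(ℝ, E) 1 U := LieGroup.of_le (n := ∞) (by exact_mod_cast le_top)
  have hc : ∀ L : F →L[ℝ] E, ContMDiff 𝓘(ℝ, F) 𝓘(ℝ, E) 1 (fun y => lieExp U (L y)) := fun L =>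
    contMDiff_lieExp.comp (contMDiff_iff_contDiff.2 L.contDiff)
  have hd : ∀ L : F →L[ℝ] E, HasLeftDeriv (fun y => lieExp U (L y)) L (0 : F) := fun L => by
    have h : HasLeftDeriv (lieExp U) (ContinuousLinearMap.id ℝ E) (L 0) := by
      simpa using hasLeftDeriv_lieExp_zero (E := E) (U := U)
    simpa using h.comp_fderiv L.hasFDerivAt
  exact map_nhds_eq_of_surjective (by simp) (((hc L₁).mul (hc L₂)).mul (hc L₃) 0)
    (((hd L₁).mul_of_eq_one (hd L₂) (by simp) (by simp)).mul_of_eq_one (hd L₃) (by simp)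
      (by simp)) hs

end LocalExp

end AdjointExp

end Wrapping

end

noncomputable section

namespace Wrapping

/-! ### Invariant inner products and the decomposition into 𝔨 and 𝔭. -/

section Pair

set_option linter.unusedSectionVars false

variable {E : Type*} [NormedAddCommGroup E] [NormedSpace ℝ E] [FiniteDimensional ℝ E]
  {U : Type*} [TopologicalSpace U] [ChartedSpace E U] [Group U] [LieGroup 𝓘(ℝ, E) ∞ U]
  [IsTopologicalGroup U] [T2Space U] [CompactSpace U] [CompleteSpace E]

variable (E U) in
theorem exists_lieAd_invariant_form [MeasurableSpace U] [BorelSpace U] :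
    ∃ B : E →ₗ[ℝ] E →ₗ[ℝ] ℝ, (∀ x y, B x y = B y x) ∧ (∀ x, x ≠ 0 → 0 < B x x) ∧
      ∀ (u : U) (x y : E), B (lieAd u x) (lieAd u y) = B x y := by
  let e := toEuclidean (E := E)
  -- With u⁻¹ here, replacing x and y by Ad(v)x and Ad(v)y amounts to replacing u by v⁻¹u, so the
  -- left invariance of Haar measure gives the invariance of the average.
  let f : E → E → U → ℝ := fun x y u => inner ℝ (e (lieAd u⁻¹ x)) (e (lieAd u⁻¹ y))
  have hA : ∀ x : E, Continuous fun u : U => e (lieAd u⁻¹ x) := fun x =>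
    e.continuous.comp ((continuous_lieAd.comp continuous_inv).clm_apply continuous_const)
  have hf : ∀ x y, Continuous (f x y) := fun x y => (hA x).inner (hA y)
  let m : Measure U := Measure.haar
  have hi : ∀ x y, Integrable (f x y) m := fun x y =>
    (hf x y).integrable_of_hasCompactSupport (HasCompactSupport.of_compactSpace _)
  let B : E →ₗ[ℝ] E →ₗ[ℝ] ℝ := LinearMap.mk₂ ℝ (fun x y => ∫ u, f x y u ∂m)
    (fun x x' y => by
      rw [← integral_add (hi _ _) (hi _ _)]
      congr 1; ext u; simp [f, inner_add_left])
    (fun c x y => by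
      rw [smul_eq_mul, ← integral_const_mul]
      congr 1; ext u; simp [f, inner_smul_left])
    (fun x y y' => by
      rw [← integral_add (hi _ _) (hi _ _)]
      congr 1; ext u; simp [f, inner_add_right])
    (fun c x y => by
      rw [smul_eq_mul, ← integral_const_mul]
      congr 1; ext u; simp [f, inner_smul_right])
  refine ⟨B, fun x y => ?_, fun x hx => ?_, fun v x y => ?_⟩
  · change ∫ u, f x y u ∂m = ∫ u, f y x u ∂m
    congr 1; ext u; exact real_inner_comm _ _
  · change 0 < ∫ u, f x x u ∂m
    have hpos : ∀ u, 0 < f x x u := fun u => by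
      have h1 : lieAd u⁻¹ x ≠ 0 := fun h0 => hx (by
        rw [← lieAd_apply_lieAd_inv u x, h0, map_zero])
      have h2 : e (lieAd u⁻¹ x) ≠ 0 := by simpa using h1
      change 0 < inner ℝ (e (lieAd u⁻¹ x)) (e (lieAd u⁻¹ x))
      rw [real_inner_self_eq_norm_sq]
      exact pow_pos (norm_pos_iff.2 h2) 2
    rw [integral_pos_iff_support_of_nonneg (fun u => (hpos u).le) (hi x x)]
    have : Function.support (f x x) = Set.univ := by
      ext u; simp [(hpos u).ne']
    rw [this]
    exact NeZero.pos _
  · change ∫ u, f (lieAd v x) (lieAd v y) u ∂m = ∫ u, f x y u ∂m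
    rw [← integral_mul_left_eq_self (μ := m) (f x y) v⁻¹]
    congr 1; ext u
    simp only [f, mul_inv_rev, inv_inv, lieAd_mul_apply]

variable (S : SymmetricPair E U)

/-- A symmetric positive definite form on the Lie algebra, invariant under the adjoint action and
the involution. -/
structure InvariantForm (B : E →ₗ[ℝ] E →ₗ[ℝ] ℝ) : Prop where
  symm : ∀ x y, B x y = B y x
  pos : ∀ x, x ≠ 0 → 0 < B x x
  invariant : ∀ (u : U) (x y : E), B (lieAd u x) (lieAd u y) = B x y
  invariant_dσ : ∀ x y, B (S.dσ x) (S.dσ y) = B x y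

theorem exists_invariantForm [MeasurableSpace U] [BorelSpace U] :
    ∃ B : E →ₗ[ℝ] E →ₗ[ℝ] ℝ, InvariantForm S B := by
  obtain ⟨B, h1, h2, h3⟩ := exists_lieAd_invariant_form E U
  let d : E →ₗ[ℝ] E := S.dσ
  -- Averaging over {1, dσ} keeps Ad-invariance, because dσ carries Ad(u) to Ad(σ u).
  refine ⟨B + B.compl₁₂ d d, fun x y => ?_, fun x hx => ?_, fun u x y => ?_, fun x y => ?_⟩
  · simp [h1 x y, h1 (d x) (d y)]
  · have : d x ≠ 0 := fun h0 => hx (by rw [← S.dσ_dσ x]; erw [h0]; simp)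
    simpa using add_pos (h2 x hx) (h2 _ this)
  · simp only [LinearMap.add_apply, LinearMap.compl₁₂_apply, h3]
    congr 1
    simp only [d, ContinuousLinearMap.coe_coe, dσ_lieAd, h3]
  · simp [d, S.dσ_dσ, add_comm]

namespace InvariantForm

variable {S} {B : E →ₗ[ℝ] E →ₗ[ℝ] ℝ}

theorem eq_zero (hB : InvariantForm S B) {x : E} (h : B x x = 0) : x = 0 := by
  by_contra hx
  exact (hB.pos x hx).ne' h

/-- The derivative at t = 0 of the constant B(Ad(exp tX)Y, Ad(exp tX)Z). -/
theorem lieBr_skew (hB : InvariantForm S B) (X Y Z : E) : B (lieBr U X Y) Z = -B Y (lieBr U X Z) := by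
  have hd : HasDerivAt (fun t : ℝ => B (lieAd (lieExp U (t • X)) Y)
      (lieAd (lieExp U (t • X)) Z)) (B (lieBr U X Y) Z + B Y (lieBr U X Z)) 0 := by
    let B' : E →L[ℝ] E →L[ℝ] ℝ :=
      LinearMap.toContinuousLinearMap (LinearMap.toContinuousLinearMap.toLinearMap ∘ₗ B)
    have h1 := hasDerivAt_lieAd_lieExp_zero (U := U) X Y
    have h2 := hasDerivAt_lieAd_lieExp_zero (U := U) X Z
    have h3 := (B'.hasFDerivAt.comp_hasDerivAt (0 : ℝ) h1).clm_apply h2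
    simpa [B'] using! h3
  have hc : (fun t : ℝ => B (lieAd (lieExp U (t • X)) Y)
      (lieAd (lieExp U (t • X)) Z)) = fun _ => B Y Z := by
    ext t; exact hB.invariant _ _ _
  rw [hc] at hd
  have := hd.unique (hasDerivAt_const _ _)
  linarith

/-- The kernel of `(ad X)²` is that of `ad X`. -/
theorem lieBr_eq_zero_of_lieBr_lieBr (hB : InvariantForm S B) {X Y : E} (h : lieBr U X (lieBr U X Y) = 0) :
    lieBr U X Y = 0 := by
  apply hB.eq_zero
  rw [hB.lieBr_skew, h]; simp

end InvariantForm

namespace SymmetricPair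

/-- The fixed space `𝔨` of `dσ`. -/
def k : Submodule ℝ E := LinearMap.ker ((S.dσ : E →ₗ[ℝ] E) - LinearMap.id)

variable {S}

theorem mem_p {X : E} : X ∈ S.p ↔ S.dσ X = -X := by
  simp [p, eq_neg_iff_add_eq_zero]

theorem mem_k {X : E} : X ∈ S.k ↔ S.dσ X = X := by
  simp [k, sub_eq_zero]

theorem dσ_coe (X : S.p) : S.dσ (X : E) = -X := mem_p.1 X.2

theorem lieBr_mem_k {X Y : E} (hX : X ∈ S.p) (hY : Y ∈ S.p) : lieBr U X Y ∈ S.k := by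
  rw [mem_k, dσ_lieBr, mem_p.1 hX, mem_p.1 hY]
  simp [lieBr_eq_adL]

theorem lieBr_mem_p {X Y : E} (hX : X ∈ S.k) (hY : Y ∈ S.p) : lieBr U X Y ∈ S.p := by
  rw [mem_p, dσ_lieBr, mem_k.1 hX, mem_p.1 hY]
  simp [lieBr_eq_adL]

theorem eq_zero_of_mem_k_of_mem_p {X : E} (hX : X ∈ S.k) (hY : X ∈ S.p) : X = 0 := by
  rw [mem_k] at hX
  rw [mem_p, hX] at hY
  have h2 : (2 : ℝ) • X = 0 := by rw [two_smul]; nth_rw 2 [hY]; simp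
  simpa using h2

theorem coe_projP (X : E) : (S.projP X : E) = (2 : ℝ)⁻¹ • (X - S.dσ X) := rfl

theorem sub_projP_mem_k (X : E) : X - S.projP X ∈ S.k := by
  rw [mem_k, coe_projP, map_sub, map_smul, map_sub, S.dσ_dσ]
  module

theorem projP_coe (X : S.p) : S.projP (X : E) = X := by
  ext
  rw [coe_projP, dσ_coe]
  module

theorem projP_eq_zero_iff {X : E} : S.projP X = 0 ↔ X ∈ S.k := by
  rw [mem_k, Subtype.ext_iff, coe_projP, Submodule.coe_zero, smul_eq_zero, sub_eq_zero]
  simp [eq_comm]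

theorem lieAd_mem_p {u : U} (hu : u ∈ S.K) {X : E} (hX : X ∈ S.p) : lieAd u X ∈ S.p := by
  rw [mem_p, dσ_lieAd, S.fixed_of_mem u hu, mem_p.1 hX, map_neg]

theorem lieAd_mem_k {u : U} (hu : u ∈ S.K) {X : E} (hX : X ∈ S.k) : lieAd u X ∈ S.k := by
  rw [mem_k, dσ_lieAd, S.fixed_of_mem u hu, mem_k.1 hX]

/-- The one-parameter subgroup of T is a connected set of σ-fixed points through 1, hence lies in
the identity component, which K contains. -/
theorem lieExp_mem_K {T : E} (hT : T ∈ S.k) : lieExp U T ∈ S.K := by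
  have h1 : Set.range (fun t : ℝ => lieExp U (t • T)) ⊆ {u : U | S.σ u = u} := by
    rintro _ ⟨t, rfl⟩
    simp [σ_lieExp, mem_k.1 hT]
  have h2 : IsPreconnected (Set.range (fun t : ℝ => lieExp U (t • T))) :=
    isPreconnected_range (continuous_lieExp_smul T)
  have h3 := h2.subset_connectedComponentIn (x := (1 : U)) ⟨0, by simp⟩ h1
  exact S.component_subset (h3 ⟨1, by simp⟩)

theorem σ_lieExp_of_mem_p {X : E} (hX : X ∈ S.p) : S.σ (lieExp U X) = (lieExp U X)⁻¹ := by
  rw [σ_lieExp, mem_p.1 hX, lieExp_neg]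

theorem isCompact_K : IsCompact (S.K : Set U) := S.isClosed_K.isCompact

/-- The adjoint action of `K` on `𝔭`. -/
def AdK (u : S.K) : S.p →ₗ[ℝ] S.p :=
  ((lieAd (u : U) : E →L[ℝ] E) : E →ₗ[ℝ] E).restrict (fun _ hX => lieAd_mem_p u.2 hX)

@[simp] theorem coe_AdK (u : S.K) (X : S.p) : (S.AdK u X : E) = lieAd (u : U) (X : E) := rfl

theorem AdK_mul (u v : S.K) (X : S.p) : S.AdK (u * v) X = S.AdK u (S.AdK v X) :=
  Subtype.ext (lieAd_mul_apply _ _ _)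

@[simp] theorem AdK_inv_AdK (u : S.K) (X : S.p) : S.AdK u⁻¹ (S.AdK u X) = X :=
  Subtype.ext (lieAd_inv_apply_lieAd _ _)

@[simp] theorem AdK_AdK_inv (u : S.K) (X : S.p) : S.AdK u (S.AdK u⁻¹ X) = X :=
  Subtype.ext (lieAd_apply_lieAd_inv _ _)

/-- An element of `𝔨` fixed by `Ad (exp H)²`, for `H ∈ 𝔭`, is sent into `𝔨` by `Ad (exp H)⁻¹`; and
conversely. -/
theorem lieAd_lieExp_neg_mem_k_iff {H T : E} (hH : H ∈ S.p) (hT : T ∈ S.k) :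
    lieAd (lieExp U (-H)) T ∈ S.k ↔ lieAd (lieExp U ((2 : ℝ) • H)) T = T := by
  rw [mem_k, dσ_lieAd, lieExp_neg, map_inv, σ_lieExp_of_mem_p hH, mem_k.1 hT, inv_inv,
    lieExp_two_smul, lieAd_mul_apply]
  constructor
  · intro h; rw [h, lieAd_apply_lieAd_inv]
  · intro h
    conv_rhs => rw [← h, lieAd_inv_apply_lieAd]

theorem lieAd_lieExp_neg_mem_p_iff {H Y : E} (hH : H ∈ S.p) (hY : Y ∈ S.p) :
    lieAd (lieExp U (-H)) Y ∈ S.p ↔ lieAd (lieExp U ((2 : ℝ) • H)) Y = Y := by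
  rw [mem_p, dσ_lieAd, lieExp_neg, map_inv, σ_lieExp_of_mem_p hH, mem_p.1 hY, inv_inv,
    lieExp_two_smul, lieAd_mul_apply, map_neg, neg_inj]
  constructor
  · intro h; rw [h, lieAd_apply_lieAd_inv]
  · intro h
    conv_rhs => rw [← h, lieAd_inv_apply_lieAd]

theorem Exp_eq_Exp_iff {X Y : S.p} :
    S.Exp X = S.Exp Y ↔ (lieExp U (X : E))⁻¹ * lieExp U (Y : E) ∈ S.K :=
  QuotientGroup.eq

/-- The Cartan embedding separates points up to `K`: points with the same `Exp` have the same
square. -/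
theorem lieExp_two_smul_eq {X Y : E} (hX : X ∈ S.p) (hY : Y ∈ S.p) {k₁ k₂ : U} (hk₁ : k₁ ∈ S.K)
    (hk₂ : k₂ ∈ S.K) (h : lieExp U X = k₁ * lieExp U Y * k₂) :
    lieExp U ((2 : ℝ) • X) = k₁ * lieExp U ((2 : ℝ) • Y) * k₁⁻¹ := by
  have h2 := congrArg S.σ h
  rw [map_mul, map_mul, σ_lieExp_of_mem_p hX, σ_lieExp_of_mem_p hY, S.fixed_of_mem _ hk₁,
    S.fixed_of_mem _ hk₂] at h2
  rw [lieExp_two_smul, lieExp_two_smul]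
  have h3 : lieExp U X = (k₁ * (lieExp U Y)⁻¹ * k₂)⁻¹ := by rw [← h2, inv_inv]
  nth_rw 2 [h3]
  rw [h]; group

end SymmetricPair

end Pair

end Wrapping

end

noncomputable section

namespace Wrapping

/-! ### Regular elements, Hunt's argument and conjugacy in 𝔞. -/

section Structure

set_option linter.unusedSectionVars false

variable {E : Type*} [NormedAddCommGroup E] [NormedSpace ℝ E] [FiniteDimensional ℝ E]
  {U : Type*} [TopologicalSpace U] [ChartedSpace E U] [Group U] [LieGroup 𝓘(ℝ, E) ∞ U]
  [IsTopologicalGroup U] [T2Space U] [CompactSpace U] [CompleteSpace E]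
  {S : SymmetricPair E U}

namespace SymmetricPair.IsMaximalAbelian

variable {𝔞 : Submodule ℝ S.p}

theorem lieBr_eq_zero (h : S.IsMaximalAbelian 𝔞) {X Y : S.p} (hX : X ∈ 𝔞) (hY : Y ∈ 𝔞) :
    lieBr U (X : E) (Y : E) = 0 := h.prop X hX Y hY

theorem mem_of_forall_lieBr (h : S.IsMaximalAbelian 𝔞) {Z : S.p}
    (hZ : ∀ X ∈ 𝔞, lieBr U (X : E) (Z : E) = 0) : Z ∈ 𝔞 := by
  have hle : 𝔞 ⊔ Submodule.span ℝ {Z} ≤ 𝔞 := by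
    refine h.2 ?_ le_sup_left
    intro X hX Y hY
    obtain ⟨X₁, hX₁, X₂, hX₂, rfl⟩ := Submodule.mem_sup.1 hX
    obtain ⟨Y₁, hY₁, Y₂, hY₂, rfl⟩ := Submodule.mem_sup.1 hY
    obtain ⟨a, rfl⟩ := Submodule.mem_span_singleton.1 hX₂
    obtain ⟨b, rfl⟩ := Submodule.mem_span_singleton.1 hY₂
    simp [lieBr_add_left, lieBr_add_right, lieBr_smul_left, lieBr_smul_right,
      h.lieBr_eq_zero hX₁ hY₁, hZ X₁ hX₁, lieBr_comm_zero (hZ Y₁ hY₁)]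
  exact hle (Submodule.mem_sup_right (Submodule.mem_span_singleton_self Z))

/-- A maximal abelian subspace contains a regular element: one whose centraliser in `𝔭` is the
subspace. -/
theorem exists_regular {B : E →ₗ[ℝ] E →ₗ[ℝ] ℝ} (hB : InvariantForm S B)
    (h : S.IsMaximalAbelian 𝔞) :
    ∃ A ∈ 𝔞, ∀ Y : S.p, lieBr U (A : E) (Y : E) = 0 → Y ∈ 𝔞 := by
  -- A is chosen in 𝔞 with ker(ad A) of least dimension. For A' in 𝔞 and small t, ker ad(A + tA')
  -- lies in ker(ad A) ∩ ker(ad A'); minimality then forces ker(ad A) ⊆ ker(ad A').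
  let d : 𝔞 → ℕ := fun A => Module.finrank ℝ (LinearMap.ker (adL E U (A : S.p) : E →ₗ[ℝ] E))
  obtain ⟨A, hA⟩ : ∃ A, ∀ A', d A ≤ d A' :=
    ⟨Function.argmin d, fun A' => Function.argmin_le d A'⟩
  refine ⟨A, A.2, fun Y hY => h.mem_of_forall_lieBr fun A' hA' => ?_⟩
  set M : E →L[ℝ] E := adL E U ((A : S.p) : E) with hM
  set M' : E →L[ℝ] E := adL E U (A' : E) with hM'
  have hcomm : ∀ v, M (M' v) = M' (M v) := fun v => by
    have := lieAd_comm_lieBr_of_lieBr_eq_zero (Z := v) (h.lieBr_eq_zero A.2 hA')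
    simpa only [lieBr_eq_adL] using this
  have hMM : ∀ v, M (M v) = 0 → M v = 0 := fun v hv => by
    have := hB.lieBr_eq_zero_of_lieBr_lieBr (X := ((A : S.p) : E)) (Y := v)
    simp only [lieBr_eq_adL] at this
    exact this hv
  let W := LinearMap.range (M : E →ₗ[ℝ] E)
  -- As ker (ad A)² = ker(ad A), the map ad A is injective on its range, hence bounded below there.
  obtain ⟨C, hC, hanti⟩ := LinearMap.exists_antilipschitzWith ((M : E →ₗ[ℝ] E).domRestrict W) (by
    rw [LinearMap.ker_eq_bot']
    rintro ⟨_, ⟨v, rfl⟩⟩ hv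
    exact Subtype.ext (hMM v hv))
  have hbd : ∀ v, ‖M v‖ ≤ C * ‖M (M v)‖ := fun v => by
    simpa using! hanti.le_mul_norm (map_zero _) (⟨M v, ⟨v, rfl⟩⟩ : W)
  have hCpos : (0 : ℝ) < C := hC
  -- Small enough that C·t·‖M'‖ ≤ 1/2, so that the estimate for `M v` absorbs itself.
  set t : ℝ := (2 * C * (‖M'‖ + 1))⁻¹ with ht
  have htpos : 0 < t := by positivity
  have hker : LinearMap.ker (adL E U (((A : S.p) + t • A' : S.p) : E) : E →ₗ[ℝ] E) ≤
      LinearMap.ker (M : E →ₗ[ℝ] E) ⊓ LinearMap.ker (M' : E →ₗ[ℝ] E) := by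
    intro v hv
    have hv' : M v + t • M' v = 0 := by simpa [hM, hM'] using! hv
    have h1 : M (M v) = -(t • M' (M v)) := by
      have := congrArg M hv'
      rw [map_add, map_smul, hcomm, map_zero] at this
      exact eq_neg_of_add_eq_zero_left this
    have h2 : ‖M v‖ ≤ 1 / 2 * ‖M v‖ := by
      calc ‖M v‖ ≤ C * ‖M (M v)‖ := hbd v
        _ = C * (t * ‖M' (M v)‖) := by rw [h1, norm_neg, norm_smul, Real.norm_of_nonneg htpos.le]
        _ ≤ C * (t * ((‖M'‖ + 1) * ‖M v‖)) := by
          have := M'.le_opNorm (M v)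
          gcongr
          nlinarith [norm_nonneg (M v)]
        _ = 1 / 2 * ‖M v‖ := by rw [ht]; field_simp
    have h3 : M v = 0 := by
      rw [← norm_eq_zero]; linarith [norm_nonneg (M v)]
    refine ⟨h3, ?_⟩
    rw [h3, zero_add, smul_eq_zero] at hv'
    exact hv'.resolve_left htpos.ne'
  have hle : Module.finrank ℝ (LinearMap.ker (M : E →ₗ[ℝ] E)) ≤
      Module.finrank ℝ (LinearMap.ker (adL E U (((A : S.p) + t • A' : S.p) : E) : E →ₗ[ℝ] E)) :=
    hA ⟨(A : S.p) + t • A', 𝔞.add_mem A.2 (𝔞.smul_mem t hA')⟩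
  have heq := Submodule.eq_of_le_of_finrank_le (hker.trans inf_le_left) hle
  have hYM : (Y : E) ∈ LinearMap.ker (M : E →ₗ[ℝ] E) := by
    simpa [hM, lieBr_eq_adL] using hY
  rw [← heq] at hYM
  have := (hker hYM).2
  rw [lieBr_eq_adL]
  simpa [hM'] using this

end SymmetricPair.IsMaximalAbelian

/-- A conjugation argument of Hunt: the maximum of `g ↦ B (Ad g A, C)` over a compact group yields
a commuting conjugate. -/
theorem exists_lieBr_lieAd_eq_zero {B : E →ₗ[ℝ] E →ₗ[ℝ] ℝ} (hB : InvariantForm S B)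
    {L : Subgroup U} (hL : IsClosed (L : Set U)) {l : Set E}
    (hl : ∀ T ∈ l, ∀ t : ℝ, lieExp U (t • T) ∈ L) {A C : E}
    (h : ∀ g ∈ L, lieBr U (lieAd g A) C ∈ l) : ∃ g ∈ L, lieBr U (lieAd g A) C = 0 := by
  let φ : E →L[ℝ] ℝ := LinearMap.toContinuousLinearMap (B.flip C)
  have hc : Continuous fun g : U => φ (lieAd g A) :=
    φ.continuous.comp (continuous_lieAd.clm_apply continuous_const)
  obtain ⟨g, hg, hmax⟩ := hL.isCompact.exists_isMaxOn ⟨1, L.one_mem⟩ hc.continuousOn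
  refine ⟨g, hg, ?_⟩
  set T := lieBr U (lieAd g A) C with hT
  have hd : HasDerivAt (fun t : ℝ => φ (lieAd (lieExp U (t • T)) (lieAd g A)))
      (φ (lieBr U T (lieAd g A))) 0 :=
    φ.hasFDerivAt.comp_hasDerivAt 0 (hasDerivAt_lieAd_lieExp_zero (U := U) T (lieAd g A))
  have hloc : IsLocalMax (fun t : ℝ => φ (lieAd (lieExp U (t • T)) (lieAd g A))) 0 := by
    refine Filter.Eventually.of_forall fun t => ?_
    have := hmax (L.mul_mem (hl T (h g hg) t) hg)
    simpa [lieAd_mul_apply] using this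
  -- By skewness this critical value condition, in the direction T = [Ad(g)A, C], reads B(T, T) = 0.
  have h0 : B (lieBr U T (lieAd g A)) C = 0 := hloc.hasDerivAt_eq_zero hd
  rw [lieBr_swap, map_neg, LinearMap.neg_apply, hB.lieBr_skew, neg_neg] at h0
  exact hB.eq_zero h0

namespace SymmetricPair

variable (S) in
/-- The stabiliser in `K` of the point `exp(H) K`. -/
def stab (H : E) : Subgroup U :=
  S.K ⊓ S.K.comap (MulAut.conj (lieExp U H)⁻¹).toMonoidHom

theorem mem_stab {H : E} {u : U} :
    u ∈ S.stab H ↔ u ∈ S.K ∧ (lieExp U H)⁻¹ * u * lieExp U H ∈ S.K := by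
  simp [stab, Subgroup.mem_inf]

theorem isClosed_stab (H : E) : IsClosed (S.stab H : Set U) := by
  have : (S.stab H : Set U) =
      (S.K : Set U) ∩ (fun u => (lieExp U H)⁻¹ * u * lieExp U H) ⁻¹' (S.K : Set U) := by
    ext u; simp [mem_stab]
  rw [this]
  exact S.isClosed_K.inter (S.isClosed_K.preimage
    ((continuous_const.mul continuous_id).mul continuous_const))

/-- An element u of K fixing exp(H)K satisfies exp H = u exp(H) k for some k in K, so the Cartan
embedding shows that it commutes with exp 2H. -/
theorem conj_lieExp_two_of_mem_stab {H : E} (hH : H ∈ S.p) {u : U} (hu : u ∈ S.stab H) :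
    lieExp U ((2 : ℝ) • H) = u * lieExp U ((2 : ℝ) • H) * u⁻¹ := by
  obtain ⟨h1, h2⟩ := mem_stab.1 hu
  refine lieExp_two_smul_eq hH hH h1 (S.K.inv_mem h2) ?_
  group

theorem lieAd_lieExp_two_of_mem_stab {H : E} (hH : H ∈ S.p) {u : U} (hu : u ∈ S.stab H) {Z : E}
    (hZ : lieAd (lieExp U ((2 : ℝ) • H)) Z = Z) :
    lieAd (lieExp U ((2 : ℝ) • H)) (lieAd u Z) = lieAd u Z := by
  have h := conj_lieExp_two_of_mem_stab hH hu
  rw [← lieAd_mul_apply]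
  have h2 : lieExp U ((2 : ℝ) • H) * u = u * lieExp U ((2 : ℝ) • H) := by
    conv_lhs => rw [h]
    group
  rw [h2, lieAd_mul_apply, hZ]

/-- Hunt's argument for the stabiliser of exp(H)K. It contains exp of every vector of 𝔨 fixed by
Ad(exp 2H), and the bracket of two vectors of 𝔭 fixed by Ad(exp 2H) is such a vector. -/
theorem exists_mem_stab_lieBr_eq_zero {B : E →ₗ[ℝ] E →ₗ[ℝ] ℝ} (hB : InvariantForm S B)
    {H A C : E} (hH : H ∈ S.p) (hA : A ∈ S.p) (hC : C ∈ S.p)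
    (hA2 : lieAd (lieExp U ((2 : ℝ) • H)) A = A) (hC2 : lieAd (lieExp U ((2 : ℝ) • H)) C = C) :
    ∃ u ∈ S.stab H, lieBr U (lieAd u A) C = 0 := by
  refine exists_lieBr_lieAd_eq_zero hB (isClosed_stab H)
    (l := {T | T ∈ S.k ∧ lieAd (lieExp U ((2 : ℝ) • H)) T = T}) ?_ ?_
  · rintro T ⟨hT, hT2⟩ t
    have htk : t • T ∈ S.k := S.k.smul_mem t hT
    refine mem_stab.2 ⟨lieExp_mem_K htk, ?_⟩
    rw [← lieExp_neg]
    have := conj_lieExp (lieExp U (-H)) (t • T)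
    rw [lieExp_neg, inv_inv, ← lieExp_neg] at this
    rw [this]
    refine lieExp_mem_K ((lieAd_lieExp_neg_mem_k_iff hH htk).2 ?_)
    rw [map_smul, hT2]
  · intro g hg
    refine ⟨lieBr_mem_k (lieAd_mem_p (mem_stab.1 hg).1 hA) hC, ?_⟩
    rw [lieAd_lieBr, lieAd_lieExp_two_of_mem_stab hH hg hA2, hC2]

theorem lieAd_lieExp_two_neg {H Z : E} (h : lieAd (lieExp U ((2 : ℝ) • H)) Z = Z) :
    lieAd (lieExp U ((2 : ℝ) • -H)) Z = Z := by
  rw [smul_neg, lieExp_neg]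
  conv_lhs => rw [← h]
  exact lieAd_inv_apply_lieAd _ _

variable {𝔞 : Submodule ℝ S.p} {B : E →ₗ[ℝ] E →ₗ[ℝ] ℝ}

theorem IsMaximalAbelian.lieAd_lieExp_two (h : S.IsMaximalAbelian 𝔞) {X Y : S.p} (hX : X ∈ 𝔞)
    (hY : Y ∈ 𝔞) : lieAd (lieExp U ((2 : ℝ) • (X : E))) (Y : E) = Y :=
  lieAd_lieExp_smul_of_lieBr_eq_zero (h.lieBr_eq_zero hX hY) 2

theorem IsMaximalAbelian.exists_AdK_mem (h : S.IsMaximalAbelian 𝔞) (hB : InvariantForm S B)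
    {H : S.p} (hH : H ∈ 𝔞) {Z : S.p} (hZ : lieAd (lieExp U ((2 : ℝ) • (H : E))) (Z : E) = Z) :
    ∃ u : S.K, (u : U) ∈ S.stab (H : E) ∧ S.AdK u Z ∈ 𝔞 := by
  obtain ⟨A, hA, hreg⟩ := h.exists_regular hB
  obtain ⟨u, hu, hu0⟩ := exists_mem_stab_lieBr_eq_zero hB H.2 Z.2 A.2 hZ
    (h.lieAd_lieExp_two hH hA)
  exact ⟨⟨u, (mem_stab.1 hu).1⟩, hu, hreg _ (lieBr_comm_zero hu0)⟩

theorem IsMaximalAbelian.exists_AdK_mem' (h : S.IsMaximalAbelian 𝔞) (hB : InvariantForm S B)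
    (X : S.p) : ∃ u : S.K, S.AdK u X ∈ 𝔞 := by
  -- At H = 0 the fixed-point condition is empty.
  obtain ⟨u, -, hu⟩ := h.exists_AdK_mem hB 𝔞.zero_mem (Z := X) (by simp)
  exact ⟨u, hu⟩

/-- For a regular A in 𝔞, both A and Ad(k₁)A are fixed by Ad(exp 2H'), since exp 2H' = k₁ exp(2H)
k₁⁻¹. Some l in the stabiliser of exp(H')K makes Ad(l)A commute with Ad(k₁)A, and w = l⁻¹k₁ is the
required element. -/
theorem IsMaximalAbelian.exists_weyl (h : S.IsMaximalAbelian 𝔞) (hB : InvariantForm S B)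
    {H H' : S.p} (hH : H ∈ 𝔞) (hH' : H' ∈ 𝔞) {k₁ k₂ : U} (hk₁ : k₁ ∈ S.K) (hk₂ : k₂ ∈ S.K)
    (e : lieExp U (H' : E) = k₁ * lieExp U (H : E) * k₂) :
    ∃ w : S.K, (∀ X ∈ 𝔞, S.AdK w X ∈ 𝔞) ∧ H' - S.AdK w H ∈ S.lattice 𝔞 := by
  obtain ⟨A, hA, hreg⟩ := h.exists_regular hB
  have e2 := lieExp_two_smul_eq H'.2 H.2 hk₁ hk₂ e
  obtain ⟨l, hl, hl0⟩ := exists_mem_stab_lieBr_eq_zero hB H'.2 A.2 (lieAd_mem_p hk₁ A.2)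
    (h.lieAd_lieExp_two hH' hA) (by
      rw [e2, ← lieAd_mul_apply, inv_mul_cancel_right, lieAd_mul_apply, h.lieAd_lieExp_two hH hA])
  obtain ⟨hlK, hlH⟩ := mem_stab.1 hl
  let w : S.K := ⟨l⁻¹ * k₁, S.K.mul_mem (S.K.inv_mem hlK) hk₁⟩
  -- Ad(w⁻¹)A commutes with the regular A, so it lies in 𝔞 and commutes with X; applying Ad(w), the
  -- vector Ad(w)X commutes with A.
  have hw : ∀ X ∈ 𝔞, S.AdK w X ∈ 𝔞 := by
    intro X hX
    have h1 : S.AdK w⁻¹ A ∈ 𝔞 := by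
      refine hreg _ (lieBr_comm_zero ?_)
      have h2 := congrArg (fun v : E => lieAd k₁⁻¹ v) hl0
      simp only [lieAd_lieBr, lieAd_inv_apply_lieAd, map_zero] at h2
      rw [← lieAd_mul_apply] at h2
      simpa [w] using h2
    refine hreg _ ?_
    have h3 := congrArg (fun v : E => lieAd (w : U) v) (h.lieBr_eq_zero h1 hX)
    simpa only [lieAd_lieBr, map_zero, coe_AdK, InvMemClass.coe_inv, lieAd_apply_lieAd_inv] using h3
  refine ⟨w, hw, 𝔞.sub_mem hH' (hw H hH), ?_⟩
  have h4 : lieBr U ((H' : S.p) : E) ((S.AdK w H : S.p) : E) = 0 := h.lieBr_eq_zero hH' (hw H hH)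
  have h5 := lieExp_sub_of_lieBr_eq_zero h4
  rw [Submodule.coe_sub, h5]
  have h6 : lieExp U (H' : E) * (lieExp U ((S.AdK w H : S.p) : E))⁻¹ =
      (lieExp U ((S.AdK w H : S.p) : E))⁻¹ * lieExp U (H' : E) := by
    have := commute_lieExp_of_lieBr_eq_zero h4
    rw [eq_inv_mul_iff_mul_eq, ← mul_assoc, ← this, mul_inv_cancel_right]
  have h7 : lieExp U ((S.AdK w H : S.p) : E) = (l⁻¹ * k₁) * lieExp U (H : E) * (l⁻¹ * k₁)⁻¹ := by
    rw [conj_lieExp]; rfl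
  have h8 : lieExp U (H : E) = k₁⁻¹ * lieExp U (H' : E) * k₂⁻¹ := by rw [e]; group
  -- Every factor on the right lies in K, the last one because l fixes exp(H')K.
  have h9 : (lieExp U ((S.AdK w H : S.p) : E))⁻¹ * lieExp U (H' : E) =
      l⁻¹ * k₁ * k₂ * ((lieExp U (H' : E))⁻¹ * l * lieExp U (H' : E)) := by
    rw [h7, h8]; group
  rw [h6, h9]
  exact S.K.mul_mem (S.K.mul_mem (S.K.mul_mem (S.K.inv_mem hlK) hk₁) hk₂) hlH

end SymmetricPair

end Structure

end Wrapping

end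

noncomputable section

namespace Wrapping

/-! ### The decomposition U = K exp(𝔞) K. -/

section Decomposition

set_option linter.unusedSectionVars false

variable {E : Type*} [NormedAddCommGroup E] [NormedSpace ℝ E] [FiniteDimensional ℝ E]
  {U : Type*} [TopologicalSpace U] [ChartedSpace E U] [Group U] [LieGroup 𝓘(ℝ, E) ∞ U]
  [IsTopologicalGroup U] [T2Space U] [CompactSpace U] [CompleteSpace E]
  {S : SymmetricPair E U} {𝔞 : Submodule ℝ S.p} {B : E →ₗ[ℝ] E →ₗ[ℝ] ℝ}

namespace InvariantForm

/-- Y + dσ(Y) lies in 𝔨 and is orthogonal to Y, hence by invariance also to dσ(Y), so it is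
orthogonal to itself. -/
theorem mem_p_of_forall_mem_k (hB : InvariantForm S B) {Y : E} (h : ∀ T ∈ S.k, B Y T = 0) :
    Y ∈ S.p := by
  have h1 : B (Y + S.dσ Y) (Y + S.dσ Y) = 0 := by
    have h2 : B Y (Y + S.dσ Y) = 0 := h _ (by
      rw [SymmetricPair.mem_k, map_add, S.dσ_dσ, add_comm])
    have h3 : B (S.dσ Y) (Y + S.dσ Y) = 0 := by
      rw [← hB.invariant_dσ, S.dσ_dσ, map_add, S.dσ_dσ, add_comm (S.dσ Y), h2]
    have h4 : B (Y + S.dσ Y) = B Y + B (S.dσ Y) := map_add _ _ _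
    rw [h4, LinearMap.add_apply, h2, h3, add_zero]
  rw [SymmetricPair.mem_p]
  exact (neg_eq_of_add_eq_zero_right (hB.eq_zero h1)).symm

theorem eq_top_of_forall (hB : InvariantForm S B) {R : Submodule ℝ E}
    (h : ∀ Y : E, (∀ x ∈ R, B Y x = 0) → Y = 0) : R = ⊤ := by
  by_contra hR
  obtain ⟨f, hf, hle⟩ := Submodule.exists_le_ker_of_lt_top R (lt_top_iff_ne_top.2 hR)
  have hinj : Function.Injective B := by
    rw [← LinearMap.ker_eq_bot, LinearMap.ker_eq_bot']
    intro x hx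
    exact hB.eq_zero (by rw [hx]; rfl)
  have hsurj := (LinearMap.injective_iff_surjective_of_finrank_eq_finrank
    (Subspace.dual_finrank_eq (K := ℝ) (V := E)).symm).1 hinj
  obtain ⟨Y, rfl⟩ := hsurj f
  exact hf (by rw [h Y fun x hx => hle hx, map_zero])

/-- The tangent space at `exp H` is spanned by the `K`-orbit directions on both sides together with
the part of `𝔭` fixed by `Ad (exp 2H)`. -/
theorem exists_sum_eq (hB : InvariantForm S B) {H : E} (hH : H ∈ S.p) (v : E) :
    ∃ T ∈ S.k, ∃ Z ∈ S.p, ∃ T' ∈ S.k, lieAd (lieExp U ((2 : ℝ) • H)) Z = Z ∧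
      lieAd (lieExp U (-H)) T + Z + T' = v := by
  let z : Submodule ℝ E := S.p ⊓ LinearMap.ker
    (((lieAd (lieExp U ((2 : ℝ) • H)) : E →L[ℝ] E) : E →ₗ[ℝ] E) - LinearMap.id)
  have hz : ∀ Z, Z ∈ z ↔ Z ∈ S.p ∧ lieAd (lieExp U ((2 : ℝ) • H)) Z = Z := fun Z => by
    simp [z, sub_eq_zero]
  let A : E →ₗ[ℝ] E := (lieAd (lieExp U (-H)) : E →L[ℝ] E)
  have htop : (S.k.map A ⊔ z) ⊔ S.k = ⊤ := by
    -- A vector Y orthogonal to 𝔨 and to Ad(exp(-H))𝔨 has Y and Ad(exp H)Y in 𝔭, hence is fixed by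
    -- Ad(exp 2H). It then lies in the third summand, to which it is also orthogonal.
    refine hB.eq_top_of_forall fun Y hY => ?_
    have h1 : Y ∈ S.p := hB.mem_p_of_forall_mem_k fun T hT => hY T (Submodule.mem_sup_right hT)
    have h2 : lieAd (lieExp U (- -H)) Y ∈ S.p := hB.mem_p_of_forall_mem_k fun T hT => by
      rw [← hB.invariant (lieExp U (-H)), lieExp_neg (-H), lieAd_apply_lieAd_inv]
      exact hY _ (Submodule.mem_sup_left (Submodule.mem_sup_left ⟨T, hT, rfl⟩))
    have h3 := (SymmetricPair.lieAd_lieExp_neg_mem_p_iff (S.p.neg_mem hH) h1).1 h2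
    have h4 := SymmetricPair.lieAd_lieExp_two_neg h3
    rw [neg_neg] at h4
    exact hB.eq_zero (hY Y (Submodule.mem_sup_left (Submodule.mem_sup_right ((hz Y).2 ⟨h1, h4⟩))))
  have hv : v ∈ (S.k.map A ⊔ z) ⊔ S.k := htop ▸ Submodule.mem_top
  obtain ⟨y, hy, T', hT', rfl⟩ := Submodule.mem_sup.1 hv
  obtain ⟨_, ⟨T, hT, rfl⟩, Z, hZ, rfl⟩ := Submodule.mem_sup.1 hy
  exact ⟨T, hT, Z, ((hz Z).1 hZ).1, T', hT', ((hz Z).1 hZ).2, rfl⟩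

end InvariantForm

namespace SymmetricPair

variable (S 𝔞) in
/-- The set `K exp(𝔞) K`. -/
def doubleCoset : Set U := {u | ∃ k₁ ∈ S.K, ∃ H ∈ 𝔞, ∃ k₂ ∈ S.K, u = k₁ * lieExp U (H : E) * k₂}

/-- The points exp(H) exp(Ad(exp(-H))T) exp(Z) exp(T') = exp(T) exp(H) exp(Z) exp(T') fill a
neighbourhood of exp H, and Z can be rotated into 𝔞 by an element of K that slides past exp H. -/
theorem IsMaximalAbelian.doubleCoset_mem_nhds_lieExp (h : S.IsMaximalAbelian 𝔞)
    (hB : InvariantForm S B) {H : S.p} (hH : H ∈ 𝔞) :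
    S.doubleCoset 𝔞 ∈ 𝓝 (lieExp U (H : E)) := by
  let z : Submodule ℝ E := S.p ⊓ LinearMap.ker
    (((lieAd (lieExp U ((2 : ℝ) • (H : E))) : E →L[ℝ] E) : E →ₗ[ℝ] E) - LinearMap.id)
  have hz : ∀ Z, Z ∈ z ↔ Z ∈ S.p ∧ lieAd (lieExp U ((2 : ℝ) • (H : E))) Z = Z := fun Z => by
    simp [z, sub_eq_zero]
  let F := S.k × z × S.k
  let L₁ : F →L[ℝ] E := (lieAd (lieExp U (-(H : E)))).comp
    (S.k.subtypeL.comp (ContinuousLinearMap.fst ℝ S.k (z × S.k)))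
  let L₂ : F →L[ℝ] E := z.subtypeL.comp ((ContinuousLinearMap.fst ℝ z S.k).comp
    (ContinuousLinearMap.snd ℝ S.k (z × S.k)))
  let L₃ : F →L[ℝ] E := S.k.subtypeL.comp ((ContinuousLinearMap.snd ℝ z S.k).comp
    (ContinuousLinearMap.snd ℝ S.k (z × S.k)))
  have hmap := map_lieExp_mul₃_nhds_zero (U := U) L₁ L₂ L₃ (by
    rw [LinearMap.range_eq_top]
    intro v
    obtain ⟨T, hT, Z, hZ, T', hT', hZ2, hv⟩ := hB.exists_sum_eq H.2 v
    exact ⟨(⟨T, hT⟩, ⟨Z, (hz Z).2 ⟨hZ, hZ2⟩⟩, ⟨T', hT'⟩), hv⟩)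
  have hkey : ∀ y : F, lieExp U (H : E) * (lieExp U (L₁ y) * lieExp U (L₂ y) * lieExp U (L₃ y)) ∈
      S.doubleCoset 𝔞 := by
    rintro ⟨T, Z, T'⟩
    change lieExp U (H : E) * (lieExp U (lieAd (lieExp U (-(H : E))) (T : E)) *
      lieExp U (Z : E) * lieExp U (T' : E)) ∈ _
    obtain ⟨hZp, hZ⟩ := (hz Z).1 Z.2
    -- The stabiliser is taken at -H, so that exp(H) l exp(H)⁻¹ lies in K and can be absorbed on the
    -- left.
    obtain ⟨l, hl, hlZ⟩ := h.exists_AdK_mem hB (𝔞.neg_mem hH) (Z := ⟨Z, hZp⟩)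
      (by simpa using lieAd_lieExp_two_neg hZ)
    have hcomm := h.lieBr_eq_zero hH hlZ
    have hadd := lieExp_add_of_lieBr_eq_zero hcomm
    have hconj : lieExp U ((S.AdK l ⟨Z, hZp⟩ : S.p) : E) =
        (l : U) * lieExp U (Z : E) * (l : U)⁻¹ := by rw [conj_lieExp]; rfl
    obtain ⟨hlK, hl2⟩ := mem_stab.1 hl
    rw [Submodule.coe_neg, lieExp_neg, inv_inv] at hl2
    refine ⟨lieExp U (T : E) * (lieExp U (H : E) * l * (lieExp U (H : E))⁻¹)⁻¹,
      S.K.mul_mem (lieExp_mem_K T.2) (S.K.inv_mem hl2), H + S.AdK l ⟨Z, hZp⟩,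
      𝔞.add_mem hH hlZ, l * lieExp U (T' : E), S.K.mul_mem l.2 (lieExp_mem_K T'.2), ?_⟩
    rw [Submodule.coe_add, hadd, hconj, ← conj_lieExp, lieExp_neg]
    group
  have h1 : {w : U | lieExp U (H : E) * w ∈ S.doubleCoset 𝔞} ∈ 𝓝 (1 : U) := by
    rw [← hmap]
    exact Filter.mem_map.2 (Filter.univ_mem' hkey)
  have h2 : Filter.Tendsto (fun u : U => (lieExp U (H : E))⁻¹ * u) (𝓝 (lieExp U (H : E)))
      (𝓝 1) := by
    have hc : Continuous fun u : U => (lieExp U (H : E))⁻¹ * u := by fun_prop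
    exact hc.tendsto' _ _ (inv_mul_cancel _)
  filter_upwards [h2 h1] with u hu
  simpa using hu

theorem IsMaximalAbelian.isOpen_doubleCoset (h : S.IsMaximalAbelian 𝔞)
    (hB : InvariantForm S B) : IsOpen (S.doubleCoset 𝔞) := by
  rw [isOpen_iff_mem_nhds]
  rintro _ ⟨k₁, hk₁, H, hH, k₂, hk₂, rfl⟩
  have h2 : Filter.Tendsto (fun u : U => k₁⁻¹ * u * k₂⁻¹) (𝓝 (k₁ * lieExp U (H : E) * k₂))
      (𝓝 (lieExp U (H : E))) := by
    have hc : Continuous fun u : U => k₁⁻¹ * u * k₂⁻¹ := by fun_prop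
    exact hc.tendsto' _ _ (by group)
  filter_upwards [h2 (h.doubleCoset_mem_nhds_lieExp hB hH)] with u hu
  obtain ⟨a, ha, H', hH', b, hb, e⟩ := hu
  have e' : k₁⁻¹ * u * k₂⁻¹ = a * lieExp U (H' : E) * b := e
  refine ⟨k₁ * a, S.K.mul_mem hk₁ ha, H', hH', b * k₂, S.K.mul_mem hb hk₂, ?_⟩
  calc u = k₁ * (k₁⁻¹ * u * k₂⁻¹) * k₂ := by group
    _ = _ := by rw [e']; group

/-- Near the identity, `exp 𝔞` is the image of a neighbourhood of `0` in `𝔞`. -/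
theorem IsMaximalAbelian.exists_nhds_one (h : S.IsMaximalAbelian 𝔞) :
    ∃ N ∈ 𝓝 (1 : U), ∀ A ∈ 𝔞, lieExp U (A : E) ∈ N →
      ∃ A' ∈ 𝔞, ‖A'‖ < 1 ∧ lieExp U (A : E) = lieExp U (A' : E) := by
  obtain ⟨r, hr, hinj⟩ := exists_injOn_lieExp E U
  obtain ⟨M, hM1, hM⟩ := exists_norm_lieAd_le E U
  set C := max M ‖S.dσ‖ with hC
  have hC1 : 1 ≤ C := hM1.trans (le_max_left _ _)
  have hC0 : 0 < C := by linarith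
  -- On the ball of radius δ all of Y, -Y, dσ(Y) and Ad(u)Y stay where exp is injective, so
  -- identities between exponentials give dσ(Y) = -Y and that Y commutes with 𝔞.
  set δ := min 1 (r / C) with hδ
  have hδ0 : 0 < δ := lt_min one_pos (by positivity)
  have hsmall : ∀ L : E →L[ℝ] E, ‖L‖ ≤ C → ∀ Y ∈ Metric.ball (0 : E) δ,
      L Y ∈ Metric.ball (0 : E) r := by
    intro L hL Y hY
    rw [mem_ball_zero_iff] at hY ⊢
    calc ‖L Y‖ ≤ ‖L‖ * ‖Y‖ := L.le_opNorm Y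
      _ ≤ C * ‖Y‖ := by gcongr
      _ < C * (r / C) := by gcongr; exact hY.trans_le (min_le_right _ _)
      _ = r := by field_simp
  refine ⟨lieExp U '' Metric.ball (0 : E) δ, ?_, ?_⟩
  · rw [← map_lieExp_nhds_zero (E := E) (U := U)]
    exact Filter.image_mem_map (Metric.ball_mem_nhds _ hδ0)
  · rintro A hA ⟨Y, hY, hYA⟩
    have hid : ∀ Y ∈ Metric.ball (0 : E) δ, Y ∈ Metric.ball (0 : E) r := fun Y hY =>
      hsmall (ContinuousLinearMap.id ℝ E) ((ContinuousLinearMap.norm_id_le (𝕜 := ℝ) (E := E)).trans hC1) Y hY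
    have hYneg : -Y ∈ Metric.ball (0 : E) δ := by
      rw [mem_ball_zero_iff] at hY ⊢; rwa [norm_neg]
    have hYp : Y ∈ S.p := by
      rw [mem_p]
      refine hinj (hsmall _ (le_max_right _ _) Y hY) (hid _ hYneg) ?_
      rw [← σ_lieExp, lieExp_neg, hYA, σ_lieExp_of_mem_p A.2]
    have hYa : (⟨Y, hYp⟩ : S.p) ∈ 𝔞 := by
      refine h.mem_of_forall_lieBr fun X hX => lieBr_eq_zero_of_forall_lieAd (U := U) fun t => ?_
      refine hinj (hsmall _ ((hM _).trans (le_max_left _ _)) Y hY) (hid Y hY) ?_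
      rw [← conj_lieExp, hYA, mul_inv_eq_iff_eq_mul]
      refine commute_lieExp_of_lieBr_eq_zero ?_
      rw [lieBr_smul_left, h.lieBr_eq_zero hX hA, smul_zero]
    refine ⟨⟨Y, hYp⟩, hYa, ?_, hYA.symm⟩
    rw [mem_ball_zero_iff] at hY
    exact hY.trans_le (min_le_left _ _)

/-- The closure of exp 𝔞 is compact, so finitely many translates of the neighbourhood N by elements
of exp 𝔞 cover it; each point of exp 𝔞 is then the exponential of one of finitely many vectors plus
a vector of norm below 1. -/
theorem IsMaximalAbelian.exists_norm_le (h : S.IsMaximalAbelian 𝔞) :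
    ∃ R : ℝ, ∀ A ∈ 𝔞, ∃ A' ∈ 𝔞, ‖A'‖ ≤ R ∧ lieExp U (A : E) = lieExp U (A' : E) := by
  obtain ⟨N, hN, hNA⟩ := h.exists_nhds_one
  let T : Set U := (fun A : S.p => lieExp U (A : E)) '' (𝔞 : Set S.p)
  have hNo := isOpen_interior (s := N)
  have h1N : (1 : U) ∈ interior N := mem_interior_iff_mem_nhds.2 hN
  have hcover : closure T ⊆ ⋃ A : 𝔞, (fun u : U => (lieExp U ((A : S.p) : E))⁻¹ * u) ⁻¹'
      interior N := by
    intro x hx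
    have hop : IsOpen ((fun u : U => u⁻¹ * x) ⁻¹' interior N) :=
      hNo.preimage (continuous_inv.mul continuous_const)
    obtain ⟨_, hu, A, hA, rfl⟩ := mem_closure_iff.1 hx _ hop (by simpa using h1N)
    exact Set.mem_iUnion.2 ⟨⟨A, hA⟩, hu⟩
  obtain ⟨s, hs⟩ := isClosed_closure.isCompact.elim_finite_subcover _
    (fun A : 𝔞 => hNo.preimage (continuous_const.mul continuous_id)) hcover
  refine ⟨∑ A ∈ s, ‖A‖ + 1, fun A hA => ?_⟩
  obtain ⟨A₁, hA₁s, hA₁⟩ := Set.mem_iUnion₂.1 (hs (subset_closure ⟨A, hA, rfl⟩))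
  have hc := h.lieBr_eq_zero hA A₁.2
  have hsub := lieExp_sub_of_lieBr_eq_zero hc
  have hcm := commute_lieExp_of_lieBr_eq_zero hc
  have hmem : lieExp U ((A - A₁ : S.p) : E) ∈ N := by
    have h3 : lieExp U ((A - A₁ : S.p) : E) = (lieExp U ((A₁ : S.p) : E))⁻¹ * lieExp U (A : E) := by
      rw [Submodule.coe_sub, hsub, eq_inv_mul_iff_mul_eq, ← mul_assoc, ← hcm, mul_inv_cancel_right]
    rw [h3]
    exact interior_subset hA₁
  obtain ⟨A₂, hA₂, hn, he⟩ := hNA _ (𝔞.sub_mem hA A₁.2) hmem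
  refine ⟨A₂ + A₁, 𝔞.add_mem hA₂ A₁.2, ?_, ?_⟩
  · have h4 : ‖(A₁ : S.p)‖ ≤ ∑ A ∈ s, ‖A‖ :=
      Finset.single_le_sum (f := fun A : 𝔞 => ‖A‖) (fun _ _ => norm_nonneg _) hA₁s
    calc ‖A₂ + A₁‖ ≤ ‖A₂‖ + ‖(A₁ : S.p)‖ := norm_add_le _ _
      _ ≤ _ := by linarith
  · rw [Submodule.coe_add, lieExp_add_of_lieBr_eq_zero (h.lieBr_eq_zero hA₂ A₁.2), ← he,
      Submodule.coe_sub, hsub, inv_mul_cancel_right]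

/-- The Cartan decomposition `U = K exp(𝔞) K`, with bounded elements of `𝔞`. -/
theorem IsMaximalAbelian.exists_decomposition [ConnectedSpace U] (h : S.IsMaximalAbelian 𝔞)
    (hB : InvariantForm S B) :
    ∃ R : ℝ, ∀ u : U, ∃ k₁ ∈ S.K, ∃ H ∈ 𝔞, ‖H‖ ≤ R ∧ ∃ k₂ ∈ S.K,
      u = k₁ * lieExp U (H : E) * k₂ := by
  obtain ⟨R, hR⟩ := h.exists_norm_le
  refine ⟨R, ?_⟩
  have hcomp : IsCompact ((𝔞 : Set S.p) ∩ Metric.closedBall 0 R) :=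
    (isCompact_closedBall (0 : S.p) R).inter_left 𝔞.closed_of_finiteDimensional
  have himg : S.doubleCoset 𝔞 = (fun q : U × S.p × U => q.1 * lieExp U (q.2.1 : E) * q.2.2) ''
      ((S.K : Set U) ×ˢ ((𝔞 : Set S.p) ∩ Metric.closedBall 0 R) ×ˢ (S.K : Set U)) := by
    ext u
    constructor
    · rintro ⟨k₁, hk₁, H, hH, k₂, hk₂, rfl⟩
      obtain ⟨H', hH', hn, he⟩ := hR H hH
      exact ⟨(k₁, H', k₂), ⟨hk₁, ⟨hH', by simpa using hn⟩, hk₂⟩, by simp [he]⟩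
    · rintro ⟨⟨k₁, H, k₂⟩, ⟨hk₁, ⟨hH, -⟩, hk₂⟩, rfl⟩
      exact ⟨k₁, hk₁, H, hH, k₂, hk₂, rfl⟩
  have hclosed : IsClosed (S.doubleCoset 𝔞) := by
    rw [himg]
    refine ((isCompact_K.prod (hcomp.prod isCompact_K)).image ?_).isClosed
    exact (continuous_fst.mul (continuous_lieExp.comp
      (continuous_subtype_val.comp (continuous_fst.comp continuous_snd)))).mul
      (continuous_snd.comp continuous_snd)
  -- Open by the local argument, closed as a compact image, and containing 1: connectedness of U
  -- finishes.
  have huniv : S.doubleCoset 𝔞 = Set.univ :=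
    IsClopen.eq_univ ⟨hclosed, h.isOpen_doubleCoset hB⟩
      ⟨1, 1, S.K.one_mem, 0, 𝔞.zero_mem, 1, S.K.one_mem, by simp⟩
  intro u
  obtain ⟨⟨k₁, H, k₂⟩, ⟨hk₁, ⟨hH, hn⟩, hk₂⟩, rfl⟩ := himg ▸ huniv ▸ Set.mem_univ u
  exact ⟨k₁, hk₁, H, hH, by simpa using hn, k₂, hk₂, rfl⟩

end SymmetricPair

end Decomposition

end Wrapping

end

noncomputable section

namespace Wrapping

/-! ### The differential of Exp and its generic fibres. -/

section Jacobian

set_option linter.unusedSectionVars false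

variable {E : Type*} [NormedAddCommGroup E] [NormedSpace ℝ E] [FiniteDimensional ℝ E]
  {U : Type*} [TopologicalSpace U] [ChartedSpace E U] [Group U] [LieGroup 𝓘(ℝ, E) ∞ U]
  [IsTopologicalGroup U] [T2Space U] [CompactSpace U] [CompleteSpace E]
  {S : SymmetricPair E U} {𝔞 : Submodule ℝ S.p} {B : E →ₗ[ℝ] E →ₗ[ℝ] ℝ}

/-- The integrand Ad(exp(-tX))[T, X] is the derivative in t of Ad(exp(-tX))T. -/
theorem lieExpDeriv_lieBr (T X : E) :
    lieExpDeriv U X (lieBr U T X) = lieAd (lieExp U (-X)) T - T := by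
  have h : ∀ t : ℝ, HasDerivAt (fun t : ℝ => lieAd (lieExp U (-(t • X))) T)
      (lieAd (lieExp U (-(t • X))) (lieBr U T X)) t := fun t => by
    have := hasDerivAt_lieAd_lieExp (U := U) (-X) T t
    simp only [smul_neg] at this
    have e : lieBr U (-X) T = lieBr U T X := by
      rw [lieBr_swap, ← neg_one_smul ℝ X, lieBr_smul_right, neg_one_smul, neg_neg]
    rwa [e] at this
  rw [lieExpDeriv_apply, intervalIntegral.integral_eq_sub_of_hasDerivAt (fun t _ => h t)]
  · simp
  · refine Continuous.intervalIntegrable ?_ _ _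
    exact ((continuous_lieAd.comp (continuous_lieExp.comp (by fun_prop))).clm_apply
      continuous_const)

namespace SymmetricPair

theorem hasLeftDeriv_lieExp_coe (X : S.p) :
    HasLeftDeriv (fun Y : S.p => lieExp U (Y : E)) ((lieExpDeriv U (X : E)).comp S.p.subtypeL) X :=
  (hasLeftDeriv_lieExp (X : E)).comp_fderiv S.p.subtypeL.hasFDerivAt

theorem dexp_eq (X : S.p) : S.dexp X = (lieExpDeriv U (X : E)).comp S.p.subtypeL :=
  (hasLeftDeriv_iff_hasMFDerivAt.1 (hasLeftDeriv_lieExp_coe X)).mfderiv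

variable (S) in
/-- The differential of `Exp` at `X`, as an endomorphism of `𝔭`. -/
def dExp (X : S.p) : S.p →L[ℝ] S.p :=
  (LinearMap.toContinuousLinearMap S.projP).comp ((lieExpDeriv U (X : E)).comp S.p.subtypeL)

theorem dExp_apply (X Y : S.p) : S.dExp X Y = S.projP (lieExpDeriv U (X : E) (Y : E)) := rfl

theorem jacobian_eq (X : S.p) : S.jacobian X = (S.dExp X).det := by
  rw [jacobian, dexp_eq]; rfl

theorem continuous_dExp : Continuous S.dExp :=
  continuous_const.clm_comp ((continuous_lieExpDeriv.comp continuous_subtype_val).clm_comp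
    continuous_const)

theorem continuous_jacobian : Continuous S.jacobian := by
  simp_rw [funext jacobian_eq]
  exact ContinuousLinearMap.continuous_det.comp continuous_dExp

variable (S) in
theorem exists_norm_dExp_le : ∃ C : ℝ, ∀ X, ‖S.dExp X‖ ≤ C := by
  obtain ⟨M, -, hM⟩ := exists_norm_lieAd_le E U
  refine ⟨‖(LinearMap.toContinuousLinearMap S.projP : E →L[ℝ] S.p)‖ * (M * ‖S.p.subtypeL‖),
    fun X => ?_⟩
  refine (ContinuousLinearMap.opNorm_comp_le _ _).trans ?_
  refine mul_le_mul_of_nonneg_left ((ContinuousLinearMap.opNorm_comp_le _ _).trans ?_)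
    (norm_nonneg _)
  exact mul_le_mul_of_nonneg_right (norm_lieExpDeriv_le hM _) (norm_nonneg _)

variable (S) in
theorem exists_abs_jacobian_le : ∃ C : ℝ, ∀ X, |S.jacobian X| ≤ C := by
  obtain ⟨C, hC⟩ := exists_norm_dExp_le S
  have : FiniteDimensional ℝ (S.p →L[ℝ] S.p) := inferInstance
  have : ProperSpace (S.p →L[ℝ] S.p) := FiniteDimensional.proper ℝ (S.p →L[ℝ] S.p)
  have hcont : ContinuousOn (fun f : S.p →L[ℝ] S.p => f.det)
      (Metric.closedBall (0 : S.p →L[ℝ] S.p) C) :=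
    ContinuousLinearMap.continuous_det.continuousOn
  obtain ⟨R, hR⟩ := (isCompact_closedBall (0 : S.p →L[ℝ] S.p) C).exists_bound_of_continuousOn hcont
  exact ⟨R, fun X => by
    rw [jacobian_eq]
    exact hR _ (mem_closedBall_zero_iff (E := S.p →L[ℝ] S.p).2 (hC X))⟩

theorem jacobian_zero : S.jacobian 0 = 1 := by
  have : S.dExp 0 = ContinuousLinearMap.id ℝ S.p := by
    ext X
    simp [dExp_apply, lieExpDeriv_zero, projP_coe]
  rw [jacobian_eq, this]
  exact LinearMap.det_id

/-- Two points with the same image under `Exp` commute, if `Exp` is regular at one of them. -/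
theorem lieBr_eq_zero_of_Exp_eq (hB : InvariantForm S B) {X X' : S.p} (hJ : S.jacobian X ≠ 0)
    (h : S.Exp X = S.Exp X') : lieBr U (X : E) (X' : E) = 0 := by
  have h2 : lieExp U ((2 : ℝ) • (X' : E)) = lieExp U ((2 : ℝ) • (X : E)) := by
    have := lieExp_two_smul_eq X'.2 X.2 S.K.one_mem (Exp_eq_Exp_iff.1 h)
      (show lieExp U (X' : E) = 1 * lieExp U (X : E) *
        ((lieExp U (X : E))⁻¹ * lieExp U (X' : E)) by group)
    simpa using this
  have h3 : lieAd (lieExp U ((2 : ℝ) • (X : E))) (X' : E) = X' := by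
    rw [← h2, lieAd_lieExp_smul_self]
  -- T lies in 𝔨 and is fixed by Ad(exp 2X), hence Ad(exp(-X))T is again in 𝔨. So the differential
  -- of exp maps [T, X] into 𝔨, and the differential of Exp kills it.
  set T := lieBr U (X : E) (X' : E) with hT
  have hTk : T ∈ S.k := lieBr_mem_k X.2 X'.2
  have hfix : lieAd (lieExp U ((2 : ℝ) • (X : E))) T = T := by
    rw [hT, lieAd_lieBr, lieAd_lieExp_smul_self, h3]
  have hk : lieAd (lieExp U (-(X : E))) T ∈ S.k := (lieAd_lieExp_neg_mem_k_iff X.2 hTk).2 hfix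
  have h0 : S.dExp X ⟨lieBr U T X, lieBr_mem_p hTk X.2⟩ = 0 := by
    rw [dExp_apply, projP_eq_zero_iff, lieExpDeriv_lieBr]
    exact S.k.sub_mem hk hTk
  have hinj : Function.Injective (S.dExp X) := by
    rw [jacobian_eq] at hJ
    exact ((LinearMap.equivOfDetNeZero _ hJ).injective : _)
  have h4 := hinj (h0.trans (map_zero _).symm)
  have h5 : lieBr U T (X : E) = 0 := congrArg Subtype.val h4
  exact hB.lieBr_eq_zero_of_lieBr_lieBr (by rw [← hT, lieBr_swap, h5, neg_zero])

/-- Let A be regular and P a complement of 𝔞 in 𝔭. Then ad A is injective on P, with a left inverse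
L, and M(X) = L ∘ (ad X restricted to P) satisfies M(X + tA) = M(X) + t. So det M vanishes at
finitely many points of each line in the direction A, hence on a null set; elsewhere the centraliser
of X in 𝔭 meets P trivially. -/
theorem IsMaximalAbelian.exists_finrank_ker_le [MeasurableSpace E] [BorelSpace E]
    (vol : Measure S.p) [vol.IsAddHaarMeasure] (h : S.IsMaximalAbelian 𝔞)
    (hB : InvariantForm S B) :
    ∃ N : Set S.p, vol N = 0 ∧ ∀ X ∉ N, Module.finrank ℝ
      (LinearMap.ker ((adL E U (X : E) : E →ₗ[ℝ] E).domRestrict S.p)) ≤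
        Module.finrank ℝ 𝔞 := by
  obtain ⟨A, hA, hreg⟩ := h.exists_regular hB
  obtain ⟨P, hP⟩ := Submodule.exists_isCompl 𝔞
  let adP : E →L[ℝ] (P →L[ℝ] E) :=
    ((ContinuousLinearMap.compL ℝ P E E).flip (S.p.subtypeL.comp P.subtypeL)).comp (adL E U)
  have hadP : ∀ (X : E) (Y : P), adP X Y = lieBr U X ((Y : S.p) : E) := fun X Y => by
    rw [lieBr_eq_adL]; rfl
  obtain ⟨L, hL⟩ := LinearMap.exists_leftInverse_of_injective (adP (A : E) : P →ₗ[ℝ] E) (by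
    rw [LinearMap.ker_eq_bot']
    intro Y hY
    have h1 : (Y : S.p) ∈ 𝔞 := hreg _ ((hadP _ _).symm.trans hY)
    exact Subtype.ext (Submodule.disjoint_def.1 hP.disjoint _ h1 Y.2))
  let Lc : E →L[ℝ] P := LinearMap.toContinuousLinearMap L
  let M : S.p → P →L[ℝ] P := fun X => Lc.comp (adP (X : E))
  have hMc : Continuous M := continuous_const.clm_comp (adP.continuous.comp continuous_subtype_val)
  have hMA : ∀ (X : S.p) (t : ℝ),
      (M (X + t • A) : P →ₗ[ℝ] P) = (M X : P →ₗ[ℝ] P) + t • LinearMap.id := by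
    intro X t
    ext Y : 1
    have h2 : L (adP (A : E) Y) = Y := LinearMap.congr_fun hL Y
    change L (adP ((X + t • A : S.p) : E) Y) = L (adP (X : E) Y) + t • Y
    rw [Submodule.coe_add, Submodule.coe_smul, map_add, map_smul, _root_.add_apply,
      _root_.smul_apply, map_add, map_smul, h2]
  have hG : MeasurableSet {X | (M X).det ≠ 0} :=
    ((isClosed_singleton (x := (0 : ℝ))).isOpen_compl.preimage
      (ContinuousLinearMap.continuous_det.comp hMc)).measurableSet
  refine ⟨{X | (M X).det ≠ 0}ᶜ, ?_, ?_⟩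
  · rw [← mem_ae_iff]
    refine ae_mem_of_ae_add_linearMap_mem (LinearMap.toSpanSingleton ℝ S.p A)
      (volume : Measure ℝ) vol hG fun X => ?_
    have hfin : {t : ℝ | Module.End.HasEigenvalue (M X : P →ₗ[ℝ] P) t}.Finite :=
      Module.End.finite_hasEigenvalue _
    have hfin' := hfin.preimage (f := fun t : ℝ => -t) neg_injective.injOn
    filter_upwards [compl_mem_ae_iff.2 (hfin'.measure_zero volume)] with t ht hdet
    apply ht
    change (M (X + t • A)).det = 0 at hdet
    rw [ContinuousLinearMap.det, hMA] at hdet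
    change Module.End.HasEigenvalue (M X : P →ₗ[ℝ] P) (-t)
    obtain ⟨Y, hY, hY0⟩ := Submodule.exists_mem_ne_zero_of_ne_bot
      (LinearMap.bot_lt_ker_of_det_eq_zero hdet).ne'
    refine Module.End.hasEigenvalue_of_hasEigenvector (x := Y)
      (Module.End.hasEigenvector_iff.2 ⟨Module.End.mem_eigenspace_iff.2 ?_, hY0⟩)
    rw [neg_smul]
    exact eq_neg_of_add_eq_zero_left hY
  · intro X hX
    have hX' : (M X).det ≠ 0 := by simpa using hX
    have hinj : Function.Injective (M X) := (LinearMap.equivOfDetNeZero _ hX').injective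
    set Z := LinearMap.ker ((adL E U (X : E) : E →ₗ[ℝ] E).domRestrict S.p)
    have hdis : Disjoint Z P := by
      rw [Submodule.disjoint_def]
      intro Y hY hYP
      have h3 : M X ⟨Y, hYP⟩ = 0 := by
        have : adP (X : E) ⟨Y, hYP⟩ = 0 := hY
        change Lc (adP (X : E) ⟨Y, hYP⟩) = 0
        rw [this, map_zero]
      exact congrArg Subtype.val (hinj (h3.trans (map_zero _).symm))
    have h4 := Submodule.finrank_add_le_finrank_add_finrank Z P
    have h5 := Submodule.finrank_add_eq_of_isCompl hP
    have h6 := Submodule.finrank_sup_add_finrank_inf_eq Z P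
    rw [hdis.eq_bot, finrank_bot] at h6
    have h7 := Submodule.finrank_le (Z ⊔ P)
    omega

/-- The description of the fibre of `Exp` through a generic point. -/
theorem IsMaximalAbelian.exists_fiber [MeasurableSpace E] [BorelSpace E]
    (vol : Measure S.p) [vol.IsAddHaarMeasure] (h : S.IsMaximalAbelian 𝔞)
    (hB : InvariantForm S B) :
    ∃ N : Set S.p, vol N = 0 ∧ ∀ X ∉ N, S.jacobian X ≠ 0 →
      ∃ (u : S.K) (H : S.p), H ∈ 𝔞 ∧ X = S.AdK u H ∧
        ∀ X', S.Exp X' = S.Exp X ↔ ∃ γ ∈ S.lattice 𝔞, X' = S.AdK u (H + γ) := by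
  obtain ⟨N, hN, hdim⟩ := h.exists_finrank_ker_le vol hB
  refine ⟨N, hN, fun X hX hJ => ?_⟩
  obtain ⟨v, hv⟩ := h.exists_AdK_mem' hB X
  refine ⟨v⁻¹, S.AdK v X, hv, by simp, fun X' => ?_⟩
  have hExp : ∀ H' ∈ 𝔞, S.Exp (S.AdK v⁻¹ H') = S.Exp X ↔ H' - S.AdK v X ∈ S.lattice 𝔞 := by
    intro H' hH'
    have e1 : lieExp U ((S.AdK v⁻¹ H' : S.p) : E) = (v : U)⁻¹ * lieExp U (H' : E) * v := by
      rw [coe_AdK, ← conj_lieExp]; simp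
    have e2 : lieExp U (X : E) = (v : U)⁻¹ * lieExp U ((S.AdK v X : S.p) : E) * v := by
      rw [coe_AdK, ← conj_lieExp]; group
    have e3 : lieExp U ((H' - S.AdK v X : S.p) : E) =
        (lieExp U ((S.AdK v X : S.p) : E))⁻¹ * lieExp U (H' : E) := by
      rw [Submodule.coe_sub, lieExp_sub_of_lieBr_eq_zero (h.lieBr_eq_zero hH' hv),
        eq_inv_mul_iff_mul_eq, ← mul_assoc,
        ← commute_lieExp_of_lieBr_eq_zero (h.lieBr_eq_zero hH' hv), mul_inv_cancel_right]
    have e4 : (lieExp U (X : E))⁻¹ * ((v : U)⁻¹ * lieExp U (H' : E) * v) =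
        (v : U)⁻¹ * ((lieExp U ((S.AdK v X : S.p) : E))⁻¹ * lieExp U (H' : E)) * v := by
      rw [e2]; group
    rw [eq_comm, Exp_eq_Exp_iff, e1, e4, ← e3, S.K.mul_mem_cancel_right v.2,
      S.K.mul_mem_cancel_left (S.K.inv_mem v.2)]
    exact ⟨fun hm => ⟨𝔞.sub_mem hH' hv, hm⟩, fun hm => hm.2⟩
  constructor
  · intro he
    have hc := lieBr_eq_zero_of_Exp_eq hB hJ he.symm
    set Z := LinearMap.ker ((adL E U (X : E) : E →ₗ[ℝ] E).domRestrict S.p)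
    have hZ : ∀ Y : S.p, Y ∈ Z ↔ lieBr U (X : E) (Y : E) = 0 := fun Y => by
      rw [lieBr_eq_adL]; rfl
    have hle : 𝔞.map (S.AdK v⁻¹) ≤ Z := by
      rintro _ ⟨H', hH', rfl⟩
      rw [hZ]
      have h1 : (X : E) = lieAd ((v⁻¹ : S.K) : U) ((S.AdK v X : S.p) : E) := by
        rw [← coe_AdK, AdK_inv_AdK]
      rw [h1, coe_AdK v⁻¹ H', ← lieAd_lieBr, h.lieBr_eq_zero hv hH', map_zero]
    have hinj : Function.Injective (S.AdK v⁻¹) := fun a b hab => by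
      have := congrArg (S.AdK v) hab
      simpa using this
    -- The conjugate of 𝔞 through X centralises X, and the centraliser has dimension at most dim 𝔞.
    have heq : 𝔞.map (S.AdK v⁻¹) = Z := by
      refine Submodule.eq_of_le_of_finrank_le hle ?_
      rw [← (Submodule.equivMapOfInjective _ hinj 𝔞).finrank_eq]
      exact hdim X hX
    obtain ⟨H', hH', rfl⟩ : X' ∈ 𝔞.map (S.AdK v⁻¹) := heq ▸ (hZ X').2 hc
    exact ⟨H' - S.AdK v X, (hExp H' hH').1 he, by rw [add_sub_cancel]⟩
  · rintro ⟨γ, hγ, rfl⟩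
    rw [hExp _ (𝔞.add_mem hv hγ.1), add_sub_cancel_left]
    exact hγ

end SymmetricPair

end Jacobian

end Wrapping

end

noncomputable section

namespace Wrapping

/-! ### Reduction of Exp near a point to Exp near the origin. -/

section NormalForm

set_option linter.unusedSectionVars false

variable {E : Type*} [NormedAddCommGroup E] [NormedSpace ℝ E] [FiniteDimensional ℝ E]
  {U : Type*} [TopologicalSpace U] [ChartedSpace E U] [Group U] [LieGroup 𝓘(ℝ, E) ∞ U]
  [IsTopologicalGroup U] [T2Space U] [CompactSpace U] [CompleteSpace E]
  {S : SymmetricPair E U}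

namespace SymmetricPair

theorem projP_lieAd (u : S.K) (Z : E) : S.projP (lieAd (u : U) Z) = S.AdK u (S.projP Z) := by
  have h1 : Z = (S.projP Z : E) + (Z - S.projP Z) := by abel
  have h2 : S.projP (lieAd (u : U) (Z - S.projP Z)) = 0 :=
    projP_eq_zero_iff.2 (lieAd_mem_k u.2 (sub_projP_mem_k Z))
  have h3 : S.projP (lieAd (u : U) (S.projP Z : E)) = S.AdK u (S.projP Z) := by
    rw [← coe_AdK, projP_coe]
  have h4 : lieAd (u : U) Z =
      lieAd (u : U) (S.projP Z : E) + lieAd (u : U) (Z - S.projP Z) := by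
    rw [← map_add, ← h1]
  rw [h4, map_add, h2, h3, add_zero]

theorem lieExpDeriv_mem_k {T Z : E} (hT : T ∈ S.k) (hZ : Z ∈ S.k) : lieExpDeriv U T Z ∈ S.k := by
  rw [lieExpDeriv_apply, mem_k, ← ContinuousLinearMap.intervalIntegral_comp_comm]
  · refine intervalIntegral.integral_congr fun t _ => ?_
    exact mem_k.1 (lieAd_mem_k (lieExp_mem_K (S.k.neg_mem (S.k.smul_mem t hT))) hZ)
  · refine Continuous.intervalIntegrable ?_ _ _
    exact ((continuous_lieAd.comp (continuous_lieExp.comp (by fun_prop))).clm_apply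
      continuous_const)

/-- The determinants of all powers of u are bounded, since Ad is bounded on the compact group. -/
theorem abs_det_AdK_le_one (u : S.K) : |LinearMap.det (S.AdK u)| ≤ 1 := by
  obtain ⟨M, hM1, hM⟩ := exists_norm_lieAd_le E U
  have : FiniteDimensional ℝ (S.p →L[ℝ] S.p) := inferInstance
  have : ProperSpace (S.p →L[ℝ] S.p) := FiniteDimensional.proper ℝ (S.p →L[ℝ] S.p)
  have hcont : ContinuousOn (fun f : S.p →L[ℝ] S.p => f.det)
      (Metric.closedBall (0 : S.p →L[ℝ] S.p) M) :=
    ContinuousLinearMap.continuous_det.continuousOn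
  obtain ⟨R, hR⟩ := (isCompact_closedBall (0 : S.p →L[ℝ] S.p) M).exists_bound_of_continuousOn hcont
  have hbound : ∀ v : S.K, |LinearMap.det (S.AdK v)| ≤ R := fun v => by
    refine hR (LinearMap.toContinuousLinearMap (S.AdK v))
      (mem_closedBall_zero_iff (E := S.p →L[ℝ] S.p).2 ?_)
    refine ContinuousLinearMap.opNorm_le_bound _ (by linarith) fun Y => ?_
    exact ((lieAd (v : U) : E →L[ℝ] E).le_opNorm (Y : E)).trans
      (mul_le_mul_of_nonneg_right (hM _) (norm_nonneg _))
  have hpow : ∀ n : ℕ, LinearMap.det (S.AdK (u ^ n)) = LinearMap.det (S.AdK u) ^ n := by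
    intro n
    induction n with
    | zero =>
      have : S.AdK (1 : S.K) = LinearMap.id := LinearMap.ext fun Y => Subtype.ext (by
        simp [lieAd_one])
      rw [pow_zero, pow_zero, this, LinearMap.det_id]
    | succ n ih =>
      have : S.AdK (u ^ n * u) = S.AdK (u ^ n) ∘ₗ S.AdK u := LinearMap.ext fun Y =>
        AdK_mul _ _ _
      rw [pow_succ, this, LinearMap.det_comp, ih, pow_succ]
  by_contra! h
  obtain ⟨n, hn⟩ := pow_unbounded_of_one_lt R h
  have := hbound (u ^ n)
  rw [hpow, abs_pow] at this
  linarith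

theorem abs_det_AdK (u : S.K) : |LinearMap.det (S.AdK u)| = 1 := by
  refine le_antisymm (abs_det_AdK_le_one u) ?_
  have h1 : LinearMap.det (S.AdK u) * LinearMap.det (S.AdK u⁻¹) = 1 := by
    rw [← LinearMap.det_comp]
    have : S.AdK u ∘ₗ S.AdK u⁻¹ = LinearMap.id := LinearMap.ext fun Y => AdK_AdK_inv u Y
    rw [this, LinearMap.det_id]
  have h2 : |LinearMap.det (S.AdK u)| * |LinearMap.det (S.AdK u⁻¹)| = 1 := by
    rw [← abs_mul, h1, abs_one]
  have h3 := mul_le_mul_of_nonneg_left (abs_det_AdK_le_one u⁻¹) (abs_nonneg (LinearMap.det (S.AdK u)))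
  linarith

variable (S) in
/-- The decomposition of `T₁U` into the eigenspaces of `dσ`. -/
def sumEquiv : (S.p × S.k) ≃L[ℝ] E :=
  (LinearEquiv.ofBijective (S.p.subtype.coprod S.k.subtype) (by
    constructor
    · rw [← LinearMap.ker_eq_bot, LinearMap.ker_eq_bot']
      rintro ⟨Y, T⟩ h
      have h1 : (Y : E) + (T : E) = 0 := h
      have h2 : (Y : E) = 0 := by
        refine eq_zero_of_mem_k_of_mem_p (S := S) ?_ Y.2
        rw [eq_neg_of_add_eq_zero_left h1]
        exact S.k.neg_mem T.2
      rw [h2, zero_add] at h1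
      exact Prod.ext (Subtype.ext h2) (Subtype.ext h1)
    · intro X
      exact ⟨(S.projP X, ⟨_, sub_projP_mem_k X⟩), by simp⟩)).toContinuousLinearEquiv

/-- The inverse function theorem for (Y, T) ↦ exp Y exp T on 𝔭 × 𝔨, whose differential at 0 is the
sum isomorphism onto the Lie algebra. -/
theorem exists_local_factorization {V : Set S.p} (hV : V ∈ 𝓝 0) (X₀ : S.p) :
    ∃ (O : Set S.p) (q : S.p → S.p × S.k), IsOpen O ∧ X₀ ∈ O ∧ ∀ X ∈ O,
      (lieExp U (X₀ : E))⁻¹ * lieExp U (X : E) =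
        lieExp U ((q X).1 : E) * lieExp U ((q X).2 : E) ∧
      ContDiffAt ℝ 1 q X ∧ (q X).1 ∈ V := by
  have : LieGroup 𝓘(ℝ, E) 1 U := LieGroup.of_le (n := ∞) (by exact_mod_cast le_top)
  let L₁ : (S.p × S.k) →L[ℝ] E := S.p.subtypeL.comp (ContinuousLinearMap.fst ℝ S.p S.k)
  let L₂ : (S.p × S.k) →L[ℝ] E := S.k.subtypeL.comp (ContinuousLinearMap.snd ℝ S.p S.k)
  let g : S.p × S.k → U := fun q => lieExp U (L₁ q) * lieExp U (L₂ q)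
  have hgc : ContMDiff 𝓘(ℝ, S.p × S.k) 𝓘(ℝ, E) 1 g :=
    (contMDiff_lieExp.comp (contMDiff_iff_contDiff.2 L₁.contDiff)).mul
      (contMDiff_lieExp.comp (contMDiff_iff_contDiff.2 L₂.contDiff))
  have hg0 : g 0 = 1 := by simp [g]
  have hd : ∀ L : (S.p × S.k) →L[ℝ] E, HasLeftDeriv (fun y => lieExp U (L y)) L 0 := fun L => by
    have h : HasLeftDeriv (lieExp U) (ContinuousLinearMap.id ℝ E) (L 0) := by
      simpa using hasLeftDeriv_lieExp_zero (E := E) (U := U)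
    simpa using h.comp_fderiv L.hasFDerivAt
  have hgd : HasLeftDeriv g (S.sumEquiv : (S.p × S.k) →L[ℝ] E) 0 :=
    ((hd L₁).mul_of_eq_one (hd L₂) (by simp) (by simp)).congr_deriv
      (ContinuousLinearMap.ext fun _ => rfl)
  have hG := contDiffAt_chartOne_comp (n := 1) (by exact_mod_cast le_top) (hgc 0) (by simp [hg0])
  have hG' : HasFDerivAt (fun q => chartOne E U (g q)) (S.sumEquiv : (S.p × S.k) →L[ℝ] E) 0 :=
    (hasStrictFDerivAt_chartOne_comp hg0 (hgc 0) hgd).hasFDerivAt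
  have hG0 : chartOne E U (g 0) = 0 := by simp [hg0]
  set Gi := hG.localInverse hG' one_ne_zero with hGi
  have hGic : ContDiffAt ℝ 1 Gi 0 := by
    have := hG.to_localInverse hG' one_ne_zero
    rwa [hG0] at this
  have hGi0 : Gi 0 = 0 := by
    have := hG.localInverse_apply_image hG' one_ne_zero
    rwa [hG0] at this
  have hGright : ∀ᶠ z in 𝓝 (0 : E), chartOne E U (g (Gi z)) = z := by
    have := (hG.hasStrictFDerivAt' hG' one_ne_zero).eventually_right_inverse
    rwa [hG0] at this
  let c : S.p → U := fun X => (lieExp U (X₀ : E))⁻¹ * lieExp U (X : E)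
  have hc0 : c X₀ = 1 := inv_mul_cancel _
  have hmem : (lieExp U (X₀ : E))⁻¹ * lieExp U (X₀ : E) ∈ (chartOne E U).source := by simp
  have hcd' : ContDiffAt ℝ 1 (fun Y : E => chartOne E U ((lieExp U (X₀ : E))⁻¹ * lieExp U Y))
      (S.p.subtypeL X₀) := contDiffAt_chartOne_lieExp _ hmem
  have hcd : ContDiffAt ℝ 1 (fun X => chartOne E U (c X)) X₀ :=
    hcd'.comp X₀ S.p.subtypeL.contDiff.contDiffAt
  have hcc : ContinuousAt c X₀ :=
    (continuous_const.mul (continuous_lieExp.comp continuous_subtype_val)).continuousAt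
  have hχ0 : chartOne E U (c X₀) = 0 := by simp [hc0]
  let q : S.p → S.p × S.k := fun X => Gi (chartOne E U (c X))
  have hq : ContDiffAt ℝ 1 q X₀ := ContDiffAt.comp X₀ (by rwa [hχ0]) hcd
  have hq0 : q X₀ = 0 := by simp [q, hχ0, hGi0]
  have hψ : ContDiffAt ℝ 1 (fun X => (q X).1) X₀ := hq.fst
  have hev : ∀ᶠ X in 𝓝 X₀, c X = g (q X) ∧ ContDiffAt ℝ 1 q X ∧ (q X).1 ∈ V := by
    have e1 : ∀ᶠ X in 𝓝 X₀, c X ∈ (chartOne E U).source := hcc.eventually (by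
      rw [hc0]; exact chartOne_source_mem_nhds)
    have e2 : ∀ᶠ X in 𝓝 X₀, g (q X) ∈ (chartOne E U).source :=
      (hgc.continuous.continuousAt.comp hq.continuousAt).eventually (by
        simp only [Function.comp_apply, hq0, hg0]; exact chartOne_source_mem_nhds)
    have e3 : ∀ᶠ X in 𝓝 X₀, chartOne E U (g (q X)) = chartOne E U (c X) :=
      hcd.continuousAt.eventually (p := fun z => chartOne E U (g (Gi z)) = z)
        (by simpa only [hχ0] using hGright)
    have e4 : ∀ᶠ X in 𝓝 X₀, (q X).1 ∈ V := hψ.continuousAt.preimage_mem_nhds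
      (by rw [hq0]; exact hV)
    filter_upwards [e1, e2, e3, e4, hq.eventually (by simp)] with X h1 h2 h3 h4 h5
    exact ⟨(chartOne E U).injOn h1 h2 h3.symm, h5, h4⟩
  obtain ⟨O, hO, hOo, hX₀⟩ := eventually_nhds_iff.1 hev
  exact ⟨O, q, hOo, hX₀, hO⟩

/-- Near every point, `Exp` is the translate of `Exp` near `0` composed with a map of `𝔭` whose
differential accounts for the Jacobian determinant. -/
theorem exists_normal_form {V : Set S.p} (hV : V ∈ 𝓝 0) (X₀ : S.p) :
    ∃ (O : Set S.p) (ψ : S.p → S.p) (ψ' : S.p → S.p →L[ℝ] S.p), IsOpen O ∧ X₀ ∈ O ∧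
      HasStrictFDerivAt ψ (ψ' X₀) X₀ ∧ ∀ X ∈ O, HasFDerivAt ψ (ψ' X) X ∧ ψ X ∈ V ∧
        S.Exp X = lieExp U (X₀ : E) • S.Exp (ψ X) ∧
        |S.jacobian X| = |S.jacobian (ψ X)| * |(ψ' X).det| := by
  obtain ⟨O, q, hOo, hX₀, hO⟩ := exists_local_factorization hV X₀
  let c : S.p → U := fun X => (lieExp U (X₀ : E))⁻¹ * lieExp U (X : E)
  have hψ : ContDiffAt ℝ 1 (fun X => (q X).1) X₀ := (hO X₀ hX₀).2.1.fst
  refine ⟨O, fun X => (q X).1, fun X => fderiv ℝ (fun X => (q X).1) X, hOo, hX₀,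
    hψ.hasStrictFDerivAt one_ne_zero, fun X hX => ?_⟩
  obtain ⟨hcX, hqX, hVX⟩ := hO X hX
  have hqd := (hqX.differentiableAt one_ne_zero).hasFDerivAt
  have hψd : HasFDerivAt (fun X => (q X).1) (fderiv ℝ (fun X => (q X).1) X) X :=
    (hqX.fst.differentiableAt one_ne_zero).hasFDerivAt
  have hτd : HasFDerivAt (fun X => (q X).2) (fderiv ℝ (fun X => (q X).2) X) X :=
    (hqX.snd.differentiableAt one_ne_zero).hasFDerivAt
  set ψ' := fderiv ℝ (fun X => (q X).1) X
  set τ' := fderiv ℝ (fun X => (q X).2) X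
  have hcL : HasLeftDeriv c ((lieExpDeriv U (X : E)).comp S.p.subtypeL) X :=
    (hasLeftDeriv_lieExp_coe X).const_mul _
  have hgL : HasLeftDeriv (fun X => lieExp U ((q X).1 : E) * lieExp U ((q X).2 : E))
      ((lieAd (lieExp U ((q X).2 : E))⁻¹).comp
        ((lieExpDeriv U ((q X).1 : E)).comp (S.p.subtypeL.comp ψ')) +
        (lieExpDeriv U ((q X).2 : E)).comp (S.k.subtypeL.comp τ')) X :=
    (HasLeftDeriv.comp_fderiv (f := fun X => ((q X).1 : E)) (hasLeftDeriv_lieExp _)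
      (S.p.subtypeL.hasFDerivAt.comp X hψd)).mul
      (HasLeftDeriv.comp_fderiv (f := fun X => ((q X).2 : E)) (hasLeftDeriv_lieExp _)
        (S.k.subtypeL.hasFDerivAt.comp X hτd))
  have heq := hcL.unique (hgL.congr_of_eventuallyEq
    (Filter.mem_of_superset (hOo.mem_nhds hX) fun Y hY => (hO Y hY).1))
  have hτK : lieExp U ((q X).2 : E) ∈ S.K := lieExp_mem_K (q X).2.2
  -- Projecting the differentiated factorization to 𝔭 removes the 𝔨-factor, except for its adjoint
  -- action, which has determinant ±1.
  have hfac : S.dExp X = (LinearMap.toContinuousLinearMap (S.AdK ⟨_, S.K.inv_mem hτK⟩)).comp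
      ((S.dExp (q X).1).comp ψ') := by
    ext Y : 1
    have h1 := DFunLike.congr_fun heq Y
    change lieExpDeriv U (X : E) (Y : E) = lieAd (lieExp U ((q X).2 : E))⁻¹
      (lieExpDeriv U ((q X).1 : E) (ψ' Y : E)) + lieExpDeriv U ((q X).2 : E) (τ' Y : E) at h1
    rw [dExp_apply, h1, map_add, projP_eq_zero_iff.2 (lieExpDeriv_mem_k (q X).2.2 (τ' Y).2),
      add_zero]
    exact projP_lieAd ⟨_, S.K.inv_mem hτK⟩ _
  refine ⟨hψd, hVX, ?_, ?_⟩
  · have h1 : lieExp U (X : E) = lieExp U (X₀ : E) * (lieExp U ((q X).1 : E) *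
        lieExp U ((q X).2 : E)) := by
      have : (lieExp U (X₀ : E))⁻¹ * lieExp U (X : E) = _ := hcX
      rw [← inv_mul_eq_iff_eq_mul, this]
    change ((lieExp U (X : E) : U) : U ⧸ S.K) = ((lieExp U (X₀ : E) * lieExp U ((q X).1 : E) : U) :
      U ⧸ S.K)
    rw [eq_comm, QuotientGroup.eq, h1]
    convert hτK using 1
    group
  · rw [jacobian_eq, jacobian_eq, hfac]
    have h2 : ((LinearMap.toContinuousLinearMap (S.AdK ⟨_, S.K.inv_mem hτK⟩)).comp
      ((S.dExp (q X).1).comp ψ')).det = LinearMap.det (S.AdK ⟨_, S.K.inv_mem hτK⟩) *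
        ((S.dExp (q X).1).det * ψ'.det) := by
      change LinearMap.det (S.AdK ⟨_, S.K.inv_mem hτK⟩ ∘ₗ ((S.dExp (q X).1 : S.p →ₗ[ℝ] S.p) ∘ₗ
        (ψ' : S.p →ₗ[ℝ] S.p))) = _
      rw [LinearMap.det_comp, LinearMap.det_comp]
    rw [h2, abs_mul, abs_mul, abs_det_AdK, one_mul]

end SymmetricPair

end NormalForm

end Wrapping

end

noncomputable section

namespace Wrapping

/-! ### Null sets and integration over the fibres of Exp. -/

section AreaFormula

open scoped Pointwise

set_option linter.unusedSectionVars false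

variable {E : Type*} [NormedAddCommGroup E] [NormedSpace ℝ E] [FiniteDimensional ℝ E]
  {U : Type*} [TopologicalSpace U] [ChartedSpace E U] [Group U] [LieGroup 𝓘(ℝ, E) ∞ U]
  [IsTopologicalGroup U] [T2Space U] [CompactSpace U] [CompleteSpace E]
  {S : SymmetricPair E U}

namespace SymmetricPair

theorem continuous_Exp : Continuous S.Exp :=
  QuotientGroup.continuous_mk.comp (continuous_lieExp.comp continuous_subtype_val)

theorem t2Space_quotient : T2Space (U ⧸ S.K) := by
  rw [t2Space_iff_of_isOpenQuotientMap QuotientGroup.isOpenQuotientMap_mk]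
  simp_rw [QuotientGroup.eq]
  exact S.isClosed_K.preimage ((continuous_inv.comp continuous_fst).mul continuous_snd)

variable [MeasurableSpace E] [BorelSpace E] [MeasurableSpace U] [BorelSpace U]

variable (S) in
-- U is compact and metrisable, hence Polish; the quotient σ-algebra on its Hausdorff quotient is
-- then the Borel one.
theorem borelSpace_quotient : BorelSpace (U ⧸ S.K) := by
  have : SecondCountableTopology U := ChartedSpace.secondCountable_of_sigmaCompact E U
  let _ : MetricSpace U := TopologicalSpace.metrizableSpaceMetric U
  have : T2Space (U ⧸ S.K) := t2Space_quotient
  infer_instance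

variable {vol : Measure S.p} [vol.IsAddHaarMeasure] {ν : Measure (U ⧸ S.K)}

namespace IsInvariantVolume

theorem measure_image_translate (hν : S.IsInvariantVolume vol ν) {s : Set S.p} {ψ : S.p → S.p}
    {u : U} (h : ∀ X ∈ s, S.Exp X = u • S.Exp (ψ X)) :
    ν (S.Exp '' s) = ν (S.Exp '' (ψ '' s)) := by
  have := hν.invariant
  have := borelSpace_quotient S
  have e : S.Exp '' s = u • (S.Exp '' (ψ '' s)) := by
    rw [← Set.image_smul, Set.image_image, Set.image_image]
    exact Set.image_congr h
  rw [e, measure_smul]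

/-- By invariance of ν, images under Exp may be replaced by images under Exp ∘ ψ, with ψ taking
values where the normalisation of ν applies. Each property then follows from the corresponding one
of the map ψ between open sets of 𝔭; the second is Sard's lemma in equal dimensions. -/
theorem exists_nhds (hν : S.IsInvariantVolume vol ν) (X₀ : S.p) :
    ∃ O : Set S.p, IsOpen O ∧ X₀ ∈ O ∧ (∀ s ⊆ O, vol s = 0 → ν (S.Exp '' s) = 0) ∧
      ν (S.Exp '' (O ∩ {X | S.jacobian X = 0})) = 0 ∧
      (∀ s ⊆ O, MeasurableSet s → Set.InjOn S.Exp s →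
        ν (S.Exp '' s) = ∫⁻ X in s, ENNReal.ofReal |S.jacobian X| ∂vol) ∧
      (S.jacobian X₀ ≠ 0 → ∃ O₂ ⊆ O, IsOpen O₂ ∧ X₀ ∈ O₂ ∧ Set.InjOn S.Exp O₂) := by
  obtain ⟨V, hV, hVinj, hVν⟩ := hν.normalized
  -- J has no zeros on V', so J(X) = 0 exactly when the differential of ψ at X is singular.
  set V' : Set S.p := interior V ∩ {X | S.jacobian X ≠ 0} with hV'
  have hV'o : IsOpen V' := isOpen_interior.inter
    (isOpen_compl_singleton.preimage continuous_jacobian)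
  have h0V' : (0 : S.p) ∈ V' := ⟨mem_interior_iff_mem_nhds.2 hV, by simp [jacobian_zero]⟩
  have hV'V : V' ⊆ V := Set.inter_subset_left.trans interior_subset
  obtain ⟨O, ψ, ψ', hO, hX₀, hstrict, hψ⟩ := exists_normal_form (hV'o.mem_nhds h0V') X₀
  have hExp : ∀ s ⊆ O, ν (S.Exp '' s) = ν (S.Exp '' (ψ '' s)) := fun s hs =>
    hν.measure_image_translate fun X hX => (hψ X (hs hX)).2.2.1
  have hmaps : ∀ s ⊆ O, ψ '' s ⊆ V' := by
    rintro s hs _ ⟨X, hX, rfl⟩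
    exact (hψ X (hs hX)).2.1
  have hnull : ∀ s ⊆ O, vol (ψ '' s) = 0 → ν (S.Exp '' s) = 0 := by
    intro s hs h
    set t := toMeasurable vol (ψ '' s) ∩ V'
    have ht : MeasurableSet t := (measurableSet_toMeasurable _ _).inter hV'o.measurableSet
    have ht0 : vol t = 0 := measure_mono_null Set.inter_subset_left
      (by rw [measure_toMeasurable, h])
    have h1 := hVν t (Set.inter_subset_right.trans hV'V) ht
    rw [Measure.restrict_eq_zero.2 ht0, lintegral_zero_measure] at h1
    rw [hExp s hs]
    exact measure_mono_null (Set.image_mono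
      (Set.subset_inter (subset_toMeasurable _ _) (hmaps s hs))) h1
  refine ⟨O, hO, hX₀, fun s hs h => hnull s hs ?_, hnull _ Set.inter_subset_left ?_, ?_, ?_⟩
  · exact addHaar_image_eq_zero_of_differentiableOn_of_addHaar_eq_zero vol
      (fun X hX => (hψ X (hs hX)).1.differentiableAt.differentiableWithinAt) h
  · refine addHaar_image_eq_zero_of_det_fderivWithin_eq_zero vol
      (f' := ψ') (fun X hX => (hψ X hX.1).1.hasFDerivWithinAt) fun X hX => ?_
    obtain ⟨-, hXV, -, hdet⟩ := hψ X hX.1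
    rw [show S.jacobian X = 0 from hX.2, abs_zero, eq_comm, mul_eq_zero] at hdet
    exact abs_eq_zero.1 (hdet.resolve_left (abs_ne_zero.2 hXV.2))
  · intro s hs hsm hinj
    have hψinj : Set.InjOn ψ s := fun X hX Y hY h => hinj hX hY (by
      rw [(hψ X (hs hX)).2.2.1, (hψ Y (hs hY)).2.2.1, h])
    have hd : ∀ X ∈ s, HasFDerivWithinAt ψ (ψ' X) s X := fun X hX =>
      (hψ X (hs hX)).1.hasFDerivWithinAt
    rw [hExp s hs, hVν _ ((hmaps s hs).trans hV'V) (measurable_image_of_fderivWithin hsm hd hψinj),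
      lintegral_image_eq_lintegral_abs_det_fderiv_mul vol hsm hd hψinj]
    refine setLIntegral_congr_fun hsm fun X hX => ?_
    rw [(hψ X (hs hX)).2.2.2, mul_comm, ENNReal.ofReal_mul (abs_nonneg _)]
  · intro hJ
    have hdet : (ψ' X₀).det ≠ 0 := by
      have := (hψ X₀ hX₀).2.2.2
      intro h
      rw [h, abs_zero, mul_zero, abs_eq_zero] at this
      exact hJ this
    let e : S.p ≃L[ℝ] S.p := (ψ' X₀).toContinuousLinearEquivOfDetNeZero hdet
    have hs : HasStrictFDerivAt ψ (e : S.p →L[ℝ] S.p) X₀ := hstrict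
    refine ⟨O ∩ (hs.toOpenPartialHomeomorph ψ).source, Set.inter_subset_left,
      hO.inter (hs.toOpenPartialHomeomorph ψ).open_source,
      ⟨hX₀, hs.mem_toOpenPartialHomeomorph_source⟩, fun X hX Y hY h => ?_⟩
    obtain ⟨-, hXV, hXE, -⟩ := hψ X hX.1
    obtain ⟨-, hYV, hYE, -⟩ := hψ Y hY.1
    refine (hs.toOpenPartialHomeomorph ψ).injOn hX.2 hY.2 ?_
    rw [hXE, hYE, smul_left_cancel_iff] at h
    exact hVinj (hV'V hXV) (hV'V hYV) h

theorem measure_image_eq_zero (hν : S.IsInvariantVolume vol ν) {s : Set S.p} (hs : vol s = 0) :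
    ν (S.Exp '' s) = 0 := by
  choose O hO hX hnull _ using hν.exists_nhds
  obtain ⟨t, htc, ht⟩ := TopologicalSpace.countable_cover_nhds fun X => (hO X).mem_nhds (hX X)
  refine measure_mono_null (t := ⋃ X ∈ t, S.Exp '' (s ∩ O X)) ?_
    ((measure_biUnion_null_iff htc).2 fun X _ => hnull X _ Set.inter_subset_right
      (measure_mono_null Set.inter_subset_left hs))
  rintro _ ⟨Y, hY, rfl⟩
  obtain ⟨X, hXt, hYX⟩ := Set.mem_iUnion₂.1 (ht.symm ▸ Set.mem_univ Y : Y ∈ ⋃ X ∈ t, O X)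
  exact Set.mem_iUnion₂.2 ⟨X, hXt, Y, ⟨hY, hYX⟩, rfl⟩

/-- The critical values of `Exp` form a null set. -/
theorem measure_image_jacobian_eq_zero (hν : S.IsInvariantVolume vol ν) :
    ν (S.Exp '' {X | S.jacobian X = 0}) = 0 := by
  choose O hO hX _ hnull _ using hν.exists_nhds
  obtain ⟨t, htc, ht⟩ := TopologicalSpace.countable_cover_nhds fun X => (hO X).mem_nhds (hX X)
  refine measure_mono_null (t := ⋃ X ∈ t, S.Exp '' (O X ∩ {X | S.jacobian X = 0})) ?_
    ((measure_biUnion_null_iff htc).2 fun X _ => hnull X)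
  rintro _ ⟨Y, hY, rfl⟩
  obtain ⟨X, hXt, hYX⟩ := Set.mem_iUnion₂.1 (ht.symm ▸ Set.mem_univ Y : Y ∈ ⋃ X ∈ t, O X)
  exact Set.mem_iUnion₂.2 ⟨X, hXt, Y, ⟨hYX, hY⟩, rfl⟩

/-- The regular points of `Exp` are partitioned into countably many pieces on which `Exp` is
injective and transforms the measure by the Jacobian determinant. -/
theorem exists_partition (hν : S.IsInvariantVolume vol ν) :
    ∃ D : ℕ → Set S.p, (∀ n, MeasurableSet (D n)) ∧ Pairwise (Function.onFun Disjoint D) ∧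
      ⋃ n, D n = {X | S.jacobian X ≠ 0} ∧ (∀ n, Set.InjOn S.Exp (D n)) ∧
      ∀ n, ∀ s ⊆ D n, MeasurableSet s →
        ν (S.Exp '' s) = ∫⁻ X in s, ENNReal.ofReal |S.jacobian X| ∂vol := by
  have hRo : IsOpen {X | S.jacobian X ≠ 0} := isOpen_compl_singleton.preimage continuous_jacobian
  have h1 : ∀ X ∈ {X | S.jacobian X ≠ 0}, ∃ O : Set S.p, IsOpen O ∧ X ∈ O ∧ Set.InjOn S.Exp O ∧
      ∀ s ⊆ O, MeasurableSet s →
        ν (S.Exp '' s) = ∫⁻ X in s, ENNReal.ofReal |S.jacobian X| ∂vol := by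
    intro X hX
    obtain ⟨O, -, -, -, -, h2, h3⟩ := hν.exists_nhds X
    obtain ⟨O₂, hsub, ho, hm, hinj⟩ := h3 hX
    exact ⟨O₂, ho, hm, hinj, fun s hs hsm => h2 s (hs.trans hsub) hsm (hinj.mono hs)⟩
  choose! O hO hXO hinj hform using h1
  obtain ⟨t, htR, htc, ht⟩ := TopologicalSpace.countable_cover_nhdsWithin
    fun X hX => mem_nhdsWithin_of_mem_nhds ((hO X hX).mem_nhds (hXO X hX))
  have htne : t.Nonempty := by
    obtain ⟨X, hX, -⟩ := Set.mem_iUnion₂.1 (ht (show S.jacobian 0 ≠ 0 by simp [jacobian_zero]))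
    exact ⟨X, hX⟩
  obtain ⟨f, rfl⟩ := htc.exists_eq_range htne
  have hfR : ∀ n, S.jacobian (f n) ≠ 0 := fun n => htR ⟨n, rfl⟩
  set A : ℕ → Set S.p := fun n => O (f n) ∩ {X | S.jacobian X ≠ 0}
  have hsub : ∀ n, disjointed A n ⊆ O (f n) := fun n =>
    (disjointed_subset A n).trans Set.inter_subset_left
  refine ⟨disjointed A, fun n => MeasurableSet.disjointed
    (fun n => ((hO _ (hfR n)).inter hRo).measurableSet) n, disjoint_disjointed A, ?_,
    fun n => (hinj _ (hfR n)).mono (hsub n), fun n s hs hsm =>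
      hform _ (hfR n) s (hs.trans (hsub n)) hsm⟩
  rw [iUnion_disjointed]
  refine Set.Subset.antisymm (Set.iUnion_subset fun n => Set.inter_subset_right) fun X hX => ?_
  obtain ⟨_, ⟨n, rfl⟩, hn⟩ := Set.mem_iUnion₂.1 (ht hX)
  exact Set.mem_iUnion.2 ⟨n, hn, hX⟩

theorem _root_.Wrapping.SymmetricPair.map_restrict_withDensity {D : Set S.p}
    (hD : MeasurableSet D)
    (h : ∀ s ⊆ D, MeasurableSet s →
        ν (S.Exp '' s) = ∫⁻ X in s, ENNReal.ofReal |S.jacobian X| ∂vol) :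
    (((vol.withDensity fun X => ENNReal.ofReal |S.jacobian X|).restrict D).map S.Exp) =
      ν.restrict (S.Exp '' D) := by
  have := borelSpace_quotient S
  ext t ht
  have hm := continuous_Exp (S := S) |>.measurable ht
  rw [Measure.map_apply continuous_Exp.measurable ht, Measure.restrict_apply hm,
    Measure.restrict_apply ht, withDensity_apply _ (hm.inter hD),
    ← h _ Set.inter_subset_right (hm.inter hD), Set.inter_comm _ D, Set.image_inter_preimage,
    Set.inter_comm]

/-- Integration over the fibres of `Exp`. -/
theorem integral_abs_jacobian_mul (hν : S.IsInvariantVolume vol ν) {h : S.p → ℂ}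
    (hh : Continuous h) (hint : Integrable (fun X => |S.jacobian X| • h X) vol)
    {Ψ : U ⧸ S.K → ℂ}
    (hΨ : ∀ᵐ y ∂ν, (∀ X, S.Exp X = y → S.jacobian X ≠ 0) ∧
      HasSum (fun X : {X // S.Exp X = y} => h X) (Ψ y)) :
    ∫ X, |S.jacobian X| • h X ∂vol = ∫ y, Ψ y ∂ν := by
  have := borelSpace_quotient S
  have : T2Space (U ⧸ S.K) := t2Space_quotient
  obtain ⟨D, hDm, hDd, hDU, hDinj, hDν⟩ := hν.exists_partition
  have hemb : ∀ n, MeasurableEmbedding ((D n).domRestrict S.Exp) := fun n =>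
    continuous_Exp.continuousOn.measurableEmbedding (hDm n) (hDinj n)
  -- `e n y` is the value of h at the preimage of y in the n-th piece, or 0 if there is none. For
  -- almost every y all preimages are regular and each lies in exactly one piece, so summing over n
  -- gives the fibre sum.
  let e : ℕ → U ⧸ S.K → ℂ := fun n => Function.extend ((D n).domRestrict S.Exp)
    (fun X : D n => h X) 0
  have hem : ∀ n, Measurable (e n) := fun n =>
    (hemb n).measurable_extend (hh.measurable.comp measurable_subtype_coe) measurable_const
  have heD : ∀ n, ∀ X ∈ D n, e n (S.Exp X) = h X := fun n X hX =>
    (hemb n).injective.extend_apply (fun X : D n => h X) 0 ⟨X, hX⟩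
  have he0 : ∀ n, ∀ y ∉ S.Exp '' D n, e n y = 0 := fun n y hy =>
    Function.extend_apply' _ _ _ (by
      rintro ⟨X, rfl⟩
      exact hy ⟨X, X.2, rfl⟩)
  have hWm : Measurable fun X => ENNReal.ofReal |S.jacobian X| :=
    (continuous_jacobian.abs.measurable).ennreal_ofReal
  have hmap := fun n => map_restrict_withDensity (hDm n) (hDν n)
  have hintn : ∀ n, ∫ y, e n y ∂ν = ∫ X in D n, |S.jacobian X| • h X ∂vol := by
    intro n
    rw [← setIntegral_eq_integral_of_forall_compl_eq_zero (he0 n), ← hmap n,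
      integral_map continuous_Exp.aemeasurable (hem n).aestronglyMeasurable,
      setIntegral_congr_fun (hDm n) (heD n),
      setIntegral_withDensity_eq_setIntegral_toReal_smul hWm
        (Filter.Eventually.of_forall fun _ => ENNReal.ofReal_lt_top) _ (hDm n)]
    simp only [ENNReal.toReal_ofReal (abs_nonneg _)]
  have hlintn : ∀ n, ∫⁻ y, ‖e n y‖ₑ ∂ν = ∫⁻ X in D n, ‖|S.jacobian X| • h X‖ₑ ∂vol := by
    intro n
    rw [← setLIntegral_eq_of_support_subset (s := S.Exp '' D n) (f := fun y => ‖e n y‖ₑ), ← hmap n,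
      lintegral_map (hem n).enorm continuous_Exp.measurable,
      setLIntegral_congr_fun (hDm n) (g := fun X => ‖h X‖ₑ) (fun X hX => by
        simp only [heD n X hX]),
      setLIntegral_withDensity_eq_setLIntegral_mul _ hWm hh.measurable.enorm (hDm n)]
    · refine setLIntegral_congr_fun (hDm n) fun X _ => ?_
      simp only [Pi.mul_apply]
      rw [enorm_smul, Real.enorm_eq_ofReal_abs, abs_abs]
    · intro y hy
      by_contra hn
      exact hy (by simp only [he0 n y hn, enorm_zero])
  have hsum : ∀ᵐ y ∂ν, Ψ y = ∑' n, e n y := by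
    filter_upwards [hΨ] with y ⟨hy1, hy2⟩
    have hidx : ∀ X : {X // S.Exp X = y}, ∃ n, (X : S.p) ∈ D n := fun X =>
      Set.mem_iUnion.1 (hDU ▸ hy1 X X.2 : (X : S.p) ∈ ⋃ n, D n)
    choose a ha using hidx
    have hainj : Function.Injective a := fun X X' hXX' => Subtype.ext
      (hDinj (a X) (ha X) (hXX' ▸ ha X') (X.2.trans X'.2.symm))
    refine (HasSum.tsum_eq ?_).symm
    rw [← hainj.hasSum_iff]
    · convert hy2 using 1
      ext X
      rw [Function.comp_apply, ← heD _ _ (ha X), X.2]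
    · intro n hn
      refine he0 n y ?_
      rintro ⟨X, hX, hXy⟩
      refine hn ⟨⟨X, hXy⟩, ?_⟩
      by_contra hne
      exact (hDd hne).le_bot ⟨ha ⟨X, hXy⟩, hX⟩
  rw [integral_congr_ae hsum, integral_tsum (fun n => (hem n).aestronglyMeasurable)]
  · simp_rw [hintn]
    rw [← integral_iUnion hDm hDd hint.integrableOn, hDU,
      setIntegral_eq_integral_of_forall_compl_eq_zero]
    intro X hX
    have : S.jacobian X = 0 := by simpa using hX
    rw [this, abs_zero, zero_smul]
  · simp_rw [hlintn]
    rw [← lintegral_iUnion hDm hDd]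
    exact ((setLIntegral_le_lintegral _ _).trans_lt hint.hasFiniteIntegral).ne

end IsInvariantVolume

end SymmetricPair

end AreaFormula

end Wrapping

end

noncomputable section

namespace Wrapping

/-! ### Sums of a Schwartz function over a lattice. -/

section SchwartzSum

variable {F : Type*} [NormedAddCommGroup F] [NormedSpace ℝ F] [FiniteDimensional ℝ F]
  (L : Submodule ℤ F) [DiscreteTopology L] (μ : SchwartzMap F ℂ)

/-- Rapid decay, together with 1 + ‖γ‖ ≤ (1 + ‖H + γ‖)(1 + |R|), bounds the terms by a multiple of
(1 + ‖γ‖)⁻ⁿ; this is summable once n exceeds the rank. Uniformity in H gives continuity of the sum.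
-/
theorem exists_summable_bound_schwartz (R : ℝ) :
    ∃ b : L → ℝ, Summable b ∧ ∀ (γ : L) (H : F), H ∈ Metric.ball 0 R → ‖μ (H + γ)‖ ≤ b γ := by
  set n := Module.finrank ℤ L + 1
  obtain ⟨C, hC⟩ : ∃ C : ℝ, ∀ X, (1 + ‖X‖) ^ n * ‖μ X‖ ≤ C :=
    ⟨_, fun X => by
      simpa using μ.one_add_le_sup_seminorm_apply (𝕜 := ℝ) (m := (n, 0)) le_rfl le_rfl X⟩
  have hsum : Summable fun γ : L => ((1 + ‖γ‖)⁻¹) ^ n := by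
    refine Summable.of_norm_bounded_eventually
      (ZLattice.summable_norm_pow_inv L n (Nat.lt_succ_self _)) ?_
    -- The comparison with ‖γ‖⁻ⁿ fails at γ = 0, where the inverse is 0 by convention.
    refine (Set.finite_singleton (0 : L)).subset fun γ hγ => ?_
    by_contra h0
    have hpos : 0 < ‖γ‖ := norm_pos_iff.2 h0
    refine hγ ?_
    change ‖((1 + ‖γ‖)⁻¹) ^ n‖ ≤ ‖γ‖⁻¹ ^ n
    rw [Real.norm_of_nonneg (by positivity)]
    gcongr
    linarith
  refine ⟨_, hsum.mul_left (C * (1 + |R|) ^ n), fun γ H hH => ?_⟩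
  have hR : ‖H‖ ≤ |R| := (mem_ball_zero_iff.1 hH).le.trans (le_abs_self R)
  have h1 : 1 + ‖γ‖ ≤ (1 + ‖H + (γ : F)‖) * (1 + |R|) := by
    have : ‖(γ : F)‖ ≤ ‖H + (γ : F)‖ + ‖H‖ := by
      simpa using norm_sub_le (H + (γ : F)) H
    have h2 : ‖γ‖ = ‖(γ : F)‖ := rfl
    nlinarith [norm_nonneg (H + (γ : F)), abs_nonneg R]
  have h3 : (1 + ‖γ‖) ^ n ≤ (1 + ‖H + (γ : F)‖) ^ n * (1 + |R|) ^ n := by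
    rw [← mul_pow]
    gcongr
  rw [inv_pow, ← div_eq_mul_inv, le_div_iff₀ (by positivity)]
  calc ‖μ (H + γ)‖ * (1 + ‖γ‖) ^ n
      ≤ ‖μ (H + γ)‖ * ((1 + ‖H + (γ : F)‖) ^ n * (1 + |R|) ^ n) := by gcongr
    _ = ((1 + ‖H + (γ : F)‖) ^ n * ‖μ (H + γ)‖) * (1 + |R|) ^ n := by ring
    _ ≤ C * (1 + |R|) ^ n := by gcongr; exact hC _

theorem summable_schwartz (H : F) : Summable fun γ : L => μ (H + γ) := by
  obtain ⟨b, hb, hle⟩ := exists_summable_bound_schwartz L μ (‖H‖ + 1)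
  exact Summable.of_norm_bounded hb fun γ => hle γ H (by simp)

theorem continuous_tsum_schwartz : Continuous fun H : F => ∑' γ : L, μ (H + γ) := by
  rw [continuous_iff_continuousAt]
  intro H
  obtain ⟨b, hb, hle⟩ := exists_summable_bound_schwartz L μ (‖H‖ + 1)
  refine (continuousOn_tsum (s := Metric.ball 0 (‖H‖ + 1)) (fun γ => ?_) hb hle).continuousAt
    (Metric.isOpen_ball.mem_nhds (by simp))
  exact (μ.continuous.comp (continuous_id.add continuous_const)).continuousOn

end SchwartzSum

/-! ### The periodization and its extension to U/K. -/

section Periodization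

set_option linter.unusedSectionVars false

variable {E : Type*} [NormedAddCommGroup E] [NormedSpace ℝ E] [FiniteDimensional ℝ E]
  {U : Type*} [TopologicalSpace U] [ChartedSpace E U] [Group U] [LieGroup 𝓘(ℝ, E) ∞ U]
  [IsTopologicalGroup U] [T2Space U] [CompactSpace U] [CompleteSpace E]
  {S : SymmetricPair E U} {𝔞 : Submodule ℝ S.p} {B : E →ₗ[ℝ] E →ₗ[ℝ] ℝ}

namespace SymmetricPair

theorem Exp_AdK (u : S.K) (X : S.p) : S.Exp (S.AdK u X) = (u : U) • S.Exp X := by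
  change ((lieExp U (lieAd (u : U) (X : E)) : U) : U ⧸ S.K) = (((u : U) * lieExp U (X : E) : U) : _)
  rw [← conj_lieExp, QuotientGroup.eq]
  simp [mul_assoc]

theorem IsKInvariant.apply_AdK {φ : S.p → ℂ} (hφ : S.IsKInvariant φ) (u : S.K) (X : S.p) :
    φ (S.AdK u X) = φ X := hφ u u.2 X _ rfl

namespace IsMaximalAbelian

/-- The lattice of a maximal abelian subspace, as a subgroup. -/
def latticeSubmodule (h : S.IsMaximalAbelian 𝔞) : Submodule ℤ S.p :=
  AddSubgroup.toIntSubmodule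
    { carrier := S.lattice 𝔞
      zero_mem' := ⟨𝔞.zero_mem, by simp⟩
      add_mem' := fun {a b} ha hb => ⟨𝔞.add_mem ha.1 hb.1, by
        rw [Submodule.coe_add, lieExp_add_of_lieBr_eq_zero (h.lieBr_eq_zero ha.1 hb.1)]
        exact S.K.mul_mem ha.2 hb.2⟩
      neg_mem' := fun {a} ha => ⟨𝔞.neg_mem ha.1, by
        rw [Submodule.coe_neg, lieExp_neg]
        exact S.K.inv_mem ha.2⟩ }

theorem mem_latticeSubmodule (h : S.IsMaximalAbelian 𝔞) {γ : S.p} :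
    γ ∈ h.latticeSubmodule ↔ γ ∈ S.lattice 𝔞 := Iff.rfl

/-- For γ in the lattice, exp γ is fixed by σ, so exp(-γ) = exp γ; injectivity of exp near 0 leaves
only γ = 0 there. -/
theorem discreteTopology_latticeSubmodule (h : S.IsMaximalAbelian 𝔞) :
    DiscreteTopology h.latticeSubmodule := by
  obtain ⟨r, hr, hinj⟩ := exists_injOn_lieExp E U
  refine discreteTopology_of_isOpen_singleton_zero ?_
  have e : ({0} : Set h.latticeSubmodule) = Subtype.val ⁻¹' Metric.ball (0 : S.p) r := by
    ext γ
    constructor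
    · rintro rfl
      simpa using hr
    · intro hγ
      have hγr : ((γ : S.p) : E) ∈ Metric.ball (0 : E) r := by
        rw [mem_ball_zero_iff]
        exact mem_ball_zero_iff.1 hγ
      have h1 := S.fixed_of_mem _ (h.mem_latticeSubmodule.1 γ.2).2
      rw [σ_lieExp_of_mem_p (γ : S.p).2, ← lieExp_neg] at h1
      have h2 := hinj (by rwa [mem_ball_zero_iff, norm_neg, ← mem_ball_zero_iff]) hγr h1
      have h3 : ((γ : S.p) : E) = 0 := by
        have h4 := eq_neg_iff_add_eq_zero.1 h2.symm
        rw [← two_smul ℝ] at h4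
        simpa using h4
      exact Subtype.ext (Subtype.ext h3)
  rw [e]
  exact Metric.isOpen_ball.preimage continuous_subtype_val

theorem AdK_mem_lattice {w : S.K} (hw : ∀ X ∈ 𝔞, S.AdK w X ∈ 𝔞)
    {γ : S.p} (hγ : γ ∈ S.lattice 𝔞) : S.AdK w γ ∈ S.lattice 𝔞 := by
  refine ⟨hw γ hγ.1, ?_⟩
  rw [coe_AdK, ← conj_lieExp]
  exact S.K.mul_mem (S.K.mul_mem w.2 hγ.2) (S.K.inv_mem w.2)

theorem AdK_inv_mem (w : S.K) (hw : ∀ X ∈ 𝔞, S.AdK w X ∈ 𝔞) :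
    ∀ X ∈ 𝔞, S.AdK w⁻¹ X ∈ 𝔞 := by
  have hinj : Function.Injective (S.AdK w) := fun a b hab => by
    simpa using congrArg (S.AdK w⁻¹) hab
  have heq : 𝔞.map (S.AdK w) = 𝔞 :=
    Submodule.eq_of_le_of_finrank_eq (by rintro _ ⟨X, hX, rfl⟩; exact hw X hX)
      (Submodule.equivMapOfInjective _ hinj 𝔞).finrank_eq.symm
  intro X hX
  rw [← heq] at hX
  obtain ⟨Y, hY, rfl⟩ := hX
  simpa using hY

/-- The periodization of a function on `𝔭` over the lattice. -/
def periodization (h : S.IsMaximalAbelian 𝔞) (μ : S.p → ℂ) (H : S.p) : ℂ :=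
  ∑' γ : h.latticeSubmodule, μ (H + γ)

theorem continuous_periodization (h : S.IsMaximalAbelian 𝔞) (μ : SchwartzMap S.p ℂ) :
    Continuous (h.periodization μ) := by
  have := h.discreteTopology_latticeSubmodule
  exact continuous_tsum_schwartz _ μ

theorem hasSum_periodization (h : S.IsMaximalAbelian 𝔞) (μ : SchwartzMap S.p ℂ) (H : S.p) :
    HasSum (fun γ : S.lattice 𝔞 => μ (H + (γ : S.p))) (h.periodization μ H) := by
  have := h.discreteTopology_latticeSubmodule
  exact (summable_schwartz h.latticeSubmodule μ H).hasSum

theorem periodization_add (h : S.IsMaximalAbelian 𝔞) (μ : S.p → ℂ) (H : S.p) {γ : S.p}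
    (hγ : γ ∈ S.lattice 𝔞) : h.periodization μ (H + γ) = h.periodization μ H := by
  let γ' : h.latticeSubmodule := ⟨γ, hγ⟩
  rw [periodization, periodization, ← (Equiv.addLeft γ').tsum_eq fun δ => μ (H + (δ : S.p))]
  simp [γ', add_assoc]

theorem periodization_AdK (h : S.IsMaximalAbelian 𝔞) {μ : S.p → ℂ} (hμ : S.IsKInvariant μ)
    (w : S.K) (hw : ∀ X ∈ 𝔞, S.AdK w X ∈ 𝔞) (H : S.p) :
    h.periodization μ (S.AdK w H) = h.periodization μ H := by
  let e : h.latticeSubmodule ≃ h.latticeSubmodule :=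
    { toFun := fun γ => ⟨S.AdK w γ, AdK_mem_lattice hw γ.2⟩
      invFun := fun γ => ⟨S.AdK w⁻¹ γ, AdK_mem_lattice (AdK_inv_mem w hw) γ.2⟩
      left_inv := fun γ => Subtype.ext (by simp)
      right_inv := fun γ => Subtype.ext (by simp) }
  rw [periodization, periodization, ← e.tsum_eq]
  refine tsum_congr fun γ => ?_
  change μ (S.AdK w H + S.AdK w (γ : S.p)) = _
  rw [← map_add, hμ.apply_AdK]

theorem periodization_eq (h : S.IsMaximalAbelian 𝔞) (hB : InvariantForm S B) {μ : S.p → ℂ}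
    (hμ : S.IsKInvariant μ) {u u' : S.K} {H H' : S.p} (hH : H ∈ 𝔞) (hH' : H' ∈ 𝔞)
    (e : (u : U) • S.Exp H = (u' : U) • S.Exp H') :
    h.periodization μ H = h.periodization μ H' := by
  have h1 : (((u : U) * lieExp U (H : E) : U) : U ⧸ S.K) = (((u' : U) * lieExp U (H' : E) : U) : _) :=
    e
  rw [QuotientGroup.eq] at h1
  obtain ⟨w, hw, hmem⟩ := h.exists_weyl hB hH hH' (S.K.mul_mem (S.K.inv_mem u'.2) u.2) h1
    (by group)
  rw [← h.periodization_AdK hμ w hw H, ← h.periodization_add μ _ hmem, add_sub_cancel]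

variable [ConnectedSpace U]

theorem exists_smul_Exp (h : S.IsMaximalAbelian 𝔞) (hB : InvariantForm S B) :
    ∃ R : ℝ, ∀ y : U ⧸ S.K, ∃ u : S.K, ∃ H ∈ 𝔞, ‖H‖ ≤ R ∧ (u : U) • S.Exp H = y := by
  obtain ⟨R, hR⟩ := h.exists_decomposition hB
  refine ⟨R, fun y => ?_⟩
  obtain ⟨v, rfl⟩ := QuotientGroup.mk_surjective y
  obtain ⟨k₁, hk₁, H, hH, hn, k₂, hk₂, rfl⟩ := hR v
  refine ⟨⟨k₁, hk₁⟩, H, hH, hn, ?_⟩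
  change ((k₁ * lieExp U (H : E) : U) : U ⧸ S.K) = _
  rw [QuotientGroup.eq]
  simpa [mul_assoc] using hk₂

/-- The `K`-invariant function on `U ⧸ K` whose restriction to the torus is the periodization. -/
theorem exists_continuous_extension (h : S.IsMaximalAbelian 𝔞) (hB : InvariantForm S B)
    {μ : SchwartzMap S.p ℂ} (hμ : S.IsKInvariant μ) :
    ∃ Ψ : U ⧸ S.K → ℂ, Continuous Ψ ∧
      ∀ (u : S.K), ∀ H ∈ 𝔞, Ψ ((u : U) • S.Exp H) = h.periodization μ H := by
  obtain ⟨R, hR⟩ := h.exists_smul_Exp hB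
  -- The choices need not depend continuously on y; `hval` shows that the value does not depend on
  -- them.
  choose u H hH hn hy using hR
  have hval : ∀ (v : S.K), ∀ H' ∈ 𝔞, h.periodization μ (H ((v : U) • S.Exp H')) =
      h.periodization μ H' := fun v H' hH' => h.periodization_eq hB hμ (hH _) hH' (hy _)
  refine ⟨fun y => h.periodization μ (H y), ?_, hval⟩
  have : T2Space (U ⧸ S.K) := t2Space_quotient
  have hcomp : IsCompact ((𝔞 : Set S.p) ∩ Metric.closedBall 0 R) :=
    (isCompact_closedBall (0 : S.p) R).inter_left 𝔞.closed_of_finiteDimensional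
  have : CompactSpace S.K := isCompact_iff_compactSpace.1 isCompact_K
  have : CompactSpace ↑((𝔞 : Set S.p) ∩ Metric.closedBall 0 R) := isCompact_iff_compactSpace.1 hcomp
  let π : S.K × ↑((𝔞 : Set S.p) ∩ Metric.closedBall 0 R) → U ⧸ S.K :=
    fun q => (q.1 : U) • S.Exp q.2
  have hπc : Continuous π := by
    change Continuous fun q : S.K × ↑((𝔞 : Set S.p) ∩ Metric.closedBall 0 R) =>
      (((q.1 : U) * lieExp U ((q.2 : S.p) : E) : U) : U ⧸ S.K)
    exact QuotientGroup.continuous_mk.comp ((continuous_subtype_val.comp continuous_fst).mul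
      (continuous_lieExp.comp (continuous_subtype_val.comp
        (continuous_subtype_val.comp continuous_snd))))
  have hπs : Function.Surjective π := fun y =>
    ⟨(u y, ⟨H y, hH y, by simpa using hn y⟩), hy y⟩
  -- A continuous surjection from a compact space onto a Hausdorff one is a quotient map; the norm
  -- bound on H is what makes the source compact.
  rw [(Topology.IsQuotientMap.of_surjective_continuous hπs hπc).continuous_iff]
  have : (fun y => h.periodization μ (H y)) ∘ π = fun q => h.periodization μ (q.2 : S.p) :=
    funext fun q => hval q.1 q.2 q.2.2.1
  rw [this]
  exact (h.continuous_periodization μ).comp (continuous_subtype_val.comp continuous_snd)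

variable [MeasurableSpace E] [BorelSpace E] [MeasurableSpace U] [BorelSpace U]
  {vol : Measure S.p} [vol.IsAddHaarMeasure] {ν : Measure (U ⧸ S.K)}

/-- Discard the critical values and the image of the exceptional null set. The remaining fibres are
Ad(u)(H + Γ), and μ does not see Ad(u). -/
theorem ae_hasSum_fiber (h : S.IsMaximalAbelian 𝔞) (hB : InvariantForm S B)
    (hν : S.IsInvariantVolume vol ν) {μ : SchwartzMap S.p ℂ} (hμ : S.IsKInvariant μ)
    {Ψ : U ⧸ S.K → ℂ}
    (hΨ : ∀ (u : S.K), ∀ H ∈ 𝔞, Ψ ((u : U) • S.Exp H) = h.periodization μ H) :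
    ∀ᵐ y ∂ν, (∀ X, S.Exp X = y → S.jacobian X ≠ 0) ∧
      HasSum (fun X : {X // S.Exp X = y} => μ X) (Ψ y) := by
  obtain ⟨N, hN, hfib⟩ := h.exists_fiber vol hB
  obtain ⟨R, hR⟩ := h.exists_smul_Exp hB
  filter_upwards [compl_mem_ae_iff.2 (hν.measure_image_eq_zero hN),
    compl_mem_ae_iff.2 hν.measure_image_jacobian_eq_zero] with y hyN hyJ
  have hJ : ∀ X, S.Exp X = y → S.jacobian X ≠ 0 := fun X hX h0 => hyJ ⟨X, h0, hX⟩
  refine ⟨hJ, ?_⟩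
  obtain ⟨v, H₀, hH₀, -, rfl⟩ := hR y
  have hX₀ := Exp_AdK v H₀
  obtain ⟨u, H, hH, hX, hiff⟩ := hfib _ (fun hm => hyN ⟨_, hm, hX₀⟩) (hJ _ hX₀)
  let e : S.lattice 𝔞 → {X // S.Exp X = (v : U) • S.Exp H₀} := fun γ =>
    ⟨S.AdK u (H + γ), ((hiff _).2 ⟨γ, γ.2, rfl⟩).trans hX₀⟩
  have he : Function.Bijective e := by
    constructor
    · intro γ γ' hγ
      have := congrArg (fun X => S.AdK u⁻¹ X.1) hγ
      simp only [e, AdK_inv_AdK, add_right_inj] at this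
      exact Subtype.ext this
    · rintro ⟨X, hXe⟩
      obtain ⟨γ, hγ, rfl⟩ := (hiff X).1 (hXe.trans hX₀.symm)
      exact ⟨⟨γ, hγ⟩, rfl⟩
  have hval : Ψ ((v : U) • S.Exp H₀) = h.periodization μ H := by
    rw [← hX₀, hX, Exp_AdK, hΨ u H hH]
  rw [← (Equiv.ofBijective e he).hasSum_iff, hval]
  convert h.hasSum_periodization μ H using 1
  ext γ
  exact hμ.apply_AdK u _

end IsMaximalAbelian

end SymmetricPair

end Periodization

end Wrapping

end

/-! ### The wrapping theorem. -/

theorem mainTheorem2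
    {E : Type*} [NormedAddCommGroup E] [NormedSpace ℝ E] [FiniteDimensional ℝ E]
    [MeasurableSpace E] [BorelSpace E]
    {U : Type*} [TopologicalSpace U] [ChartedSpace E U] [Group U] [LieGroup 𝓘(ℝ, E) ∞ U]
    [T2Space U] [CompactSpace U] [ConnectedSpace U] [MeasurableSpace U] [BorelSpace U]
    (S : Wrapping.SymmetricPair E U)
    (vol : Measure S.p) [vol.IsAddHaarMeasure]
    (ν : Measure (U ⧸ S.K)) (hν : S.IsInvariantVolume vol ν)
    (j : S.p → ℝ) (hj : S.IsJacobianRoot j)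
    (𝔞 : Submodule ℝ S.p) (h𝔞 : S.IsMaximalAbelian 𝔞)
    (μ : SchwartzMap S.p ℂ) (hμ : S.IsKInvariant μ) :
    ∃ Ψ : U ⧸ S.K → ℂ,
      Continuous Ψ ∧
      (∀ k ∈ S.K, ∀ y : U ⧸ S.K, Ψ (k • y) = Ψ y) ∧
      (∀ f : U ⧸ S.K → ℂ, S.IsSmooth f →
        Integrable (fun X : S.p => ((j X : ℂ) * μ X) * ((j X : ℂ) * f (S.Exp X))) vol ∧
        S.wrap vol j (fun X => (j X : ℂ) * μ X) f = ∫ y, Ψ y * f y ∂ν) ∧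
      ∀ H ∈ 𝔞, HasSum (fun γ : S.lattice 𝔞 => μ (H + (γ : S.p))) (Ψ (S.Exp H)) := by
  have : IsTopologicalGroup U := topologicalGroup_of_lieGroup 𝓘(ℝ, E) ∞
  have : CompleteSpace E := FiniteDimensional.complete ℝ E
  obtain ⟨B, hB⟩ := Wrapping.exists_invariantForm S
  obtain ⟨Ψ, hΨc, hΨ⟩ := h𝔞.exists_continuous_extension hB hμ
  obtain ⟨R, hR⟩ := h𝔞.exists_smul_Exp hB
  refine ⟨Ψ, hΨc, fun k hk y => ?_, fun f hf => ?_, fun H hH => ?_⟩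
  · obtain ⟨u, H, hH, -, rfl⟩ := hR y
    have h1 := hΨ (⟨k, hk⟩ * u) H hH
    rw [Subgroup.coe_mul, mul_smul] at h1
    rw [hΨ u H hH]
    exact h1
  · have hfc : Continuous f := QuotientGroup.isOpenQuotientMap_mk.isQuotientMap.continuous_iff.2
      (ContMDiff.continuous hf)
    have hc : Continuous fun X : S.p => f (S.Exp X) :=
      hfc.comp Wrapping.SymmetricPair.continuous_Exp
    -- The two factors j combine to |J|, so the choice of the square root plays no part.
    have heq : ∀ X : S.p, ((j X : ℂ) * μ X) * ((j X : ℂ) * f (S.Exp X)) =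
        |S.jacobian X| • (μ X * f (S.Exp X)) := fun X => by
      rw [← hj X, Complex.real_smul]
      push_cast
      ring
    have hint : Integrable (fun X : S.p => |S.jacobian X| • (μ X * f (S.Exp X))) vol := by
      obtain ⟨C, hC⟩ := S.exists_abs_jacobian_le
      obtain ⟨C', hC'⟩ := isCompact_univ.exists_bound_of_continuousOn hfc.continuousOn
      have h1 : Integrable (fun X : S.p => μ X * f (S.Exp X)) vol :=
        μ.integrable.mul_bdd (c := C') hc.aestronglyMeasurable
          (Filter.Eventually.of_forall fun X => hC' _ (Set.mem_univ _))
      exact h1.bdd_smul C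
        Wrapping.SymmetricPair.continuous_jacobian.abs.aestronglyMeasurable
        (Filter.Eventually.of_forall fun X => by simpa using hC X)
    simp only [Wrapping.SymmetricPair.wrap, heq]
    refine ⟨hint, hν.integral_abs_jacobian_mul (μ.continuous.mul hc) hint ?_⟩
    filter_upwards [h𝔞.ae_hasSum_fiber hB hν hμ hΨ] with y ⟨hy1, hy2⟩
    refine ⟨hy1, ?_⟩
    -- On a fibre f ∘ Exp is constant, so it factors out of the sum.
    have e : (fun X : {X // S.Exp X = y} => μ X * f (S.Exp X)) =
        fun X : {X // S.Exp X = y} => μ X * f y :=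
      funext fun X => by rw [X.2]
    have hsum := hy2.mul_right (f y)
    rw [← e] at hsum
    exact hsum
  · have := hΨ 1 H hH
    rw [Subgroup.coe_one, one_smul] at this
    rw [this]
    exact h𝔞.hasSum_periodization μ H
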